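/- For $a=(a_{ijk})\in\mathbb C^{3\times4\times5}$ let $M_a$ be the $3\times4$ matrix of linear forms in $x=(x_1,\dots,x_5)$ with entries $(M_a)_{ij}=\sum_{k}a_{ijk}x_k$, and let $X_a\subset\mathbb C^5$ be the scheme defined by the $3$-minors of $M_a$. Let $W\subset \mathrm{Mat}_{3,4}(\mathbb C)\times\mathbb P^2$ be the Zariski closure of the set of pairs $(B,[s])$ with $\operatorname{rank}B=2$ and $s^{T}B=0$ (the graph of the map sending a matrix of rank $2$ to the hyperplane spanned by its columns). The Tjurina transform of $X_a$ is the fibre product $Y_a\subset\mathbb C^5\times\mathbb P^2$ of $X_a$ and $W$ over the variety of $3\times 4$ matrices of rank $<3$. A finite set of points of $\mathbb P^2$ is said to be in general position if for every $d$ no $\binom{d+2}{2}$ of its points lie on a curve of degree $d$ (no three on a line, no six on a conic, no ten on a cubic, and so on). Corollary (10 points). There is a non-empty Zariski open set of coefficients $a\in\mathbb C^{3\times4\times5}$ such that for every $a$ in it, $(X_a,0)\subset(\mathbb C^5,0)$ is an ICMC2 singularity of type $(3,4,3)$, that is, $X_a$ has the expected codimension $2$ in $\mathbb C^5$ and an isolated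 singularity at $0$, and the singular locus of the Tjurina transform $Y_a$ (the set of points at which its local ring is not regular) is $\{0\}\times\Sigma$, where $\Sigma\subset\mathbb P^2$ consists of exactly $10$ points in general position. -/

import Mathlib

open MvPolynomial

noncomputable section

namespace Determinantal

/-! ### Points of affine schemes over `ℂ` -/

/-- The local ring at the point `p` of the affine scheme `V(I) ⊆ ℂ^σ`
(the zero ring if `p` does not lie on `V(I)`). -/
abbrev LocalRingAt {σ : Type} (I : Ideal (MvPolynomial σ ℂ)) (p : σ → ℂ) : Type :=
  Localization.AtPrime (vanishingIdeal ℂ ({p} : Set (σ → ℂ))) ⧸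
    I.map (algebraMap (MvPolynomial σ ℂ)
      (Localization.AtPrime (vanishingIdeal ℂ ({p} : Set (σ → ℂ)))))

/-- The set of singular points of the affine scheme `V(I) ⊆ ℂ^σ`: the points of `V(I)` at which
the local ring is not regular. -/
def singularPoints {σ : Type} (I : Ideal (MvPolynomial σ ℂ)) : Set (σ → ℂ) :=
  {p | p ∈ zeroLocus ℂ I ∧ ¬ IsRegularLocalRing (LocalRingAt I p)}

/-! ### Determinantal varieties -/

/-- The ideal of `t`-minors of a matrix. -/
def minorIdeal {R : Type} [CommRing R] {m n : ℕ} (t : ℕ) (M : Matrix (Fin m) (Fin n) R) :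
    Ideal R :=
  Ideal.span {d | ∃ (r : Fin t ↪o Fin m) (c : Fin t ↪o Fin n), d = (M.submatrix r c).det}

/-- For a polynomial map `M` from `ℂ^N` to the space of `m × n` matrices, `X = V(t`-minors of `M)`
is a determinantal variety of type `(m, n, t)`, i.e. `X` has the expected codimension
`(m - t + 1)(n - t + 1)` in `ℂ^N`. -/
def IsDeterminantalVariety {N m n : ℕ} (t : ℕ)
    (M : Matrix (Fin m) (Fin n) (MvPolynomial (Fin N) ℂ)) : Prop :=
  1 ≤ t ∧ t ≤ m ∧ t ≤ n ∧
    ringKrullDim (MvPolynomial (Fin N) ℂ ⧸ minorIdeal t M) +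
      (((m - t + 1) * (n - t + 1) : ℕ) : WithBot ℕ∞) = ((N : ℕ) : WithBot ℕ∞)

/-- The scheme `V(I)` in `ℂ^N` has an isolated singularity at the origin. -/
def HasIsolatedSingularityAtZero {N : ℕ} (I : Ideal (MvPolynomial (Fin N) ℂ)) : Prop :=
  0 ∈ singularPoints I ∧ ∃ U : Set (Fin N → ℂ), IsOpen U ∧ 0 ∈ U ∧ U ∩ singularPoints I = {0}

/-- The `t × (t+1)` matrix `M` defines an isolated Cohen-Macaulay codimension 2 singularity at the
origin: its `t`-minors define a determinantal variety of type `(t, t+1, t)` (so of codimension 2)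
with an isolated singularity at the origin. -/
def IsICMC2 {N t : ℕ} (M : Matrix (Fin t) (Fin (t + 1)) (MvPolynomial (Fin N) ℂ)) : Prop :=
  IsDeterminantalVariety t M ∧ HasIsolatedSingularityAtZero (minorIdeal t M)

/-- The matrix of linear forms `∑ₖ a (i, j, k) xₖ` with coefficients `a`. -/
def linearMatrix {N m n : ℕ} (a : Fin m × Fin n × Fin N → ℂ) :
    Matrix (Fin m) (Fin n) (MvPolynomial (Fin N) ℂ) :=
  Matrix.of fun i j => ∑ k, C (a (i, j, k)) * X k

/-! ### The Tjurina transform, for maximal minors (`t = m ≤ n`)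

The columns of an `m × n` matrix `B` of rank `m - 1` span a hyperplane of `ℂ^m`, i.e. a point
`[s]` of the Grassmannian of hyperplanes `≅ ℙ^{m-1}`, where `s ≠ 0` and `sᵀ B = 0`. `W` is the
closure in `Mat(m, n) × ℙ^{m-1}` of the graph of `B ↦ [s]`, and the Tjurina transform of
`X = M⁻¹(matrices of rank < m)` is the fibre product `Y ⊆ ℂ^N × ℙ^{m-1}` of `X` and `W` over
the space of matrices of rank `< m`, i.e. the preimage of `W` under `M × id`.

We describe the chart `s_i ≠ 0` of `ℙ^{m-1}` as the affine space `{s | s_i = 1} ⊆ ℂ^m`. -/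

/-- The graph of `B ↦ [s]` on matrices of rank exactly `m - 1`, in the chart `s_i = 1`.
A point of the ambient space `ℂ^{m × n} × ℂ^m` is a function on `(Fin m × Fin n) ⊕ Fin m`. -/
def graphChart (m n : ℕ) (i : Fin m) : Set ((Fin m × Fin n) ⊕ Fin m → ℂ) :=
  {q | (Matrix.of fun j k => q (Sum.inl (j, k)) : Matrix (Fin m) (Fin n) ℂ).rank + 1 = m ∧
    q (Sum.inr i) = 1 ∧
    Matrix.vecMul (fun j => q (Sum.inr j))
      (Matrix.of fun j k => q (Sum.inl (j, k)) : Matrix (Fin m) (Fin n) ℂ) = 0}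

/-- The comorphism of `M × id : ℂ^N × ℂ^m → ℂ^{m × n} × ℂ^m`. -/
def pullback {N m n : ℕ} (M : Matrix (Fin m) (Fin n) (MvPolynomial (Fin N) ℂ)) :
    MvPolynomial ((Fin m × Fin n) ⊕ Fin m) ℂ →ₐ[ℂ] MvPolynomial (Fin N ⊕ Fin m) ℂ :=
  aeval (Sum.elim (fun jk => rename Sum.inl (M jk.1 jk.2)) (fun j => X (Sum.inr j)))

/-- The ideal of the Tjurina transform of `M` in the chart `s_i = 1`: the extension along `M × id`
of the ideal of the closure of the graph. -/
def tjurinaIdeal {N m n : ℕ} (M : Matrix (Fin m) (Fin n) (MvPolynomial (Fin N) ℂ)) (i : Fin m) :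
    Ideal (MvPolynomial (Fin N ⊕ Fin m) ℂ) :=
  (vanishingIdeal ℂ (graphChart m n i)).map (pullback M)

/-- The singular locus, in `ℂ^N × ℙ^{m-1}`, of the Tjurina transform of `M`. -/
def tjurinaSingularLocus {N m n : ℕ} (M : Matrix (Fin m) (Fin n) (MvPolynomial (Fin N) ℂ)) :
    Set ((Fin N → ℂ) × Projectivization ℂ (Fin m → ℂ)) :=
  {q | ∃ i, q.2.rep i ≠ 0 ∧
    Sum.elim q.1 ((q.2.rep i)⁻¹ • q.2.rep) ∈ singularPoints (tjurinaIdeal M i)}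

/-! ### General position -/

/-- A finite set of points of `ℙ²` is in general position if, for every `d`, no
`(d + 2 choose 2) = dim ℂ[x, y, z]_d` of them lie on a curve of degree `d`
(no three on a line, no six on a conic, no ten on a cubic, ...). -/
def InGeneralPosition (S : Finset (Projectivization ℂ (Fin 3 → ℂ))) : Prop :=
  ∀ (d : ℕ) (T : Finset (Projectivization ℂ (Fin 3 → ℂ))), T ⊆ S → T.card = (d + 2).choose 2 →
    ∀ f : MvPolynomial (Fin 3) ℂ, f.IsHomogeneous d → (∀ p ∈ T, eval p.rep f = 0) → f = 0

end Determinantal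

end

/-!
Write `C(s) = ∑ᵢ sᵢ a(i, ·, ·)`, a `4 × 5` matrix. Since `sᵀ M_a(x) = C(s) x`, the Tjurina
transform is cut out by `C(s) x = 0`, and by the Jacobian criterion it is singular exactly at the
points `(0, [s])` at which `C(s)` drops rank, i.e. at the zeros of its five maximal minors, which
are forms of degree four in `s`.

For general `a` the minors together with `X₀` times the cubic forms span the quartic forms, so that
every `Xᵢ f / X₀` is a well-defined cubic form modulo the minors for a cubic form `f`. The joint
eigenvalues of these multiplications on the ten-dimensional space of cubics are the coordinates of
the zeros, so there are exactly ten reduced zeros as soon as the characteristic polynomial of the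
multiplication by `X₁` is separable. General position is then the nonvanishing of a symmetric
function of its roots, hence of a polynomial in `a`. This polynomial is not zero because of an
explicit `a` whose minors vanish at the points `(1, t, t⁴)`, `1 ≤ t ≤ 10`: a curve of degree `d`
through `(d + 2 choose 2)` of them is a polynomial in `t` with too many positive roots for
Descartes' rule of signs.
-/

noncomputable section

namespace Determinantal

open scoped Matrix

section ContractedMatrices

variable {R S : Type*} [CommRing R] [CommRing S] {l m n : ℕ}

/-- The matrix `∑ᵢ sᵢ a(i, ·, ·)`. Applied to `x` it gives the row `sᵀ M_a(x)`, so its kernel is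
the fibre over `[s]` of the incidence variety `{(x, [s]) | sᵀ M_a(x) = 0}`. -/
def contractRows (a : Fin l × Fin m × Fin n → R) (s : Fin l → R) : Matrix (Fin m) (Fin n) R :=
  Matrix.of fun j k => ∑ i, a (i, j, k) * s i

/-- The value `M_a(x)` at the point `x` of the matrix of linear forms with coefficients `a`. -/
def matrixAt (a : Fin l × Fin m × Fin n → R) (x : Fin n → R) : Matrix (Fin l) (Fin m) R :=
  Matrix.of fun i j => ∑ k, a (i, j, k) * x k

theorem vecMul_matrixAt (a : Fin l × Fin m × Fin n → R) (s : Fin l → R) (x : Fin n → R) :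
    s ᵥ* matrixAt a x = contractRows a s *ᵥ x := by
  ext j
  simp only [Matrix.vecMul, Matrix.mulVec, dotProduct, matrixAt, contractRows, Matrix.of_apply,
    Finset.mul_sum, Finset.sum_mul]
  rw [Finset.sum_comm]
  exact Finset.sum_congr rfl fun _ _ => Finset.sum_congr rfl fun _ _ => by ring

theorem dotProduct_matrixAt_mulVec (a : Fin l × Fin m × Fin n → R) (s : Fin l → R) (y : Fin m → R)
    (x : Fin n → R) : s ⬝ᵥ matrixAt a x *ᵥ y = y ⬝ᵥ contractRows a s *ᵥ x := by
  rw [Matrix.dotProduct_mulVec, vecMul_matrixAt, dotProduct_comm]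

theorem map_linearMatrix_eval (a : Fin l × Fin m × Fin n → ℂ) (x : Fin n → ℂ) :
    (linearMatrix a).map (eval x) = matrixAt a x := by
  ext i j
  simp [linearMatrix, matrixAt]

end ContractedMatrices

section FirstOrderPoints

variable {k M ι : Type*}

/-- The point `p + v` of the first order neighbourhood of `p`, for a tangent vector `v` with
coefficients in `M`. For `M = k` these are the points over the dual numbers. -/
def firstOrderPoint [AddZeroClass k] [AddZeroClass M] (p : ι → k) (v : ι → M) (i : ι) :
    TrivSqZeroExt k M :=
  TrivSqZeroExt.inl (p i) + TrivSqZeroExt.inr (v i)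

end FirstOrderPoints

section EmbeddingDimension

variable {A k M ι : Type*} [CommRing A] [IsLocalRing A] [Field k] [AddCommGroup M] [Module k M]
  [Module kᵐᵒᵖ M] [IsCentralScalar k M] {ψ : A →+* TrivSqZeroExt k M}

theorem fst_eq_zero_iff_mem_maximalIdeal (hψ : Function.Surjective fun x => (ψ x).fst) {x : A} :
    (ψ x).fst = 0 ↔ x ∈ IsLocalRing.maximalIdeal A := by
  let φ : A →+* k := (TrivSqZeroExt.fstHom k k M).toRingHom.comp ψ
  rw [← IsLocalRing.eq_maximalIdeal (RingHom.ker_isMaximal_of_surjective φ hψ)]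
  rfl

theorem snd_mem_span_of_mem_span (hψ : Function.Surjective fun x => (ψ x).fst) {s : Set A}
    (hs : s ⊆ IsLocalRing.maximalIdeal A) {x : A} (hx : x ∈ Ideal.span s) :
    (ψ x).snd ∈ Submodule.span k ((fun y => (ψ y).snd) '' s) := by
  induction hx using Submodule.span_induction with
  | mem y hy => exact Submodule.subset_span ⟨y, hy, rfl⟩
  | zero => simp
  | add y z _ _ ihy ihz =>
    rw [map_add, TrivSqZeroExt.snd_add]
    exact add_mem ihy ihz
  | smul c y hy ih =>
    rw [smul_eq_mul, map_mul, TrivSqZeroExt.snd_mul,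
      (fst_eq_zero_iff_mem_maximalIdeal hψ).2 (Ideal.span_le.2 hs hy), MulOpposite.op_zero,
      zero_smul, add_zero]
    exact Submodule.smul_mem _ _ ih

theorem finrank_le_spanFinrank_maximalIdeal [IsNoetherianRing A]
    (hψ : Function.Surjective fun x => (ψ x).fst) {z : ι → A} {v : ι → M}
    (hz : ∀ i, ψ (z i) = TrivSqZeroExt.inr (v i)) (hv : Submodule.span k (Set.range v) = ⊤) :
    Module.finrank k M ≤ (IsLocalRing.maximalIdeal A).spanFinrank := by
  have hfg : (IsLocalRing.maximalIdeal A).FG := IsNoetherian.noetherian _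
  set s := (IsLocalRing.maximalIdeal A).generators
  have hs : Ideal.span s = IsLocalRing.maximalIdeal A := Submodule.span_generators _
  have hfin : s.Finite := Submodule.FG.finite_generators hfg
  have htop : Submodule.span k ((fun y => (ψ y).snd) '' s) = ⊤ := by
    rw [← top_le_iff, ← hv, Submodule.span_le]
    rintro _ ⟨i, rfl⟩
    have hzi : z i ∈ Ideal.span s := by
      rw [hs, ← fst_eq_zero_iff_mem_maximalIdeal hψ, hz, TrivSqZeroExt.fst_inr]
    have := snd_mem_span_of_mem_span hψ (hs ▸ Ideal.subset_span) hzi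
    rwa [hz, TrivSqZeroExt.snd_inr] at this
  have := (hfin.image fun y => (ψ y).snd).fintype
  calc Module.finrank k M = Module.finrank k (Submodule.span k ((fun y => (ψ y).snd) '' s)) := by
        rw [htop, finrank_top]
    _ ≤ ((fun y => (ψ y).snd) '' s).toFinset.card := finrank_span_le_card _
    _ = ((fun y => (ψ y).snd) '' s).ncard := (Set.ncard_eq_toFinset_card' _).symm
    _ ≤ s.ncard := Set.ncard_image_le hfin
    _ = (IsLocalRing.maximalIdeal A).spanFinrank := Submodule.FG.generators_ncard hfg

end EmbeddingDimension

section LocalRings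

variable {σ : Type}

/-- The maximal ideal of a point of affine space. -/
abbrev pointIdeal (p : σ → ℂ) : Ideal (MvPolynomial σ ℂ) := vanishingIdeal ℂ ({p} : Set (σ → ℂ))

/-- The local ring of affine space at a point. -/
abbrev AffineLocalRing (p : σ → ℂ) : Type := Localization.AtPrime (pointIdeal p)

instance [Finite σ] (p : σ → ℂ) : IsNoetherianRing (AffineLocalRing p) :=
  IsLocalization.isNoetherianRing (pointIdeal p).primeCompl _ inferInstance

instance [Finite σ] (I : Ideal (MvPolynomial σ ℂ)) (p : σ → ℂ) :
    IsNoetherianRing (LocalRingAt I p) :=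
  Ideal.Quotient.isNoetherianRing _

theorem mem_pointIdeal {p : σ → ℂ} {f : MvPolynomial σ ℂ} : f ∈ pointIdeal p ↔ eval p f = 0 := by
  rw [mem_vanishingIdeal_singleton_iff, aeval_eq_eval]

theorem mem_zeroLocus_iff_le {I : Ideal (MvPolynomial σ ℂ)} {p : σ → ℂ} :
    p ∈ zeroLocus ℂ I ↔ I ≤ pointIdeal p := by
  rw [← le_zeroLocus_iff_le_vanishingIdeal]
  exact Set.singleton_subset_iff.symm

theorem mem_zeroLocus_span {G : Set (MvPolynomial σ ℂ)} {p : σ → ℂ} :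
    p ∈ zeroLocus ℂ (Ideal.span G) ↔ ∀ g ∈ G, eval p g = 0 := by
  rw [mem_zeroLocus_iff_le, Ideal.span_le]
  exact forall₂_congr fun _ _ => mem_pointIdeal

theorem isUnit_algebraMap_of_eval_ne_zero {p : σ → ℂ} {u : MvPolynomial σ ℂ} (hu : eval p u ≠ 0) :
    IsUnit (algebraMap (MvPolynomial σ ℂ) (AffineLocalRing p) u) :=
  IsLocalization.map_units (AffineLocalRing p)
    (⟨u, fun h => hu (mem_pointIdeal.1 h)⟩ : (pointIdeal p).primeCompl)

theorem map_le_maximalIdeal {I : Ideal (MvPolynomial σ ℂ)} {p : σ → ℂ} (hp : p ∈ zeroLocus ℂ I) :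
    I.map (algebraMap (MvPolynomial σ ℂ) (AffineLocalRing p)) ≤
      IsLocalRing.maximalIdeal (AffineLocalRing p) := by
  rw [← Localization.AtPrime.map_eq_maximalIdeal]
  exact Ideal.map_mono (mem_zeroLocus_iff_le.1 hp)

theorem isLocalRing_localRingAt {I : Ideal (MvPolynomial σ ℂ)} {p : σ → ℂ}
    (hp : p ∈ zeroLocus ℂ I) : IsLocalRing (LocalRingAt I p) := by
  have := Ideal.Quotient.nontrivial_iff.2 fun h =>
    (IsLocalRing.maximalIdeal.isMaximal (AffineLocalRing p)).ne_top
      (top_le_iff.1 (h.ge.trans (map_le_maximalIdeal hp)))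
  exact IsLocalRing.of_surjective' _ Ideal.Quotient.mk_surjective

section Tangent

variable {M : Type*} [AddCommGroup M] [Module ℂ M] [Module ℂᵐᵒᵖ M] [IsCentralScalar ℂ M]

/-- The first order Taylor expansion `f ↦ f(p) + df_p(v)`, as evaluation at `p + v`. -/
def firstOrderEval (p : σ → ℂ) (v : σ → M) : MvPolynomial σ ℂ →ₐ[ℂ] TrivSqZeroExt ℂ M :=
  aeval (firstOrderPoint p v)

theorem fst_firstOrderEval (p : σ → ℂ) (v : σ → M) (f : MvPolynomial σ ℂ) :
    (firstOrderEval p v f).fst = eval p f := by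
  have hcomp : (TrivSqZeroExt.fstHom ℂ ℂ M).comp (firstOrderEval p v) = aeval p := by
    ext i
    simp [firstOrderEval, firstOrderPoint]
  rw [← aeval_eq_eval, ← hcomp]
  rfl

/-- The extension of `firstOrderEval` to the local ring of affine space. -/
def tangentHom (p : σ → ℂ) (v : σ → M) : AffineLocalRing p →+* TrivSqZeroExt ℂ M :=
  IsLocalization.lift (M := (pointIdeal p).primeCompl) (g := (firstOrderEval p v).toRingHom)
    fun f => by
      rw [TrivSqZeroExt.isUnit_iff_isUnit_fst, isUnit_iff_ne_zero]
      exact fun h => f.2 (mem_pointIdeal.2 ((fst_firstOrderEval p v f).symm.trans h))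

theorem tangentHom_algebraMap (p : σ → ℂ) (v : σ → M) (f : MvPolynomial σ ℂ) :
    tangentHom p v (algebraMap (MvPolynomial σ ℂ) (AffineLocalRing p) f) = firstOrderEval p v f :=
  IsLocalization.lift_eq _ _

theorem finrank_le_spanFinrank_of_extends_firstOrderEval {A : Type*} [CommRing A] [IsLocalRing A]
    [IsNoetherianRing A] {p : σ → ℂ} {v : σ → M} (f : MvPolynomial σ ℂ →+* A)
    (ψ : A →+* TrivSqZeroExt ℂ M) (hψ : ∀ g, ψ (f g) = firstOrderEval p v g)
    (hv : Submodule.span ℂ (Set.range v) = ⊤) :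
    Module.finrank ℂ M ≤ (IsLocalRing.maximalIdeal A).spanFinrank := by
  refine finrank_le_spanFinrank_maximalIdeal (ψ := ψ) (fun c => ⟨f (C c), ?_⟩)
    (z := fun i => f (X i - C (p i))) (v := v) (fun i => ?_) hv
  · simp only [hψ, fst_firstOrderEval, eval_C]
  · rw [hψ]
    simp [firstOrderEval, firstOrderPoint, TrivSqZeroExt.algebraMap_eq_inl]

theorem not_isRegularLocalRing_localRingAt [Finite σ] {I : Ideal (MvPolynomial σ ℂ)} {p : σ → ℂ}
    {v : σ → M} (hI : I ≤ RingHom.ker (firstOrderEval p v))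
    (hv : Submodule.span ℂ (Set.range v) = ⊤)
    (hdim : ringKrullDim (LocalRingAt I p) < (Module.finrank ℂ M : WithBot ℕ∞)) :
    ¬ IsRegularLocalRing (LocalRingAt I p) := by
  intro hreg
  have hker : I.map (algebraMap (MvPolynomial σ ℂ) (AffineLocalRing p)) ≤
      RingHom.ker (tangentHom p v) :=
    Ideal.map_le_iff_le_comap.2 fun f hf => (tangentHom_algebraMap p v f).trans (hI hf)
  have := hreg.toIsLocalRing
  have hle := finrank_le_spanFinrank_of_extends_firstOrderEval (A := LocalRingAt I p)
    ((Ideal.Quotient.mk _).comp (algebraMap (MvPolynomial σ ℂ) (AffineLocalRing p)))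
    (Ideal.Quotient.lift _ (tangentHom p v) hker)
    (fun g => tangentHom_algebraMap p v g) hv
  rw [← hreg.spanFinrank_maximalIdeal] at hdim
  exact absurd hle (not_le.2 (by exact_mod_cast hdim))

theorem card_le_ringKrullDim_affineLocalRing [Fintype σ] (p : σ → ℂ) :
    (Fintype.card σ : WithBot ℕ∞) ≤ ringKrullDim (AffineLocalRing p) := by
  have hreg : IsRegularLocalRing (AffineLocalRing p) := inferInstance
  rw [← hreg.spanFinrank_maximalIdeal, ← Module.finrank_fintype_fun_eq_card ℂ]
  exact_mod_cast finrank_le_spanFinrank_of_extends_firstOrderEval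
    (algebraMap (MvPolynomial σ ℂ) (AffineLocalRing p)) (tangentHom p _)
    (tangentHom_algebraMap p _) (Pi.basisFun ℂ σ).span_eq

end Tangent

end LocalRings

section Gradients

variable {σ : Type}

/-- The differential of a polynomial at the point `p`, as a vector of partial derivatives. -/
def gradient (p : σ → ℂ) : MvPolynomial σ ℂ →ₗ[ℂ] (σ → ℂ) :=
  LinearMap.pi fun i => (aeval p).toLinearMap ∘ₗ (pderiv i : Derivation ℂ _ _).toLinearMap

theorem gradient_apply (p : σ → ℂ) (f : MvPolynomial σ ℂ) (i : σ) :
    gradient p f i = eval p (pderiv i f) := by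
  simp [gradient, aeval_eq_eval]

theorem gradient_mul (p : σ → ℂ) (f g : MvPolynomial σ ℂ) :
    gradient p (f * g) = eval p f • gradient p g + eval p g • gradient p f := by
  ext i
  simp [gradient_apply, Derivation.leibniz]

theorem gradient_C (p : σ → ℂ) (c : ℂ) : gradient p (C c) = 0 := by
  ext i
  simp [gradient_apply]

theorem gradient_X [DecidableEq σ] (p : σ → ℂ) (i : σ) : gradient p (X i) = Pi.single i 1 := by
  ext j
  simp [gradient_apply, pderiv_X, Pi.single_apply, apply_ite (eval p), eq_comm]

theorem taylor_mem_sq [Fintype σ] (p : σ → ℂ) (f : MvPolynomial σ ℂ) :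
    f - C (eval p f) - ∑ i, C (gradient p f i) * (X i - C (p i)) ∈ pointIdeal p ^ 2 := by
  classical
  have hX : ∀ i, (X i - C (p i) : MvPolynomial σ ℂ) ∈ pointIdeal p :=
    fun i => mem_pointIdeal.2 (by simp)
  induction f using MvPolynomial.induction_on with
  | C c => simp [gradient_C]
  | add f g hf hg =>
    convert add_mem hf hg using 1
    simp only [map_add, Pi.add_apply, add_mul, Finset.sum_add_distrib]
    ring
  | mul_X f n hf =>
    have hsum : ∑ i, C (gradient p (f * X n) i) * (X i - C (p i) : MvPolynomial σ ℂ) =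
        C (p n) * ∑ i, C (gradient p f i) * (X i - C (p i)) +
          C (eval p f) * (X n - C (p n)) := by
      simp [gradient_mul, gradient_X, add_mul, Finset.sum_add_distrib, Finset.mul_sum, mul_assoc,
        Pi.single_apply, apply_ite C, ite_mul, add_comm]
    have hprod : (∑ i, C (gradient p f i) * (X i - C (p i) : MvPolynomial σ ℂ)) *
        (X n - C (p n)) ∈ pointIdeal p ^ 2 := by
      rw [pow_two]
      exact Ideal.mul_mem_mul (Ideal.sum_mem _ fun i _ => Ideal.mul_mem_left _ _ (hX i)) (hX n)
    rw [hsum]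
    convert add_mem (Ideal.mul_mem_right (X n) _ hf) hprod using 1
    simp only [map_mul, eval_X]
    ring

theorem pointIdeal_le_sup_sq [Finite σ] {p : σ → ℂ} {S : Set (MvPolynomial σ ℂ)}
    (hS : ∀ f ∈ S, eval p f = 0) (h : Submodule.span ℂ (gradient p '' S) = ⊤) :
    pointIdeal p ≤ Ideal.span S ⊔ pointIdeal p ^ 2 := by
  have := Fintype.ofFinite σ
  intro f hf
  obtain ⟨g, hg, hgf⟩ : gradient p f ∈ (Submodule.span ℂ S).map (gradient p) := by
    rw [Submodule.map_span, h]
    trivial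
  have hgS : g ∈ Ideal.span S :=
    (Submodule.span_le (p := (Ideal.span S).restrictScalars ℂ)).2 Ideal.subset_span hg
  have hgp : g ∈ pointIdeal p := Ideal.span_le.2 (fun x hx => mem_pointIdeal.2 (hS x hx)) hgS
  have hfg : f - g ∈ pointIdeal p ^ 2 := by
    simpa [hgf, mem_pointIdeal.1 hf, mem_pointIdeal.1 hgp] using taylor_mem_sq p (f - g)
  rw [← add_sub_cancel g f]
  exact add_mem (Ideal.mem_sup_left hgS) (Ideal.mem_sup_right hfg)

theorem maximalIdeal_affineLocalRing_eq_map_span [Finite σ] {p : σ → ℂ}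
    {S : Set (MvPolynomial σ ℂ)} (hS : ∀ f ∈ S, eval p f = 0)
    (h : Submodule.span ℂ (gradient p '' S) = ⊤) :
    IsLocalRing.maximalIdeal (AffineLocalRing p) = (Ideal.span S).map
      (algebraMap (MvPolynomial σ ℂ) (AffineLocalRing p)) := by
  refine le_antisymm ?_ ?_
  · refine Submodule.le_of_le_smul_of_le_jacobson_bot (IsNoetherian.noetherian _)
      (IsLocalRing.jacobson_eq_maximalIdeal _ bot_ne_top).ge ?_
    have hle := Ideal.map_mono (f := algebraMap (MvPolynomial σ ℂ) (AffineLocalRing p))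
      (pointIdeal_le_sup_sq hS h)
    rwa [Ideal.map_sup, Ideal.map_pow, Localization.AtPrime.map_eq_maximalIdeal, pow_two] at hle
  · exact map_le_maximalIdeal (mem_zeroLocus_span.2 hS)

theorem exists_span_gradient_eq_top [Fintype σ] {κ : Type*} [Fintype κ] {p : σ → ℂ}
    {f : κ → MvPolynomial σ ℂ} (hli : LinearIndependent ℂ fun l => gradient p (f l)) :
    ∃ g : Fin (Fintype.card σ - Fintype.card κ) → MvPolynomial σ ℂ, (∀ j, eval p (g j) = 0) ∧
      Submodule.span ℂ (gradient p '' (Set.range f ∪ Set.range g)) = ⊤ := by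
  classical
  obtain ⟨W, hW⟩ := (Submodule.span ℂ (Set.range fun l => gradient p (f l))).exists_isCompl
  have hWrank : Module.finrank ℂ W = Fintype.card σ - Fintype.card κ := by
    have := Submodule.finrank_add_eq_of_isCompl hW
    rw [finrank_span_eq_card hli, Module.finrank_fintype_fun_eq_card] at this
    omega
  let b := Module.finBasisOfFinrankEq ℂ W hWrank
  let g : Fin (Fintype.card σ - Fintype.card κ) → MvPolynomial σ ℂ := fun j =>
    ∑ i, C ((b j : σ → ℂ) i) * (X i - C (p i))
  have hgrad : gradient p ∘ g = W.subtype ∘ b := by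
    ext j k
    simp [g, gradient_mul, gradient_X, gradient_C, Pi.single_apply]
  refine ⟨g, fun j => by simp [g], ?_⟩
  rw [Set.image_union, Submodule.span_union, ← Set.range_comp, ← Set.range_comp, hgrad,
    Set.range_comp W.subtype, ← Submodule.map_span, b.span_eq, Submodule.map_top,
    Submodule.range_subtype]
  exact hW.sup_eq_top

end Gradients

section JacobianCriterion

theorem spanFinrank_span_range_le {A κ : Type*} [CommRing A] [Fintype κ] (f : κ → A) :
    (Ideal.span (Set.range f)).spanFinrank ≤ Fintype.card κ := by
  refine (Submodule.spanFinrank_span_le_ncard_of_finite (Set.finite_range f)).trans ?_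
  rw [← Set.image_univ, ← Nat.card_eq_fintype_card, ← Set.ncard_univ]
  exact Set.ncard_image_le Set.finite_univ

theorem map_span_range_union {A B ι κ : Type*} [CommRing A] [CommRing B] (φ : A →+* B)
    {f : ι → A} {g : κ → A} (hf : ∀ i, φ (f i) = 0) :
    (Ideal.span (Set.range f ∪ Set.range g)).map φ = Ideal.span (Set.range fun j => φ (g j)) := by
  rw [Ideal.map_span, Set.image_union, Ideal.span_union, ← Set.range_comp, ← Set.range_comp]
  refine (sup_of_le_right (Ideal.span_le.2 ?_)).trans rfl
  rintro _ ⟨i, rfl⟩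
  rw [Function.comp_apply, hf]
  exact zero_mem _

theorem eq_natCast_of_le_add_of_le {x : WithBot ℕ∞} {a k m : ℕ} (h : (a : WithBot ℕ∞) ≤ x + k)
    (h' : x ≤ m) (hm : m + k ≤ a) : x = m := by
  induction x using WithBot.recBotCoe with
  | bot => simp at h
  | coe x =>
    induction x using ENat.recTopCoe with
    | top =>
      have : (⊤ : ℕ∞) ≤ m := WithBot.coe_le_coe.1 h'
      exact absurd this (by simp)
    | coe x =>
      norm_cast at h h' ⊢
      omega

theorem isRegularLocalRing_quotient {A : Type*} [CommRing A] [IsLocalRing A] [IsNoetherianRing A]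
    {I : Ideal A} [IsLocalRing (A ⧸ I)] (hI : I ≤ IsLocalRing.maximalIdeal A) {n k : ℕ}
    (hdim : (n : WithBot ℕ∞) ≤ ringKrullDim A) (hkn : k ≤ n) (hk : I.spanFinrank ≤ k)
    (hmax : (IsLocalRing.maximalIdeal (A ⧸ I)).spanFinrank ≤ n - k) :
    IsRegularLocalRing (A ⧸ I) ∧ ringKrullDim (A ⧸ I) = ((n - k : ℕ) : WithBot ℕ∞) := by
  have hmax' : ((IsLocalRing.maximalIdeal (A ⧸ I)).spanFinrank : WithBot ℕ∞) ≤ (n - k : ℕ) := by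
    exact_mod_cast hmax
  have hle : (n : WithBot ℕ∞) ≤ ringKrullDim (A ⧸ I) + k := by
    refine (hdim.trans (ringKrullDim_le_ringKrullDim_quotient_add_spanFinrank I ?_)).trans
      (add_le_add_right (by exact_mod_cast hk) _)
    rwa [← Ideal.jacobson_bot, IsLocalRing.jacobson_eq_maximalIdeal _ bot_ne_top]
  have heq := eq_natCast_of_le_add_of_le hle
    ((ringKrullDim_le_spanFinrank_maximalIdeal _).trans hmax') (Nat.sub_add_cancel hkn).le
  exact ⟨IsRegularLocalRing.of_spanFinrank_maximalIdeal_le _ (hmax'.trans_eq heq.symm), heq⟩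

variable {σ : Type} {p : σ → ℂ} {G : Set (MvPolynomial σ ℂ)} {κ : Type*}
  {f : κ → MvPolynomial σ ℂ}

theorem map_span_affineLocalRing_eq (hf : ∀ l, f l ∈ Ideal.span G)
    (hG : ∀ g ∈ G, ∃ u, eval p u ≠ 0 ∧ u * g ∈ Ideal.span (Set.range f)) :
    (Ideal.span G).map (algebraMap (MvPolynomial σ ℂ) (AffineLocalRing p)) =
      (Ideal.span (Set.range f)).map (algebraMap (MvPolynomial σ ℂ) (AffineLocalRing p)) := by
  refine le_antisymm ?_ (Ideal.map_mono (Ideal.span_le.2 (Set.range_subset_iff.2 hf)))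
  rw [Ideal.map_le_iff_le_comap, Ideal.span_le]
  intro g hg
  obtain ⟨u, hu, hug⟩ := hG g hg
  have hmem := Ideal.mem_map_of_mem (algebraMap (MvPolynomial σ ℂ) (AffineLocalRing p)) hug
  rw [map_mul] at hmem
  exact (Ideal.unit_mul_mem_iff_mem _ (isUnit_algebraMap_of_eval_ne_zero hu)).1 hmem

theorem spanFinrank_maximalIdeal_localRingAt_le [Fintype σ] [Fintype κ]
    (hp : p ∈ zeroLocus ℂ (Ideal.span G)) (hf : ∀ l, f l ∈ Ideal.span G)
    (hli : LinearIndependent ℂ fun l => gradient p (f l)) :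
    have := isLocalRing_localRingAt hp
    (IsLocalRing.maximalIdeal (LocalRingAt (Ideal.span G) p)).spanFinrank ≤
      Fintype.card σ - Fintype.card κ := by
  have := isLocalRing_localRingAt hp
  obtain ⟨g, hg, htop⟩ := exists_span_gradient_eq_top hli
  have hfg : ∀ h ∈ Set.range f ∪ Set.range g, eval p h = 0 := by
    rintro _ (⟨l, rfl⟩ | ⟨j, rfl⟩)
    · exact mem_pointIdeal.1 (mem_zeroLocus_iff_le.1 hp (hf l))
    · exact hg j
  have hmax : IsLocalRing.maximalIdeal (LocalRingAt (Ideal.span G) p) = Ideal.span (Set.range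
      fun j => Ideal.Quotient.mk _ (algebraMap (MvPolynomial σ ℂ) (AffineLocalRing p) (g j))) := by
    rw [← IsLocalRing.map_maximalIdeal_of_surjective (Ideal.Quotient.mk _)
      Ideal.Quotient.mk_surjective, maximalIdeal_affineLocalRing_eq_map_span hfg htop,
      Ideal.map_map]
    exact map_span_range_union _ fun l => Ideal.Quotient.eq_zero_iff_mem.2
      (Ideal.mem_map_of_mem (algebraMap (MvPolynomial σ ℂ) (AffineLocalRing p)) (hf l))
  simpa only [hmax, Fintype.card_fin] using spanFinrank_span_range_le fun j =>
    Ideal.Quotient.mk _ (algebraMap (MvPolynomial σ ℂ) (AffineLocalRing p) (g j))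

theorem isRegularLocalRing_of_gradient [Fintype σ] [Fintype κ]
    (hp : p ∈ zeroLocus ℂ (Ideal.span G)) (hf : ∀ l, f l ∈ Ideal.span G)
    (hG : ∀ g ∈ G, ∃ u, eval p u ≠ 0 ∧ u * g ∈ Ideal.span (Set.range f))
    (hli : LinearIndependent ℂ fun l => gradient p (f l)) :
    IsRegularLocalRing (LocalRingAt (Ideal.span G) p) ∧ ringKrullDim (LocalRingAt (Ideal.span G) p)
      = ((Fintype.card σ - Fintype.card κ : ℕ) : WithBot ℕ∞) := by
  have := isLocalRing_localRingAt hp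
  have hcard : Fintype.card κ ≤ Fintype.card σ := by simpa using hli.fintype_card_le_finrank
  refine isRegularLocalRing_quotient (map_le_maximalIdeal hp)
    (card_le_ringKrullDim_affineLocalRing p) hcard ?_
    (spanFinrank_maximalIdeal_localRingAt_le hp hf hli)
  rw [map_span_affineLocalRing_eq hf hG, Ideal.map_span, ← Set.range_comp]
  exact spanFinrank_span_range_le _

end JacobianCriterion

section KrullDimension

variable {σ : Type} {I : Ideal (MvPolynomial σ ℂ)} {p : σ → ℂ}

theorem mk_mem_map_pointIdeal (hp : p ∈ zeroLocus ℂ I) {f : MvPolynomial σ ℂ} :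
    Ideal.Quotient.mk I f ∈ (pointIdeal p).map (Ideal.Quotient.mk I) ↔ f ∈ pointIdeal p := by
  rw [Ideal.mem_quotient_iff_mem_sup, sup_of_le_left (mem_zeroLocus_iff_le.1 hp)]

theorem isMaximal_map_pointIdeal (hp : p ∈ zeroLocus ℂ I) :
    ((pointIdeal p).map (Ideal.Quotient.mk I)).IsMaximal :=
  (Ideal.map_eq_top_or_isMaximal_of_surjective _ Ideal.Quotient.mk_surjective
    inferInstance).resolve_left
      (Ideal.isPrime_map_quotientMk_of_isPrime (mem_zeroLocus_iff_le.1 hp)).ne_top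

theorem ringKrullDim_localRingAt_eq_height (hp : p ∈ zeroLocus ℂ I) :
    ringKrullDim (LocalRingAt I p) = ((pointIdeal p).map (Ideal.Quotient.mk I)).height := by
  have := (isMaximal_map_pointIdeal hp).isPrime
  have hmonoid : Algebra.algebraMapSubmonoid (MvPolynomial σ ℂ ⧸ I) (pointIdeal p).primeCompl =
      ((pointIdeal p).map (Ideal.Quotient.mk I)).primeCompl := by
    ext x
    obtain ⟨f, rfl⟩ := Ideal.Quotient.mk_surjective x
    refine ⟨?_, fun hf => ⟨f, fun h => hf ((mk_mem_map_pointIdeal hp).2 h), rfl⟩⟩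
    rintro ⟨g, hg, hgf⟩ hf
    exact hg ((mk_mem_map_pointIdeal hp).1 (hgf ▸ hf : Ideal.Quotient.mk I g ∈ _))
  have hloc : IsLocalization (Algebra.algebraMapSubmonoid (MvPolynomial σ ℂ ⧸ I)
      (pointIdeal p).primeCompl) (LocalRingAt I p) := inferInstance
  rw [hmonoid] at hloc
  exact @IsLocalization.AtPrime.ringKrullDim_eq_height _ _ _ this (LocalRingAt I p) _ _ hloc

theorem ringKrullDim_localRingAt_le (hp : p ∈ zeroLocus ℂ I) :
    ringKrullDim (LocalRingAt I p) ≤ ringKrullDim (MvPolynomial σ ℂ ⧸ I) := by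
  rw [ringKrullDim_localRingAt_eq_height hp]
  exact Ideal.height_le_ringKrullDim_of_ne_top (isMaximal_map_pointIdeal hp).ne_top

theorem exists_mem_zeroLocus_notMem [Finite σ] {Q : Ideal (MvPolynomial σ ℂ)} (hQ : Q.IsPrime)
    (hmax : ¬ Q.IsMaximal) {F : Set (σ → ℂ)} (hF : F.Finite) : ∃ p ∈ zeroLocus ℂ Q, p ∉ F := by
  by_contra! hsub
  have hfin : (zeroLocus ℂ Q).Finite := hF.subset hsub
  have hinf : hfin.toFinset.inf pointIdeal ≤ vanishingIdeal ℂ (zeroLocus ℂ Q) :=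
    fun f hf p hp => (Submodule.mem_finsetInf.1 hf) p (hfin.mem_toFinset.2 hp) p rfl
  rw [IsPrime.vanishingIdeal_zeroLocus] at hinf
  obtain ⟨p, hp, hpQ⟩ := (Ideal.IsPrime.inf_le' hQ).1 hinf
  have hQp : pointIdeal p = Q :=
    le_antisymm hpQ (mem_zeroLocus_iff_le.1 (hfin.mem_toFinset.1 hp))
  exact hmax (hQp ▸ inferInstance)

theorem exists_lt_map_pointIdeal [Finite σ] {P : Ideal (MvPolynomial σ ℂ ⧸ I)} (hP : P.IsPrime)
    (hmax : ¬ P.IsMaximal) {F : Set (σ → ℂ)} (hF : F.Finite) :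
    ∃ p ∈ zeroLocus ℂ I, p ∉ F ∧ P < (pointIdeal p).map (Ideal.Quotient.mk I) := by
  have hsurj := Ideal.Quotient.mk_surjective (I := I)
  have hQmax : ¬ (P.comap (Ideal.Quotient.mk I)).IsMaximal := fun h =>
    hmax <| by
      have := Ideal.map_eq_top_or_isMaximal_of_surjective _ hsurj h
      rw [Ideal.map_comap_of_surjective _ hsurj] at this
      exact this.resolve_left hP.ne_top
  obtain ⟨p, hp, hpF⟩ := exists_mem_zeroLocus_notMem inferInstance hQmax hF
  have hIQ : I ≤ P.comap (Ideal.Quotient.mk I) := fun f hf => by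
    rw [Ideal.mem_comap, Ideal.Quotient.eq_zero_iff_mem.2 hf]
    exact zero_mem _
  have hpI : p ∈ zeroLocus ℂ I := zeroLocus_anti_mono hIQ hp
  refine ⟨p, hpI, hpF, lt_of_le_of_ne ?_ fun h => hmax (h ▸ isMaximal_map_pointIdeal hpI)⟩
  have := Ideal.map_mono (f := Ideal.Quotient.mk I) (mem_zeroLocus_iff_le.1 hp)
  rwa [Ideal.map_comap_of_surjective _ hsurj] at this

theorem ringKrullDim_quotient_le [Finite σ] {F : Set (σ → ℂ)} (hF : F.Finite) {d : ℕ}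
    (h : ∀ p ∈ zeroLocus ℂ I, p ∉ F → ringKrullDim (LocalRingAt I p) ≤ d) :
    ringKrullDim (MvPolynomial σ ℂ ⧸ I) ≤ d := by
  rw [ringKrullDim, Order.krullDim_eq_iSup_height]
  refine iSup_le fun x => ?_
  suffices Order.height x ≤ d by exact_mod_cast this
  rw [Order.height_le_coe_iff]
  intro y hy
  have hmax : ¬ y.asIdeal.IsMaximal := fun hm =>
    hy.ne (PrimeSpectrum.ext (hm.eq_of_le x.2.ne_top hy.le))
  obtain ⟨p, hp, hpF, hlt⟩ := exists_lt_map_pointIdeal y.2 hmax hF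
  let m : PrimeSpectrum (MvPolynomial σ ℂ ⧸ I) := ⟨_, (isMaximal_map_pointIdeal hp).isPrime⟩
  have hym : y < m := hlt
  have hm : Order.height m ≤ d := by
    have := h p hp hpF
    rw [ringKrullDim_localRingAt_eq_height hp] at this
    rw [← PrimeSpectrum.height_eq_orderHeight]
    exact_mod_cast this
  exact (Order.height_strictMono hym
    (((Order.height_mono hym.le).trans hm).trans_lt (ENat.natCast_lt_top d))).trans_le hm

end KrullDimension

section Graph

theorem rank_add_one_eq {K ι : Type*} [Field K] [Fintype ι] {m : ℕ} {B : Matrix (Fin (m + 1)) ι K}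
    {s : Fin (m + 1) → K} (hs : s ≠ 0) (h : s ᵥ* B = 0) {r : Fin m → Fin (m + 1)}
    {c : Fin m → ι} (hB : (B.submatrix r c).det ≠ 0) : B.rank + 1 = m + 1 := by
  have hne : B.rank ≠ m + 1 := by
    intro hrank
    rw [Matrix.rank_eq_finrank_span_row] at hrank
    have hli : LinearIndependent K B.row :=
      linearIndependent_iff_card_eq_finrank_span.2 (by rw [Fintype.card_fin]; exact hrank.symm)
    exact hs (Matrix.vecMul_injective_iff.2 hli (h.trans (Matrix.zero_vecMul B).symm))
  have hle : B.rank ≤ m + 1 := by simpa using B.rank_le_card_height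
  have hge : m ≤ B.rank := by
    calc m = (B.submatrix r c).rank := by
          rw [Matrix.rank_of_isUnit _ ((Matrix.isUnit_iff_isUnit_det _).2 hB.isUnit),
            Fintype.card_fin]
      _ ≤ B.rank := Matrix.rank_submatrix_le B r c
  omega

variable {m n : ℕ} {R S : Type*} [CommRing R] [CommRing S]

/-- The equations `s_i = 1` and `sᵀ B = 0` of the closure of the graph of `B ↦ [s]` in the chart
`s_i = 1`. -/
def graphEquations (m n : ℕ) (i : Fin m) : Set (MvPolynomial ((Fin m × Fin n) ⊕ Fin m) ℂ) :=
  insert (X (Sum.inr i) - 1) (Set.range fun k => ∑ j, X (Sum.inr j) * X (Sum.inl (j, k)))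

/-- The retraction of affine space onto the zero set of `graphEquations`, which sets `s_i = 1` and
solves `sᵀ B = 0` for the `i`-th row of `B`. -/
def graphProj (i : Fin (m + 1)) (q : (Fin (m + 1) × Fin n) ⊕ Fin (m + 1) → R) :
    (Fin (m + 1) × Fin n) ⊕ Fin (m + 1) → R :=
  Sum.elim (fun jk => if jk.1 = i then
      -∑ j : Fin m, q (Sum.inr (i.succAbove j)) * q (Sum.inl (i.succAbove j, jk.2))
    else q (Sum.inl jk)) (fun j => if j = i then 1 else q (Sum.inr j))

theorem map_graphProj (f : R →+* S) (i : Fin (m + 1))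
    (q : (Fin (m + 1) × Fin n) ⊕ Fin (m + 1) → R) (t) :
    f (graphProj i q t) = graphProj i (fun t => f (q t)) t := by
  rcases t with jk | j
  · simp only [graphProj, Sum.elim_inl]
    split_ifs <;> simp
  · simp only [graphProj, Sum.elim_inr]
    split_ifs <;> simp

theorem sum_graphProj_mul_graphProj (i : Fin (m + 1))
    (q : (Fin (m + 1) × Fin n) ⊕ Fin (m + 1) → R) (k : Fin n) :
    ∑ j, graphProj i q (Sum.inr j) * graphProj i q (Sum.inl (j, k)) = 0 := by
  rw [Fin.sum_univ_succAbove _ i]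
  simp [graphProj, Fin.succAbove_ne]

theorem graphProj_eq_self {i : Fin (m + 1)} {q : (Fin (m + 1) × Fin n) ⊕ Fin (m + 1) → R}
    (hs : q (Sum.inr i) = 1) (hB : ∀ k, ∑ j, q (Sum.inr j) * q (Sum.inl (j, k)) = 0) :
    graphProj i q = q := by
  ext (⟨j, k⟩ | j)
  · simp only [graphProj, Sum.elim_inl]
    split_ifs with hj
    · subst hj
      have hrow := hB k
      rw [Fin.sum_univ_succAbove _ j, hs, one_mul] at hrow
      exact (eq_neg_of_add_eq_zero_left hrow).symm
    · rfl
  · simp only [graphProj, Sum.elim_inr]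
    split_ifs with hj
    · rw [hj, hs]
    · rfl

theorem graphProj_mem_graphChart {i : Fin (m + 1)} {c : Fin m → Fin n}
    {q : (Fin (m + 1) × Fin n) ⊕ Fin (m + 1) → ℂ}
    (hq : (Matrix.of fun j k => q (Sum.inl (i.succAbove j, c k))).det ≠ 0) :
    graphProj i q ∈ graphChart (m + 1) n i := by
  have hs : graphProj i q (Sum.inr i) = 1 := by simp [graphProj]
  have hker : (fun j => graphProj i q (Sum.inr j)) ᵥ*
      (Matrix.of fun j k => graphProj i q (Sum.inl (j, k))) = 0 :=
    funext fun k => sum_graphProj_mul_graphProj i q k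
  refine ⟨rank_add_one_eq (fun h => ?_) hker (r := i.succAbove) (c := c) ?_, hs, hker⟩
  · exact one_ne_zero (hs.symm.trans (congrFun h i))
  · have hminor : (Matrix.of fun j k => graphProj i q (Sum.inl (j, k))).submatrix i.succAbove c =
        Matrix.of fun j k => q (Sum.inl (i.succAbove j, c k)) := by
      ext j k
      simp [graphProj, Fin.succAbove_ne]
    rwa [hminor]

theorem aeval_graphProj_X_sub_mem (i : Fin (m + 1))
    (f : MvPolynomial ((Fin (m + 1) × Fin n) ⊕ Fin (m + 1)) ℂ) :
    aeval (graphProj i X) f - f ∈ Ideal.span (graphEquations (m + 1) n i) := by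
  let π := Ideal.Quotient.mk (Ideal.span (graphEquations (m + 1) n i))
  have hfix : graphProj i (fun t => π (X t)) = fun t => π (X t) := by
    refine graphProj_eq_self ?_ fun k => ?_
    · rw [← sub_eq_zero, ← map_one π, ← map_sub]
      exact Ideal.Quotient.eq_zero_iff_mem.2 (Ideal.subset_span (Set.mem_insert _ _))
    · simp only [← map_mul, ← map_sum]
      exact Ideal.Quotient.eq_zero_iff_mem.2
        (Ideal.subset_span (Set.mem_insert_of_mem _ ⟨k, rfl⟩))
  have hcomp : π.comp (aeval (R := ℂ) (graphProj i X)).toRingHom = π := by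
    refine ringHom_ext (fun r => by simp) fun t => ?_
    simpa using (map_graphProj π i X t).trans (congrFun hfix t)
  exact Ideal.Quotient.eq.1 (DFunLike.congr_fun hcomp f)

theorem aeval_graphProj_X_eq_zero {i : Fin (m + 1)} (hmn : m ≤ n)
    {f : MvPolynomial ((Fin (m + 1) × Fin n) ⊕ Fin (m + 1)) ℂ}
    (hf : f ∈ vanishingIdeal ℂ (graphChart (m + 1) n i)) :
    aeval (graphProj i (X : _ → MvPolynomial ((Fin (m + 1) × Fin n) ⊕ Fin (m + 1)) ℂ)) f = 0 := by
  let entry : Fin m × Fin m → (Fin (m + 1) × Fin n) ⊕ Fin (m + 1) :=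
    fun jk => Sum.inl (i.succAbove jk.1, Fin.castLE hmn jk.2)
  have hentry : Function.Injective entry := by
    rintro ⟨j, k⟩ ⟨j', k'⟩ h
    simpa [entry, (Fin.castLE_injective hmn).eq_iff] using h
  have hminor : rename entry (Matrix.mvPolynomialX (Fin m) (Fin m) ℂ).det ≠ 0 := fun h =>
    Matrix.det_mvPolynomialX_ne_zero (Fin m) ℂ
      (rename_injective _ hentry (h.trans (map_zero _).symm))
  refine (mul_eq_zero.1 (MvPolynomial.funext fun q => ?_)).resolve_left hminor
  have heval : (eval (q ∘ entry)).mapMatrix (Matrix.mvPolynomialX (Fin m) (Fin m) ℂ) =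
      Matrix.of fun j k => q (entry (j, k)) :=
    Matrix.mvPolynomialX_mapMatrix_eval (Matrix.of fun j k => q (entry (j, k)))
  rw [map_mul, map_zero, eval_rename, RingHom.map_det, heval]
  by_cases hq : (Matrix.of fun j k => q (entry (j, k))).det = 0
  · exact mul_eq_zero_of_left hq _
  · refine mul_eq_zero_of_right _ ?_
    have hcomp : (eval q).comp (aeval (graphProj i X)).toRingHom = eval (graphProj i q) := by
      refine ringHom_ext (fun r => by simp) fun t => ?_
      simpa using map_graphProj (eval q) i X t
    have hvanish := hf _ (graphProj_mem_graphChart hq)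
    rw [aeval_eq_eval] at hvanish
    exact (DFunLike.congr_fun hcomp f).trans hvanish

theorem vanishingIdeal_graphChart (i : Fin (m + 1)) (hmn : m ≤ n) :
    vanishingIdeal ℂ (graphChart (m + 1) n i) = Ideal.span (graphEquations (m + 1) n i) := by
  refine le_antisymm (fun f hf => ?_) (Ideal.span_le.2 ?_)
  · have hmem := aeval_graphProj_X_sub_mem i f
    rw [aeval_graphProj_X_eq_zero hmn hf, zero_sub] at hmem
    exact neg_mem_iff.1 hmem
  · rintro _ (rfl | ⟨k, rfl⟩) q ⟨-, hs, hker⟩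
    · simp [aeval_eq_eval, hs]
    · simpa [aeval_eq_eval, Matrix.vecMul, dotProduct] using congrFun hker k

/-- The equations `s_i = 1` and `sᵀ M_a(x) = 0` of the Tjurina transform of a matrix of linear forms
in the chart `s_i = 1`; the coordinates are `x` on the left summand and `s` on the right one. -/
def tjurinaEquations {l m n : ℕ} (a : Fin l × Fin m × Fin n → ℂ) (i : Fin l) :
    Fin (m + 1) → MvPolynomial (Fin n ⊕ Fin l) ℂ :=
  Fin.cons (X (Sum.inr i) - 1)
    (contractRows (fun t => C (a t)) (fun i => X (Sum.inr i)) *ᵥ fun k => X (Sum.inl k))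

theorem tjurinaIdeal_linearMatrix {l m n : ℕ} (hlm : l ≤ m) (a : Fin (l + 1) × Fin m × Fin n → ℂ)
    (i : Fin (l + 1)) :
    tjurinaIdeal (linearMatrix a) i = Ideal.span (Set.range (tjurinaEquations a i)) := by
  rw [tjurinaIdeal, vanishingIdeal_graphChart i hlm, Ideal.map_span, graphEquations,
    Set.image_insert_eq, ← Set.range_comp, tjurinaEquations, Fin.range_cons]
  refine congrArg Ideal.span (congrArg₂ insert ?_ (congrArg Set.range (funext fun j => ?_)))
  · simp [pullback]
  · simp only [pullback, Function.comp_apply, map_sum, map_mul, aeval_X, Sum.elim_inr,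
      Sum.elim_inl, linearMatrix, Matrix.of_apply, rename_C, rename_X, contractRows,
      Matrix.mulVec, dotProduct, Finset.mul_sum, Finset.sum_mul]
    rw [Finset.sum_comm]
    exact Finset.sum_congr rfl fun k _ => Finset.sum_congr rfl fun i _ => by ring

end Graph

section MaximalMinors

theorem orderEmbedding_fin_eq_id {m : ℕ} (r : Fin m ↪o Fin m) : (r : Fin m → Fin m) = id :=
  (r.strictMono.range_inj strictMono_id).1 (by
    rw [(Finite.injective_iff_surjective.1 r.injective).range_eq, Set.range_id])

theorem det_submatrix_mem_minorIdeal {R : Type} [CommRing R] {m n : ℕ}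
    (B : Matrix (Fin m) (Fin n) R) (c : Fin m → Fin n) :
    (B.submatrix id c).det ∈ minorIdeal m B := by
  by_cases hc : Function.Injective c
  · have hmono : StrictMono (c ∘ Tuple.sort c) :=
      (Tuple.monotone_sort c).strictMono_of_injective (hc.comp (Tuple.sort c).injective)
    have hsorted : (B.submatrix id (c ∘ Tuple.sort c)).det ∈ minorIdeal m B :=
      Ideal.subset_span ⟨RelEmbedding.refl _, OrderEmbedding.ofStrictMono _ hmono, rfl⟩
    have hperm := Matrix.det_permute' (Tuple.sort c) (B.submatrix id c)
    rw [Matrix.submatrix_submatrix, Function.comp_id] at hperm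
    rw [hperm] at hsorted
    exact (Ideal.unit_mul_mem_iff_mem _ ((Units.isUnit _).map (Int.castRingHom R))).1 hsorted
  · obtain ⟨i, j, hij, hne⟩ := Function.not_injective_iff.1 hc
    rw [Matrix.det_zero_of_column_eq hne fun k => by simp [hij]]
    exact zero_mem _

theorem mul_det_mem_of_vecMul_mem {R : Type*} [CommRing R] {n : ℕ} (N : Matrix (Fin n) (Fin n) R)
    (s : Fin n → R) (i : Fin n) {I : Ideal R} (h : ∀ k, (s ᵥ* N) k ∈ I) : s i * N.det ∈ I := by
  have hadj := congrFun (Matrix.vecMul_vecMul s N N.adjugate) i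
  rw [Matrix.mul_adjugate, Matrix.vecMul_smul, Matrix.vecMul_one, Pi.smul_apply, smul_eq_mul,
    mul_comm] at hadj
  rw [← hadj, Matrix.vecMul_eq_sum, Finset.sum_apply]
  exact sum_mem fun k _ => I.mul_mem_right _ (h k)

variable {l m n : ℕ} {a : Fin l × Fin m × Fin n → ℂ} {x : Fin n → ℂ}

theorem eval_linearMatrix (i : Fin l) (j : Fin m) :
    eval x (linearMatrix a i j) = matrixAt a x i j := by
  rw [← map_linearMatrix_eval, Matrix.map_apply]

theorem mem_zeroLocus_minorIdeal_iff : x ∈ zeroLocus ℂ (minorIdeal l (linearMatrix a)) ↔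
    ∀ c : Fin l → Fin m, ((matrixAt a x).submatrix id c).det = 0 := by
  have heval : ∀ c : Fin l → Fin m, eval x ((linearMatrix a).submatrix id c).det =
      ((matrixAt a x).submatrix id c).det := fun c => by
    rw [RingHom.map_det, ← map_linearMatrix_eval]
    rfl
  rw [mem_zeroLocus_iff_le]
  constructor
  · intro h c
    rw [← heval]
    exact mem_pointIdeal.1 (h (det_submatrix_mem_minorIdeal _ c))
  · intro h
    refine Ideal.span_le.2 ?_
    rintro _ ⟨r, c, rfl⟩
    refine mem_pointIdeal.2 ?_
    rw [orderEmbedding_fin_eq_id, heval, h]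

theorem mem_zeroLocus_minorIdeal_of_mulVec {s : Fin l → ℂ} (hs : s ≠ 0)
    (h : contractRows a s *ᵥ x = 0) : x ∈ zeroLocus ℂ (minorIdeal l (linearMatrix a)) := by
  rw [mem_zeroLocus_minorIdeal_iff]
  intro c
  refine Matrix.exists_vecMul_eq_zero_iff.1 ⟨s, hs, ?_⟩
  rw [← vecMul_matrixAt] at h
  exact funext fun k => congrFun h (c k)

theorem sum_smul_gradient_vecMul_linearMatrix (S : Fin l → MvPolynomial (Fin n) ℂ) {y : Fin m → ℂ}
    (hy : matrixAt a x *ᵥ y = 0) : ∑ c, y c • gradient x ((S ᵥ* linearMatrix a) c) =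
      y ᵥ* contractRows a fun i => eval x (S i) := by
  have hentry : ∀ i c, gradient x (linearMatrix a i c) = fun k => a (i, c, k) := fun i c => by
    ext k
    simp [gradient_apply, linearMatrix, Derivation.leibniz, pderiv_X, Pi.single_apply]
  have hcolumn : ∀ c, gradient x ((S ᵥ* linearMatrix a) c) =
      (∑ i, eval x (S i) • fun k => a (i, c, k)) +
        ∑ i, matrixAt a x i c • gradient x (S i) := fun c => by
    simp only [Matrix.vecMul, dotProduct, map_sum, gradient_mul, hentry, eval_linearMatrix,
      Finset.sum_add_distrib]
  have hkernel : ∑ c, y c • ∑ i, matrixAt a x i c • gradient x (S i) = 0 := by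
    simp only [Finset.smul_sum, smul_smul]
    rw [Finset.sum_comm]
    refine Finset.sum_eq_zero fun i _ => ?_
    rw [← Finset.sum_smul, ← zero_smul ℂ (gradient x (S i))]
    exact congrArg (· • _) (.trans (Finset.sum_congr rfl fun _ _ => mul_comm _ _) (congrFun hy i))
  simp only [hcolumn, smul_add, Finset.sum_add_distrib, hkernel, add_zero]
  ext k
  simp [Matrix.vecMul, dotProduct, contractRows, mul_comm]

theorem minorIdeal_le_ker_firstOrderEval_zero (hl : 2 ≤ l) :
    minorIdeal l (linearMatrix a) ≤
      RingHom.ker (firstOrderEval 0 fun i : Fin n => (Pi.single i 1 : Fin n → ℂ)) := by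
  have hentry : ∀ i j, ∃ v, firstOrderEval 0 (fun i : Fin n => (Pi.single i 1 : Fin n → ℂ))
      (linearMatrix a i j) = TrivSqZeroExt.inr v := fun i j =>
    ⟨_, TrivSqZeroExt.ext (by rw [fst_firstOrderEval]; simp [linearMatrix]) rfl⟩
  choose w hw using hentry
  refine Ideal.span_le.2 ?_
  rintro _ ⟨r, c, rfl⟩
  change firstOrderEval 0 _ _ = 0
  rw [AlgHom.map_det, Matrix.det_apply]
  refine Finset.sum_eq_zero fun σ _ => ?_
  obtain ⟨l, rfl⟩ := Nat.exists_eq_add_of_le' hl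
  simp [Fin.prod_univ_succ, hw, ← mul_assoc]

end MaximalMinors

section ColumnCross

variable {m n : ℕ}

theorem vecMul_cross_col {R : Type*} [CommRing R] (B : Matrix (Fin 3) (Fin m) R) (j j' c : Fin m) :
    ((B.col j ⨯₃ B.col j') ᵥ* B) c = (B.submatrix id ![c, j, j']).det := by
  rw [← Matrix.det_transpose]
  change (B.col j ⨯₃ B.col j') ⬝ᵥ B.col c = _
  rw [dotProduct_comm, triple_product_eq_det]
  congr 1
  ext i k
  fin_cases i <;> rfl

theorem vecMul_cross_col_eq_zero {R : Type*} [CommRing R] {B : Matrix (Fin 3) (Fin m) R}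
    {j j' c : Fin m} (hc : c ∉ ({j, j'}ᶜ : Finset (Fin m))) :
    ((B.col j ⨯₃ B.col j') ᵥ* B) c = 0 := by
  change (B.col j ⨯₃ B.col j') ⬝ᵥ B.col c = 0
  rw [dotProduct_comm]
  rcases (by simpa [or_iff_not_imp_left] using hc : c = j ∨ c = j') with rfl | rfl
  exacts [dot_self_cross _ _, dot_cross_self _ _]

theorem map_cross {R S : Type*} [CommRing R] [CommRing S] (f : R →+* S) (v w : Fin 3 → R) :
    f ∘ (v ⨯₃ w) = (f ∘ v) ⨯₃ (f ∘ w) := by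
  ext i
  fin_cases i <;> simp [cross_apply]

variable {F : Type*} [Field F] {B : Matrix (Fin 3) (Fin m) F}

theorem rank_le_one_of_cross_col_eq_zero (h : ∀ j j', B.col j ⨯₃ B.col j' = 0) : B.rank ≤ 1 := by
  by_cases hB : ∃ j, B.col j ≠ 0
  · obtain ⟨j, hj⟩ := hB
    rw [Matrix.rank_eq_finrank_span_cols]
    refine (Submodule.finrank_mono (Submodule.span_le.2 ?_)).trans (finrank_span_singleton hj).le
    rintro _ ⟨k, rfl⟩
    have hdep : ¬ LinearIndependent F ![B.col j, B.col k] := fun hli =>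
      crossProduct_ne_zero_iff_linearIndependent.2 hli (h j k)
    rw [LinearIndependent.pair_iff' hj] at hdep
    push Not at hdep
    exact Submodule.mem_span_singleton.2 hdep
  · push Not at hB
    have hzero : B = 0 := Matrix.ext fun i j => congrFun (hB j) i
    simp [hzero]

theorem exists_linearIndependent_vecMul_eq_zero (h : ∀ j j', B.col j ⨯₃ B.col j' = 0) :
    ∃ s s' : Fin 3 → F, LinearIndependent F ![s', s] ∧ s ᵥ* B = 0 ∧ s' ᵥ* B = 0 := by
  have hrank := rank_le_one_of_cross_col_eq_zero h
  rw [← Matrix.rank_transpose, Matrix.rank] at hrank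
  have hnullity := Bᵀ.mulVecLin.finrank_range_add_finrank_ker
  rw [Module.finrank_fintype_fun_eq_card, Fintype.card_fin] at hnullity
  have hker : 1 < Module.finrank F (LinearMap.ker Bᵀ.mulVecLin) := by omega
  have := Module.nontrivial_of_finrank_pos (zero_lt_one.trans hker)
  obtain ⟨s', hs'⟩ := exists_ne (0 : LinearMap.ker Bᵀ.mulVecLin)
  obtain ⟨s, hli⟩ := exists_linearIndependent_pair_of_one_lt_finrank hker hs'
  have hmem : ∀ t : LinearMap.ker Bᵀ.mulVecLin, (t : Fin 3 → F) ᵥ* B = 0 := fun t => by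
    rw [← Matrix.mulVec_transpose]
    exact t.2
  refine ⟨s, s', ?_, hmem s, hmem s'⟩
  rw [LinearIndependent.pair_iff] at hli ⊢
  exact fun c d hcd => hli c d (Subtype.ext hcd)

variable {j j' : Fin m}

theorem col_mem_span_pair (hs : B.col j ⨯₃ B.col j' ≠ 0)
    (h : (B.col j ⨯₃ B.col j') ᵥ* B = 0) (k : Fin m) :
    B.col k ∈ Submodule.span F {B.col j, B.col j'} := by
  by_contra hk
  have hli : LinearIndependent F ![B.col k, B.col j, B.col j'] :=
    linearIndependent_finCons.2 ⟨crossProduct_ne_zero_iff_linearIndependent.1 hs, by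
      rwa [Matrix.range_cons, Matrix.range_cons_empty, Set.singleton_union]⟩
  have hdet : (Matrix.det ![B.col k, B.col j, B.col j'] : F) = 0 := by
    rw [← triple_product_eq_det, dotProduct_comm]
    exact congrFun h k
  have hunit := Matrix.linearIndependent_rows_iff_isUnit.1 hli
  exact ((Matrix.isUnit_iff_isUnit_det _).1 hunit).ne_zero hdet

theorem exists_mulVec_eq_zero_extending (hs : B.col j ⨯₃ B.col j' ≠ 0)
    (h : (B.col j ⨯₃ B.col j') ᵥ* B = 0) (g : Fin m → F) :
    ∃ y, B *ᵥ y = 0 ∧ ∀ k, k ≠ j → k ≠ j' → y k = g k := by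
  have hmem : B *ᵥ g ∈ Submodule.span F {B.col j, B.col j'} := by
    rw [Matrix.mulVec_eq_sum]
    exact Submodule.sum_mem _ fun k _ => by
      rw [op_smul_eq_smul]
      exact Submodule.smul_mem _ _ (col_mem_span_pair hs h k)
  obtain ⟨α, β, hαβ⟩ := Submodule.mem_span_pair.1 hmem
  refine ⟨g - (α • Pi.single j 1 + β • Pi.single j' 1), ?_, fun k hk hk' => by simp [hk, hk']⟩
  rw [Matrix.mulVec_sub, Matrix.mulVec_add, Matrix.mulVec_smul, Matrix.mulVec_smul,
    Matrix.mulVec_single_one, Matrix.mulVec_single_one, hαβ, sub_self]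

end ColumnCross

section RankTwo

variable {m n : ℕ} {a : Fin 3 × Fin m × Fin n → ℂ} {x : Fin n → ℂ} {j j' : Fin m}

theorem eval_cross_col_linearMatrix :
    (fun i => eval x (((linearMatrix a).col j ⨯₃ (linearMatrix a).col j') i)) =
      (matrixAt a x).col j ⨯₃ (matrixAt a x).col j' := by
  refine (map_cross (eval x) _ _).trans ?_
  rw [← map_linearMatrix_eval]
  rfl

theorem linearIndependent_gradient_vecMul_cross_col
    (hs : (matrixAt a x).col j ⨯₃ (matrixAt a x).col j' ≠ 0)
    (h : ((matrixAt a x).col j ⨯₃ (matrixAt a x).col j') ᵥ* matrixAt a x = 0)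
    (hy : ∀ y, y ᵥ* contractRows a ((matrixAt a x).col j ⨯₃ (matrixAt a x).col j') = 0 →
      matrixAt a x *ᵥ y = 0 → y = 0) :
    LinearIndependent ℂ fun k : ({j, j'}ᶜ : Finset (Fin m)) => gradient x
      ((((linearMatrix a).col j ⨯₃ (linearMatrix a).col j') ᵥ* linearMatrix a) k) := by
  rw [Fintype.linearIndependent_iff]
  intro g hg
  set S := (linearMatrix a).col j ⨯₃ (linearMatrix a).col j'
  obtain ⟨y, hker, hyg⟩ := exists_mulVec_eq_zero_extending hs h
    fun k => if hk : k ∈ ({j, j'}ᶜ : Finset (Fin m)) then g ⟨k, hk⟩ else 0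
  have hyg' : ∀ k : ({j, j'}ᶜ : Finset (Fin m)), y k = g k := fun k => by
    have hk := k.2
    simp only [Finset.mem_compl, Finset.mem_insert, Finset.mem_singleton, not_or] at hk
    rw [hyg k hk.1 hk.2, dif_pos k.2]
  have hzero : y = 0 := by
    refine hy y ?_ hker
    rw [← eval_cross_col_linearMatrix, ← sum_smul_gradient_vecMul_linearMatrix S hker, ← hg,
      ← Finset.sum_subset (Finset.subset_univ ({j, j'}ᶜ : Finset (Fin m))) fun k _ hk => by
        rw [vecMul_cross_col_eq_zero hk, map_zero, smul_zero], ← Finset.sum_coe_sort]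
    exact Finset.sum_congr rfl fun k _ => by rw [hyg']
  intro k
  rw [← hyg', hzero, Pi.zero_apply]

theorem isRegularLocalRing_minorIdeal_of_cross_col_ne_zero
    (hx : x ∈ zeroLocus ℂ (minorIdeal 3 (linearMatrix a)))
    (hs : (matrixAt a x).col j ⨯₃ (matrixAt a x).col j' ≠ 0)
    (hy : ∀ y, y ᵥ* contractRows a ((matrixAt a x).col j ⨯₃ (matrixAt a x).col j') = 0 →
      matrixAt a x *ᵥ y = 0 → y = 0) :
    IsRegularLocalRing (LocalRingAt (minorIdeal 3 (linearMatrix a)) x) ∧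
      ringKrullDim (LocalRingAt (minorIdeal 3 (linearMatrix a)) x) =
        ((n - (m - 2) : ℕ) : WithBot ℕ∞) := by
  set S := (linearMatrix a).col j ⨯₃ (linearMatrix a).col j'
  have hker : ((matrixAt a x).col j ⨯₃ (matrixAt a x).col j') ᵥ* matrixAt a x = 0 :=
    funext fun c => by rw [vecMul_cross_col, mem_zeroLocus_minorIdeal_iff.1 hx, Pi.zero_apply]
  have hjj : j ≠ j' := fun h => hs (by rw [h, cross_self])
  obtain ⟨i₀, hi₀⟩ := Function.ne_iff.1 hs
  have hspan : ∀ k, (S ᵥ* linearMatrix a) k ∈ Ideal.span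
      (Set.range fun k : ({j, j'}ᶜ : Finset (Fin m)) => (S ᵥ* linearMatrix a) k) := by
    intro k
    by_cases hk : k ∈ ({j, j'}ᶜ : Finset (Fin m))
    · exact Ideal.subset_span ⟨⟨k, hk⟩, rfl⟩
    · rw [vecMul_cross_col_eq_zero hk]
      exact zero_mem _
  have hmain := isRegularLocalRing_of_gradient hx
    (fun k => by rw [vecMul_cross_col]; exact det_submatrix_mem_minorIdeal _ _) (by
      rintro _ ⟨r, d, rfl⟩
      refine ⟨S i₀, (congrFun eval_cross_col_linearMatrix i₀).trans_ne hi₀,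
        mul_det_mem_of_vecMul_mem _ _ _ fun k => ?_⟩
      rw [orderEmbedding_fin_eq_id]
      exact hspan (d k)) (linearIndependent_gradient_vecMul_cross_col hs hker hy)
  rwa [Fintype.card_coe, Finset.card_compl, Finset.card_pair hjj, Fintype.card_fin,
    Fintype.card_fin] at hmain

end RankTwo

section LinearAlgebra

theorem span_range_eq_top_of_dotProduct_eq_zero {K ι κ : Type*} [Field K] [Fintype κ]
    {v : ι → κ → K} (h : ∀ c, (∀ i, c ⬝ᵥ v i = 0) → c = 0) :
    Submodule.span K (Set.range v) = ⊤ := by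
  classical
  by_contra hne
  obtain ⟨f, hf, hker⟩ := Submodule.exists_le_ker_of_lt_top _ (lt_top_iff_ne_top.2 hne)
  obtain ⟨c, rfl⟩ := (dotProductEquiv K κ).surjective f
  refine hf ?_
  rw [h c fun i => hker (Submodule.subset_span ⟨i, rfl⟩), map_zero]

theorem exists_linearIndependent_mulVec_eq_zero {F : Type*} [Field F] {m : ℕ}
    {B : Matrix (Fin m) (Fin (m + 1)) F}
    (h : ∀ k : Fin (m + 1), (B.submatrix id k.succAbove).det = 0) :
    ∃ w : Fin 2 → Fin (m + 1) → F, LinearIndependent F w ∧ ∀ k, B *ᵥ w k = 0 := by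
  obtain ⟨x, hx, hx0⟩ := Submodule.exists_mem_ne_zero_of_ne_bot
    (LinearMap.ker_ne_bot_of_finrank_lt (f := B.mulVecLin) (by simp))
  obtain ⟨k, hk⟩ : ∃ k, x k ≠ 0 := Function.ne_iff.1 hx0
  obtain ⟨w, hw0, hw⟩ := Matrix.exists_mulVec_eq_zero_iff.2 (h k)
  refine ⟨![x, k.insertNth 0 w], (LinearIndependent.pair_iff' hx0).2 fun c hc => hw0 ?_,
    Fin.forall_fin_two.2 ⟨hx, ?_⟩⟩
  · have hzero : c = 0 := by simpa [hk] using congrFun hc k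
    ext j
    simpa [hzero] using (congrFun hc (k.succAbove j)).symm
  · rw [← hw]
    ext j
    simp [Matrix.mulVec, dotProduct, Fin.sum_univ_succAbove _ k]

end LinearAlgebra

section TjurinaTransform

variable {l m n : ℕ}

theorem eval_tjurinaEquations_succ (a : Fin l × Fin m × Fin n → ℂ) (i : Fin l) (x : Fin n → ℂ)
    (s : Fin l → ℂ) (j : Fin m) :
    eval (Sum.elim x s) (tjurinaEquations a i j.succ) = (contractRows a s *ᵥ x) j := by
  simp [tjurinaEquations, contractRows, Matrix.mulVec, dotProduct]

theorem mem_zeroLocus_tjurinaEquations {a : Fin l × Fin m × Fin n → ℂ} {i : Fin l} {x : Fin n → ℂ}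
    {s : Fin l → ℂ} :
    Sum.elim x s ∈ zeroLocus ℂ (Ideal.span (Set.range (tjurinaEquations a i))) ↔
      s i = 1 ∧ contractRows a s *ᵥ x = 0 := by
  rw [mem_zeroLocus_span, Set.forall_mem_range, Fin.forall_fin_succ, funext_iff]
  simp only [eval_tjurinaEquations_succ, Pi.zero_apply]
  simp [tjurinaEquations, sub_eq_zero]

theorem gradient_tjurinaEquations_zero (a : Fin l × Fin m × Fin n → ℂ) (i : Fin l)
    (q : Fin n ⊕ Fin l → ℂ) :
    gradient q (tjurinaEquations a i 0) = Pi.single (Sum.inr i) 1 := by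
  ext t
  rw [gradient_apply]
  simp [tjurinaEquations, pderiv_X, Pi.single_apply, apply_ite, eq_comm]

theorem gradient_tjurinaEquations_succ (a : Fin l × Fin m × Fin n → ℂ) (i : Fin l) (x : Fin n → ℂ)
    (s : Fin l → ℂ) (j : Fin m) :
    gradient (Sum.elim x s) (tjurinaEquations a i j.succ) =
      Sum.elim (contractRows a s j) fun t => matrixAt a x t j := by
  ext (k | t)
  · rw [gradient_apply]
    simp [tjurinaEquations, Matrix.mulVec, dotProduct, contractRows, pderiv_X, Pi.single_apply]
  · rw [gradient_apply]
    simp [tjurinaEquations, Matrix.mulVec, dotProduct, contractRows, matrixAt, pderiv_X,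
      Pi.single_apply, mul_comm]

theorem linearIndependent_gradient_tjurinaEquations {a : Fin l × Fin m × Fin n → ℂ} {i : Fin l}
    {x : Fin n → ℂ} {s : Fin l → ℂ} (hs : s i = 1) (hx : contractRows a s *ᵥ x = 0)
    (h : ∀ y, y ᵥ* contractRows a s = 0 → matrixAt a x *ᵥ y = 0 → y = 0) :
    LinearIndependent ℂ fun j => gradient (Sum.elim x s) (tjurinaEquations a i j) := by
  rw [Fintype.linearIndependent_iff]
  intro g hg
  rw [Fin.sum_univ_succ, gradient_tjurinaEquations_zero] at hg
  simp only [gradient_tjurinaEquations_succ] at hg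
  have hleft : (fun j => g (Fin.succ j)) ᵥ* contractRows a s = 0 := by
    ext k
    simpa [Matrix.vecMul, dotProduct] using congrFun hg (Sum.inl k)
  have hright : g 0 • Pi.single i 1 + matrixAt a x *ᵥ (fun j => g (Fin.succ j)) = 0 := by
    ext t
    simpa [Matrix.mulVec, dotProduct, Pi.single_apply, mul_comm] using congrFun hg (Sum.inr t)
  have hzero : g 0 = 0 := by
    have hdot := congrArg (s ⬝ᵥ ·) hright
    simpa [dotProduct_matrixAt_mulVec, hx, hs] using hdot
  rw [hzero, zero_smul, zero_add] at hright
  exact Fin.cases hzero (congrFun (h _ hleft hright))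

theorem isRegularLocalRing_tjurinaEquations {a : Fin l × Fin m × Fin n → ℂ} {i : Fin l}
    {x : Fin n → ℂ} {s : Fin l → ℂ}
    (hq : Sum.elim x s ∈ zeroLocus ℂ (Ideal.span (Set.range (tjurinaEquations a i))))
    (h : ∀ y, y ᵥ* contractRows a s = 0 → matrixAt a x *ᵥ y = 0 → y = 0) :
    IsRegularLocalRing
        (LocalRingAt (Ideal.span (Set.range (tjurinaEquations a i))) (Sum.elim x s)) ∧
      ringKrullDim (LocalRingAt (Ideal.span (Set.range (tjurinaEquations a i))) (Sum.elim x s)) =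
        ((n + l - (m + 1) : ℕ) : WithBot ℕ∞) := by
  obtain ⟨hs, hx⟩ := mem_zeroLocus_tjurinaEquations.1 hq
  have hmain := isRegularLocalRing_of_gradient hq (fun j => Ideal.subset_span ⟨j, rfl⟩)
    (fun g hg => ⟨1, by simp, by rw [one_mul]; exact Ideal.subset_span hg⟩)
    (linearIndependent_gradient_tjurinaEquations hs hx h)
  rwa [Fintype.card_sum, Fintype.card_fin, Fintype.card_fin, Fintype.card_fin] at hmain

theorem firstOrderEval_tjurinaEquations_succ {M : Type*} [AddCommGroup M] [Module ℂ M]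
    [Module ℂᵐᵒᵖ M] [IsCentralScalar ℂ M] (a : Fin l × Fin m × Fin n → ℂ) (i : Fin l)
    (s : Fin l → ℂ) (v : Fin n ⊕ Fin l → M) (j : Fin m) :
    firstOrderEval (Sum.elim 0 s) v (tjurinaEquations a i j.succ) =
      TrivSqZeroExt.inr (∑ k, contractRows a s j k • v (Sum.inl k)) := by
  have hentry : ∀ k, (firstOrderEval (Sum.elim (0 : Fin n → ℂ) s) v
      (contractRows (fun t => C (a t)) (fun i => X (Sum.inr i)) j k)).fst =
        contractRows a s j k := fun k => by
    rw [fst_firstOrderEval]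
    simp [contractRows]
  simp only [tjurinaEquations, Fin.cons_succ, Matrix.mulVec, dotProduct, map_sum, map_mul,
    TrivSqZeroExt.inr_sum]
  refine Finset.sum_congr rfl fun k _ => ?_
  rw [← hentry]
  ext <;> simp [firstOrderEval, firstOrderPoint]

-- The tangent space at `(0, s)` is the product of the kernel of `contractRows a s`, containing all
-- `w k`, and of the hyperplane `{t | t i = 0}`.
theorem not_isRegularLocalRing_tjurinaEquations {κ : Type*} [Fintype κ]
    {a : Fin (l + 1) × Fin m × Fin n → ℂ} {i : Fin (l + 1)} {s : Fin (l + 1) → ℂ}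
    {w : κ → Fin n → ℂ} (hs : s i = 1) (hli : LinearIndependent ℂ w)
    (hw : ∀ k, contractRows a s *ᵥ w k = 0)
    (hdim : ringKrullDim
        (LocalRingAt (Ideal.span (Set.range (tjurinaEquations a i))) (Sum.elim 0 s)) <
      ((Fintype.card κ + l : ℕ) : WithBot ℕ∞)) :
    ¬ IsRegularLocalRing
      (LocalRingAt (Ideal.span (Set.range (tjurinaEquations a i))) (Sum.elim 0 s)) := by
  let v : Fin n ⊕ Fin (l + 1) → κ ⊕ Fin l → ℂ :=
    Sum.elim (fun j => Sum.elim (fun k => w k j) 0)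
      (fun t => Sum.elim 0 fun r => if t = i.succAbove r then 1 else 0)
  have hvi : v (Sum.inr i) = 0 := by
    ext (k | r) <;> simp [v, (Fin.succAbove_ne _ _).symm]
  have hvw : ∀ j, ∑ k, contractRows a s j k • v (Sum.inl k) = 0 := by
    intro j
    ext (k | r)
    · simpa [v, Matrix.mulVec, dotProduct] using congrFun (hw k) j
    · simp [v]
  refine not_isRegularLocalRing_localRingAt (v := v) (Ideal.span_le.2 ?_) ?_ ?_
  · rintro _ ⟨j, rfl⟩
    refine Fin.cases ?_ (fun j => ?_) j
    · change firstOrderEval _ _ _ = 0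
      simp [firstOrderEval, tjurinaEquations, firstOrderPoint, hs, hvi]
    · exact (firstOrderEval_tjurinaEquations_succ a i s v j).trans
        (by rw [hvw, TrivSqZeroExt.inr_zero])
  · refine span_range_eq_top_of_dotProduct_eq_zero fun c hc => ?_
    have hleft : ∀ k, c (Sum.inl k) = 0 :=
      Fintype.linearIndependent_iff.1 hli (fun k => c (Sum.inl k)) <| funext fun j => by
        simpa [v, dotProduct] using hc (Sum.inl j)
    have hright : ∀ r, c (Sum.inr r) = 0 := fun r => by
      simpa [v, dotProduct, Fin.succAbove_right_injective.eq_iff] using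
        hc (Sum.inr (i.succAbove r))
    ext (k | r)
    exacts [hleft k, hright r]
  · rwa [Module.finrank_fintype_fun_eq_card, Fintype.card_sum, Fintype.card_fin]

end TjurinaTransform

section Resolvent

variable {A B : Type*} [CommRing A] [CommRing B] {ι κ : Type*} [Fintype ι] [Fintype κ]

theorem esymm_eq_neg_one_pow_mul_coeff {χ : Polynomial B} {t : κ → B}
    (h : χ = ∏ i, (Polynomial.X - Polynomial.C (t i))) {j : ℕ} (hj : j ≤ Fintype.card κ) :
    eval t (esymm κ B j) = (-1) ^ j * χ.coeff (Fintype.card κ - j) := by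
  have hcoeff := Multiset.prod_X_sub_C_coeff (Finset.univ.val.map t)
    (k := Fintype.card κ - j) (by simp)
  rw [Multiset.map_map, Multiset.card_map, Finset.card_val, Finset.card_univ,
    Nat.sub_sub_self hj, Finset.esymm_map_val] at hcoeff
  rw [h, Finset.prod, show (fun i => Polynomial.X - Polynomial.C (t i)) =
    (fun r => Polynomial.X - Polynomial.C r) ∘ t from rfl, hcoeff, ← mul_assoc, ← mul_pow]
  simp [esymm]

theorem isSymmetric_prod_rename (G : MvPolynomial ι A) :
    (∏ e : ι ↪ κ, rename e G).IsSymmetric := by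
  intro σ
  simp_rw [map_prod, rename_rename]
  exact Fintype.prod_equiv (Equiv.embeddingCongr (Equiv.refl ι) σ) _ _
    fun e => congrArg (fun h => rename h G) (by ext; simp)

/-- If `χ = ∏ i : κ, (X - tᵢ)`, the product of the values of `G` at all families of distinct
roots `(t (e i))ᵢ`, for `e : ι ↪ κ`, expressed as a polynomial in the coefficients of `χ`. It
makes sense, and commutes with ring homomorphisms, when `χ` does not split. -/
def resolvent (κ : Type*) [Fintype κ] (χ : Polynomial A) (G : MvPolynomial ι A) : A :=
  eval (fun i : Fin (Fintype.card κ) =>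
      (-1) ^ (i + 1 : ℕ) * χ.coeff (Fintype.card κ - (i + 1)))
    ((esymmAlgEquiv κ A rfl).symm ⟨∏ e : ι ↪ κ, rename e G, isSymmetric_prod_rename G⟩)

theorem map_resolvent (f : A →+* B) {χ : Polynomial A} {t : κ → B}
    (h : χ.map f = ∏ i, (Polynomial.X - Polynomial.C (t i))) (G : MvPolynomial ι A) :
    f (resolvent κ χ G) = ∏ e : ι ↪ κ, eval₂ f (t ∘ e) G := by
  set Q := (esymmAlgEquiv κ A rfl).symm ⟨∏ e : ι ↪ κ, rename e G, isSymmetric_prod_rename G⟩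
    with hQ
  have hQ_esymm : aeval (fun i : Fin (Fintype.card κ) => esymm κ A (i + 1)) Q =
      ∏ e : ι ↪ κ, rename e G := by
    rw [← esymmAlgHom_apply]
    exact congrArg Subtype.val ((esymmAlgEquiv κ A rfl).apply_symm_apply _)
  calc f (resolvent κ χ G)
      = eval₂ f (fun i : Fin (Fintype.card κ) =>
          (-1) ^ (i + 1 : ℕ) * (χ.map f).coeff (Fintype.card κ - (i + 1))) Q := by
        rw [resolvent, ← hQ, eval, coe_eval₂Hom, hom_eval₂, RingHom.comp_id]
        simp [Polynomial.coeff_map]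
    _ = eval₂ f (fun i : Fin (Fintype.card κ) => eval₂ f t (esymm κ A (i + 1))) Q := by
        congr 1
        funext i
        rw [← esymm_eq_neg_one_pow_mul_coeff h i.isLt, eval₂_eq_eval_map, map_esymm]
    _ = eval₂ f t (aeval (fun i : Fin (Fintype.card κ) => esymm κ A (i + 1)) Q) := by
        rw [aeval_def, ← coe_eval₂Hom f t, hom_eval₂]
        congr 1
        ext
        simp
    _ = ∏ e : ι ↪ κ, eval₂ f (t ∘ e) G := by
        rw [hQ_esymm, ← coe_eval₂Hom, map_prod]
        simp [eval₂_rename]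

end Resolvent

section Forms

/-- The exponents of the monomials of degree `d` in three variables. -/
abbrev Exponent (d : ℕ) : Type :=
  {m // m ∈ Finset.finsuppAntidiag (Finset.univ : Finset (Fin 3)) d}

variable {d : ℕ}

theorem mem_finsuppAntidiag_univ_iff {m : Fin 3 →₀ ℕ} :
    m ∈ Finset.finsuppAntidiag (Finset.univ : Finset (Fin 3)) d ↔ m.degree = d := by
  simp [Finset.mem_finsuppAntidiag, Finsupp.degree_eq_sum]

theorem Exponent.degree_eq (m : Exponent d) : m.1.degree = d :=
  mem_finsuppAntidiag_univ_iff.1 m.2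

theorem card_exponent (d : ℕ) : Fintype.card (Exponent d) = (d + 2).choose 2 := by
  rw [Fintype.card_coe, Finset.card_finsuppAntidiag_nat_eq_choose, Finset.card_univ,
    Fintype.card_fin, show 3 + d - 1 = 2 + d by omega, add_comm d, Nat.choose_symm_add]

variable {R S : Type*} [CommRing R] [CommRing S]

/-- The ternary form of degree `d` with the given coefficients. -/
def formOf (d : ℕ) : (Exponent d → R) →ₗ[R] MvPolynomial (Fin 3) R :=
  ∑ m, monomial m.1 ∘ₗ LinearMap.proj m

/-- The coefficients in degree `d` of a polynomial in three variables. -/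
def coeffs (d : ℕ) : MvPolynomial (Fin 3) R →ₗ[R] Exponent d → R :=
  LinearMap.pi fun m => lcoeff R m.1

theorem formOf_apply (w : Exponent d → R) : formOf d w = ∑ m, monomial m.1 (w m) := by
  simp [formOf]

@[simp]
theorem coeffs_apply (f : MvPolynomial (Fin 3) R) (m : Exponent d) :
    coeffs d f m = coeff m.1 f := rfl

@[simp]
theorem coeffs_formOf (w : Exponent d → R) : coeffs d (formOf d w) = w := by
  ext m
  rw [coeffs_apply, formOf_apply, coeff_sum, Finset.sum_eq_single m]
  · simp
  · exact fun m' _ h => by rw [coeff_monomial, if_neg fun h' => h (Subtype.ext h')]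
  · simp

theorem isHomogeneous_formOf (w : Exponent d → R) : (formOf d w).IsHomogeneous d := by
  rw [formOf_apply]
  exact IsHomogeneous.sum _ _ _ fun m _ => isHomogeneous_monomial _ m.degree_eq

theorem formOf_coeffs {f : MvPolynomial (Fin 3) R} (hf : f.IsHomogeneous d) :
    formOf d (coeffs d f) = f := by
  ext m
  by_cases hm : m.degree = d
  · exact congrFun (coeffs_formOf (coeffs d f)) ⟨m, mem_finsuppAntidiag_univ_iff.2 hm⟩
  · rw [hf.coeff_eq_zero hm, (isHomogeneous_formOf _).coeff_eq_zero hm]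

theorem formOf_single (m : Exponent d) (c : R) : formOf d (Pi.single m c) = monomial m.1 c := by
  rw [formOf_apply, Finset.sum_eq_single m] <;> simp +contextual

theorem formOf_injective : Function.Injective (formOf d : (Exponent d → R) → _) :=
  Function.LeftInverse.injective coeffs_formOf

theorem map_formOf (f : R →+* S) (w : Exponent d → R) :
    map f (formOf d w) = formOf d (f ∘ w) := by
  simp [formOf_apply]

/-- The values at `p` of the monomials of degree `d`. -/
def monomialVec (d : ℕ) (p : Fin 3 → R) (m : Exponent d) : R :=
  eval p (monomial m.1 1)

theorem monomialVec_dotProduct (p : Fin 3 → R) (w : Exponent d → R) :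
    monomialVec d p ⬝ᵥ w = eval p (formOf d w) := by
  simp [monomialVec, formOf_apply, dotProduct, eval_monomial, mul_comm]

theorem eval_eq_monomialVec_dotProduct {f : MvPolynomial (Fin 3) R} (hf : f.IsHomogeneous d)
    (p : Fin 3 → R) : eval p f = monomialVec d p ⬝ᵥ coeffs d f := by
  rw [monomialVec_dotProduct, formOf_coeffs hf]

end Forms

section Minors

variable {R S : Type*} [CommRing R] [CommRing S] {l m n : ℕ}

theorem map_contractRows (f : R →+* S) (a : Fin l × Fin m × Fin n → R) (s : Fin l → R) :
    (contractRows a s).map f = contractRows (f ∘ a) (f ∘ s) := by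
  ext j k
  simp [contractRows]

theorem isHomogeneous_contractRows_X (a : Fin l × Fin m × Fin n → R) (j : Fin m) (k : Fin n) :
    (contractRows (C ∘ a) (X : Fin l → MvPolynomial (Fin l) R) j k).IsHomogeneous 1 :=
  IsHomogeneous.sum Finset.univ (fun i => C (a (i, j, k)) * X i) 1 fun i _ => by
    simpa using (isHomogeneous_C (Fin l) (a (i, j, k))).mul (isHomogeneous_X R i)

theorem contractRows_smul (a : Fin l × Fin m × Fin n → R) (c : R) (s : Fin l → R) :
    contractRows a (c • s) = c • contractRows a s := by
  ext j k
  simp [contractRows, Finset.mul_sum, mul_left_comm]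

/-- The `k`-th maximal minor of `∑ᵢ sᵢ a(i, ·, ·)`, without the sign `(-1)ᵏ`. -/
def rowMinor (a : Fin l × Fin m × Fin (m + 1) → R) (s : Fin l → R) (k : Fin (m + 1)) : R :=
  ((contractRows a s).submatrix id k.succAbove).det

/-- The maximal minors of `∑ᵢ sᵢ a(i, ·, ·)` as forms of degree `m` in `s`. -/
def minorForm (a : Fin l × Fin m × Fin (m + 1) → R) (k : Fin (m + 1)) : MvPolynomial (Fin l) R :=
  rowMinor (C ∘ a) X k

variable (a : Fin l × Fin m × Fin (m + 1) → R) (s : Fin l → R) (k : Fin (m + 1))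

theorem map_rowMinor (f : R →+* S) : f (rowMinor a s k) = rowMinor (f ∘ a) (f ∘ s) k := by
  rw [rowMinor, rowMinor, RingHom.map_det, ← map_contractRows]
  rfl

theorem eval_minorForm : eval s (minorForm a k) = rowMinor a s k := by
  rw [minorForm, map_rowMinor]
  congr 1 <;> ext <;> simp

theorem map_minorForm (f : R →+* S) : map f (minorForm a k) = minorForm (f ∘ a) k := by
  rw [minorForm, map_rowMinor, minorForm]
  congr 1 <;> ext <;> simp

theorem isHomogeneous_minorForm : (minorForm a k).IsHomogeneous m := by
  rw [minorForm, rowMinor, Matrix.det_apply]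
  refine IsHomogeneous.sum _ _ _ fun σ _ => ?_
  have hprod := IsHomogeneous.prod Finset.univ
    (fun j => contractRows (C ∘ a) X (σ j) (k.succAbove j)) (fun _ => 1)
    fun j _ => isHomogeneous_contractRows_X a (σ j) (k.succAbove j)
  rw [Finset.sum_const, Finset.card_univ, Fintype.card_fin, smul_eq_mul, mul_one] at hprod
  rw [Units.smul_def]
  exact zsmul_mem (K := homogeneousSubmodule (Fin l) R m) hprod _

theorem rowMinor_smul (c : R) : rowMinor a (c • s) k = c ^ m * rowMinor a s k := by
  rw [rowMinor, contractRows_smul, Matrix.submatrix_smul, Pi.smul_apply, Pi.smul_apply,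
    Matrix.det_smul, Fintype.card_fin]
  rfl

theorem sum_contractRows_mul_rowMinor (j : Fin m) :
    ∑ k : Fin (m + 1), (-1) ^ (k : ℕ) * contractRows a s j k * rowMinor a s k = 0 := by
  have hdet : (Matrix.of (Fin.cons (contractRows a s j) (contractRows a s)) :
      Matrix (Fin (m + 1)) (Fin (m + 1)) R).det = 0 :=
    Matrix.det_zero_of_row_eq (i := 0) (j := j.succ) (Fin.succ_ne_zero j).symm rfl
  rwa [Matrix.det_succ_row_zero] at hdet

end Minors

section Krylov

variable {R S : Type*} [CommRing R] [CommRing S] {ι : Type*} [Fintype ι] [DecidableEq ι]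
  {A : Matrix ι ι R} {φ : ι → R} {r : R}

theorem vecMul_pow_of_vecMul_eq_smul (h : φ ᵥ* A = r • φ) (k : ℕ) :
    φ ᵥ* A ^ k = r ^ k • φ := by
  induction k with
  | zero => simp
  | succ k ih =>
    rw [pow_succ, ← Matrix.vecMul_vecMul, ih, Matrix.smul_vecMul, h, smul_smul, pow_succ]

theorem eval_charpoly_smul_of_vecMul_eq_smul (h : φ ᵥ* A = r • φ) :
    A.charpoly.eval r • φ = 0 := by
  have hker : φ ᵥ* (Matrix.scalar ι r - A) = 0 := by
    rw [Matrix.vecMul_sub, h, Matrix.scalar_apply, ← Matrix.smul_one_eq_diagonal,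
      Matrix.vecMul_smul, Matrix.vecMul_one, sub_self]
  rw [Matrix.eval_charpoly, ← Matrix.vecMul_one φ, ← Matrix.vecMul_smul, ← Matrix.mul_adjugate,
    ← Matrix.vecMul_vecMul, hker, Matrix.zero_vecMul]

/-- The matrix with columns `v, A v, A² v, …`. -/
def krylovMatrix (A : Matrix ι ι R) (v : ι → R) : Matrix ι ι R :=
  Matrix.of fun i k => ((A ^ (Fintype.equivFin ι k : ℕ)) *ᵥ v) i

/-- The polynomial `q` of degree `< card ι` with `q(A) v = det (krylovMatrix A v) • c`, given by
Cramer's rule. -/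
def krylovPoly (A : Matrix ι ι R) (v c : ι → R) : Polynomial R :=
  ∑ k, Polynomial.C (((krylovMatrix A v).adjugate *ᵥ c) k) *
    Polynomial.X ^ (Fintype.equivFin ι k : ℕ)

theorem vecMul_krylovMatrix (h : φ ᵥ* A = r • φ) (v : ι → R) (k : ι) :
    (φ ᵥ* krylovMatrix A v) k = r ^ (Fintype.equivFin ι k : ℕ) * (φ ⬝ᵥ v) := by
  change φ ⬝ᵥ (A ^ (Fintype.equivFin ι k : ℕ)) *ᵥ v = _
  rw [Matrix.dotProduct_mulVec, vecMul_pow_of_vecMul_eq_smul h, smul_dotProduct, smul_eq_mul]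

theorem eval_krylovPoly_mul (h : φ ᵥ* A = r • φ) (v c : ι → R) :
    (krylovPoly A v c).eval r * (φ ⬝ᵥ v) = (krylovMatrix A v).det * (φ ⬝ᵥ c) := by
  calc (krylovPoly A v c).eval r * (φ ⬝ᵥ v)
      = (φ ᵥ* krylovMatrix A v) ⬝ᵥ (krylovMatrix A v).adjugate *ᵥ c := by
        simp only [krylovPoly, Polynomial.eval_finsetSum, Polynomial.eval_mul, Polynomial.eval_C,
          Polynomial.eval_pow, Polynomial.eval_X, Finset.sum_mul]
        exact Finset.sum_congr rfl fun k _ => by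
          rw [vecMul_krylovMatrix h]
          ring
    _ = (krylovMatrix A v).det * (φ ⬝ᵥ c) := by
        rw [← Matrix.dotProduct_mulVec, Matrix.mulVec_mulVec, Matrix.mul_adjugate,
          Matrix.smul_mulVec, Matrix.one_mulVec, dotProduct_smul, smul_eq_mul]

theorem map_krylovMatrix (f : R →+* S) (A : Matrix ι ι R) (v : ι → R) :
    (krylovMatrix A v).map f = krylovMatrix (A.map f) (f ∘ v) := by
  ext i k
  rw [Matrix.map_apply, krylovMatrix, Matrix.of_apply, RingHom.map_mulVec, krylovMatrix,
    Matrix.of_apply, ← RingHom.mapMatrix_apply, map_pow]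
  rfl

theorem map_krylovPoly (f : R →+* S) (A : Matrix ι ι R) (v c : ι → R) :
    (krylovPoly A v c).map f = krylovPoly (A.map f) (f ∘ v) (f ∘ c) := by
  have hsolve (k : ι) : f (((krylovMatrix A v).adjugate *ᵥ c) k) =
      ((krylovMatrix (A.map f) (f ∘ v)).adjugate *ᵥ (f ∘ c)) k := by
    rw [RingHom.map_mulVec, ← RingHom.mapMatrix_apply, RingHom.map_adjugate,
      RingHom.mapMatrix_apply, map_krylovMatrix]
  simp [krylovPoly, Polynomial.map_sum, hsolve]

end Krylov

section MultiplicationMatrices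

variable {R S : Type*} [CommRing R] [CommRing S] {n : ℕ}

theorem card_exponent_sum (n : ℕ) :
    Fintype.card (Exponent n ⊕ Fin (n + 2)) = Fintype.card (Exponent (n + 1)) := by
  rw [Fintype.card_sum, card_exponent, card_exponent, Fintype.card_fin,
    add_right_comm n 1 2, Nat.choose_succ_succ' (n + 2) 1, Nat.choose_one_right, add_comm]

/-- The map `(w, c) ↦ X₀ w + ∑ₖ cₖ Δₖ` from forms of degree `n` and constants to forms of degree
`n + 1`, where the `Δₖ` are the maximal minors. -/
def spanMap (a : Fin 3 × Fin (n + 1) × Fin (n + 2) → R) :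
    (Exponent n ⊕ Fin (n + 2) → R) →ₗ[R] MvPolynomial (Fin 3) R :=
  LinearMap.mulLeft R (X 0) ∘ₗ formOf n ∘ₗ LinearMap.funLeft R R Sum.inl +
    Fintype.linearCombination R (minorForm a) ∘ₗ LinearMap.funLeft R R Sum.inr

/-- The square matrix of `spanMap`, for an arbitrary bijection between the two bases. -/
def spanMatrix (a : Fin 3 × Fin (n + 1) × Fin (n + 2) → R) :
    Matrix (Exponent n ⊕ Fin (n + 2)) (Exponent n ⊕ Fin (n + 2)) R :=
  LinearMap.toMatrix' (LinearMap.funLeft R R (Fintype.equivOfCardEq (card_exponent_sum n)) ∘ₗ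
    coeffs (n + 1) ∘ₗ spanMap a)

/-- The determinant of `spanMap`. If it is a unit, the maximal minors are linearly independent,
and forms of degree `n + 1` modulo their span are uniquely divisible by `X₀`. -/
def spanDet (a : Fin 3 × Fin (n + 1) × Fin (n + 2) → R) : R :=
  (spanMatrix a).det

/-- The solution of `spanMap a w = spanDet a • f` given by Cramer's rule. -/
def spanSolve (a : Fin 3 × Fin (n + 1) × Fin (n + 2) → R) :
    MvPolynomial (Fin 3) R →ₗ[R] Exponent n ⊕ Fin (n + 2) → R :=
  (spanMatrix a).adjugate.mulVecLin ∘ₗ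
    LinearMap.funLeft R R (Fintype.equivOfCardEq (card_exponent_sum n)) ∘ₗ coeffs (n + 1)

/-- `spanDet` times the matrix of `f ↦ Xᵢ f / X₀` on forms of degree `n` modulo the maximal
minors. -/
def mulMatrix (i : Fin 3) (a : Fin 3 × Fin (n + 1) × Fin (n + 2) → R) :
    Matrix (Exponent n) (Exponent n) R :=
  LinearMap.toMatrix' (LinearMap.funLeft R R Sum.inl ∘ₗ spanSolve a ∘ₗ
    LinearMap.mulLeft R (X i) ∘ₗ formOf n)

variable (a : Fin 3 × Fin (n + 1) × Fin (n + 2) → R)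

theorem spanMap_apply (w : Exponent n ⊕ Fin (n + 2) → R) :
    spanMap a w = X 0 * formOf n (w ∘ Sum.inl) + ∑ k, w (Sum.inr k) • minorForm a k := rfl

theorem isHomogeneous_X_mul_formOf {d : ℕ} (i : Fin 3) (w : Exponent d → R) :
    (X i * formOf d w).IsHomogeneous (d + 1) := by
  rw [add_comm]
  exact (isHomogeneous_X R i).mul (isHomogeneous_formOf w)

theorem isHomogeneous_spanMap (w : Exponent n ⊕ Fin (n + 2) → R) :
    (spanMap a w).IsHomogeneous (n + 1) :=
  (isHomogeneous_X_mul_formOf 0 _).add <| IsHomogeneous.sum _ _ _ fun k _ =>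
    (homogeneousSubmodule (Fin 3) R (n + 1)).smul_mem _ (isHomogeneous_minorForm a k)

theorem spanMatrix_mulVec (w : Exponent n ⊕ Fin (n + 2) → R) :
    spanMatrix a *ᵥ w =
      coeffs (n + 1) (spanMap a w) ∘ Fintype.equivOfCardEq (card_exponent_sum n) := by
  rw [spanMatrix, LinearMap.toMatrix'_mulVec]
  rfl

theorem spanMap_spanSolve {f : MvPolynomial (Fin 3) R} (hf : f.IsHomogeneous (n + 1)) :
    spanMap a (spanSolve a f) = spanDet a • f := by
  have hcoeffs : coeffs (n + 1) (spanMap a (spanSolve a f)) = coeffs (n + 1) (spanDet a • f) := by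
    apply (Fintype.equivOfCardEq (card_exponent_sum n)).surjective.injective_comp_right
    change coeffs (n + 1) (spanMap a (spanSolve a f)) ∘
      Fintype.equivOfCardEq (card_exponent_sum n) = _
    rw [← spanMatrix_mulVec, spanSolve, LinearMap.comp_apply, Matrix.mulVecLin_apply,
      Matrix.mulVec_mulVec, Matrix.mul_adjugate, Matrix.smul_mulVec, Matrix.one_mulVec, map_smul]
    rfl
  rw [← formOf_coeffs (isHomogeneous_spanMap a _), hcoeffs, map_smul, map_smul, formOf_coeffs hf]

theorem spanSolve_spanMap (w : Exponent n ⊕ Fin (n + 2) → R) :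
    spanSolve a (spanMap a w) = spanDet a • w := by
  calc spanSolve a (spanMap a w)
      = (spanMatrix a).adjugate *ᵥ spanMatrix a *ᵥ w := by
        rw [spanMatrix_mulVec]
        rfl
    _ = spanDet a • w := by
        rw [Matrix.mulVec_mulVec, Matrix.adjugate_mul, Matrix.smul_mulVec, Matrix.one_mulVec,
          spanDet]

theorem spanSolve_X_zero_mul {g : MvPolynomial (Fin 3) R} (hg : g.IsHomogeneous n) :
    spanSolve a (X 0 * g) = spanDet a • Sum.elim (coeffs n g) 0 := by
  rw [← spanSolve_spanMap, spanMap_apply, Sum.elim_comp_inl, formOf_coeffs hg]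
  simp

theorem spanSolve_minorForm (k : Fin (n + 2)) :
    spanSolve a (minorForm a k) =
      spanDet a • Sum.elim (0 : Exponent n → R) (Pi.single k 1) := by
  rw [← spanSolve_spanMap, spanMap_apply, Sum.elim_comp_inl, map_zero]
  simp [Pi.single_apply]

theorem mulMatrix_mulVec (i : Fin 3) (w : Exponent n → R) :
    mulMatrix i a *ᵥ w = spanSolve a (X i * formOf n w) ∘ Sum.inl := by
  rw [mulMatrix, LinearMap.toMatrix'_mulVec]
  rfl

theorem spanDet_smul_X_mul_formOf (i : Fin 3) (w : Exponent n → R) :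
    spanDet a • (X i * formOf n w) = X 0 * formOf n (mulMatrix i a *ᵥ w) +
      ∑ k, spanSolve a (X i * formOf n w) (Sum.inr k) • minorForm a k := by
  rw [mulMatrix_mulVec, ← spanMap_spanSolve a (isHomogeneous_X_mul_formOf i w), spanMap_apply]

theorem mulMatrix_zero_mulVec (w : Exponent n → R) :
    mulMatrix 0 a *ᵥ w = spanDet a • w := by
  rw [mulMatrix_mulVec, spanSolve_X_zero_mul a (isHomogeneous_formOf w), coeffs_formOf]
  rfl

theorem mulMatrix_mulVec_coeffs_X_zero_mul {d : ℕ} (a : Fin 3 × Fin (d + 2) × Fin (d + 3) → R)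
    (i : Fin 3) {g : MvPolynomial (Fin 3) R} (hg : g.IsHomogeneous d) :
    mulMatrix i a *ᵥ coeffs (d + 1) (X 0 * g) =
      spanDet a • coeffs (d + 1) (X i * g) := by
  have hXg (j : Fin 3) : (X j * g).IsHomogeneous (d + 1) := by
    rw [add_comm]
    exact (isHomogeneous_X R j).mul hg
  rw [mulMatrix_mulVec, formOf_coeffs (hXg 0), mul_left_comm, spanSolve_X_zero_mul a (hXg i)]
  rfl

theorem map_spanMap (f : R →+* S) (w : Exponent n ⊕ Fin (n + 2) → R) :
    map f (spanMap a w) = spanMap (f ∘ a) (f ∘ w) := by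
  simp [spanMap_apply, map_formOf, map_minorForm, smul_eq_C_mul, Function.comp_assoc]

theorem map_spanMatrix (f : R →+* S) : (spanMatrix a).map f = spanMatrix (f ∘ a) := by
  ext r c
  simp only [spanMatrix, Matrix.map_apply, LinearMap.toMatrix'_apply, LinearMap.comp_apply,
    LinearMap.funLeft_apply, coeffs_apply]
  rw [← coeff_map, map_spanMap]
  congr 3
  ext c'
  simp [Pi.single_apply, apply_ite f]

theorem map_spanDet (f : R →+* S) : f (spanDet a) = spanDet (f ∘ a) := by
  rw [spanDet, RingHom.map_det, RingHom.mapMatrix_apply, map_spanMatrix, spanDet]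

theorem map_spanSolve (f : R →+* S) (g : MvPolynomial (Fin 3) R) :
    f ∘ spanSolve a g = spanSolve (f ∘ a) (map f g) := by
  ext r
  simp only [spanSolve, Function.comp_apply, LinearMap.comp_apply, Matrix.mulVecLin_apply,
    RingHom.map_mulVec, ← RingHom.mapMatrix_apply, RingHom.map_adjugate]
  rw [RingHom.mapMatrix_apply, map_spanMatrix]
  congr 2

theorem map_mulMatrix (f : R →+* S) (i : Fin 3) :
    (mulMatrix i a).map f = mulMatrix i (f ∘ a) := by
  refine Matrix.ext_of_mulVec_single fun m => ?_
  have hsingle : (Pi.single m 1 : Exponent n → S) = f ∘ Pi.single m 1 := by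
    ext m'
    simp [Pi.single_apply, apply_ite f]
  rw [hsingle]
  ext m'
  rw [← RingHom.map_mulVec, mulMatrix_mulVec, mulMatrix_mulVec, ← map_formOf, ← map_X f,
    ← map_mul, ← map_spanSolve, Function.comp_assoc, Function.comp_apply (f := f)]

theorem monomialVec_vecMul_mulMatrix {a : Fin 3 × Fin (n + 1) × Fin (n + 2) → R} {p : Fin 3 → R}
    (hp : p 0 = 1) (h : ∀ k, rowMinor a p k = 0) (i : Fin 3) :
    monomialVec n p ᵥ* mulMatrix i a = (spanDet a * p i) • monomialVec n p := by
  refine dotProduct_eq _ _ fun w => ?_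
  have heval := congrArg (eval p) (spanDet_smul_X_mul_formOf a i w)
  simp only [smul_eval, map_mul, map_add, map_sum, eval_X, eval_minorForm, h, hp, mul_zero,
    Finset.sum_const_zero, add_zero, one_mul] at heval
  rw [← Matrix.dotProduct_mulVec, monomialVec_dotProduct, ← heval, smul_dotProduct,
    monomialVec_dotProduct, smul_eq_mul, mul_assoc]

end MultiplicationMatrices

section Coordinates

variable {R S : Type*} [CommRing R] [CommRing S] {n : ℕ}

/-- The determinant of the vectors `X₀ⁿ, A X₀ⁿ, A² X₀ⁿ, …`, with `A = mulMatrix 1 a`. -/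
def krylovDet (a : Fin 3 × Fin (n + 1) × Fin (n + 2) → R) : R :=
  (krylovMatrix (mulMatrix 1 a) (coeffs n (X 0 ^ n))).det

/-- A polynomial giving the coordinate `p 2` of a zero of the maximal minors as a function of
`p 1`, if `p 0 = 1`; see `eval_coordPoly`. -/
def coordPoly (a : Fin 3 × Fin (n + 1) × Fin (n + 2) → R) : Polynomial R :=
  krylovPoly (mulMatrix 1 a) (coeffs n (X 0 ^ n)) (mulMatrix 2 a *ᵥ coeffs n (X 0 ^ n))

theorem comp_coeffs_X_pow (f : R →+* S) (i : Fin 3) (d : ℕ) :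
    f ∘ coeffs d (X i ^ d : MvPolynomial (Fin 3) R) = coeffs d (X i ^ d) := by
  ext m
  rw [coeffs_apply, ← map_X f, ← map_pow, coeff_map]
  rfl

theorem map_krylovDet (f : R →+* S) (a : Fin 3 × Fin (n + 1) × Fin (n + 2) → R) :
    f (krylovDet a) = krylovDet (f ∘ a) := by
  rw [krylovDet, RingHom.map_det, RingHom.mapMatrix_apply, map_krylovMatrix, map_mulMatrix,
    comp_coeffs_X_pow, krylovDet]

theorem map_coordPoly (f : R →+* S) (a : Fin 3 × Fin (n + 1) × Fin (n + 2) → R) :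
    (coordPoly a).map f = coordPoly (f ∘ a) := by
  have hcol : f ∘ (mulMatrix 2 a *ᵥ coeffs n (X 0 ^ n)) =
      mulMatrix 2 (f ∘ a) *ᵥ coeffs n (X 0 ^ n) := by
    ext m
    rw [Function.comp_apply, RingHom.map_mulVec, map_mulMatrix, comp_coeffs_X_pow]
  rw [coordPoly, map_krylovPoly, map_mulMatrix, comp_coeffs_X_pow, hcol, coordPoly]

theorem map_charpoly_mulMatrix (f : R →+* S) (i : Fin 3)
    (a : Fin 3 × Fin (n + 1) × Fin (n + 2) → R) :
    (mulMatrix i a).charpoly.map f = (mulMatrix i (f ∘ a)).charpoly := by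
  rw [← Matrix.charpoly_map, map_mulMatrix]

theorem monomialVec_dotProduct_coeffs_X_pow (d : ℕ) (p : Fin 3 → R) (i : Fin 3) :
    monomialVec d p ⬝ᵥ coeffs d (X i ^ d) = p i ^ d := by
  rw [← eval_eq_monomialVec_dotProduct (isHomogeneous_X_pow i d)]
  simp

variable {a : Fin 3 × Fin (n + 1) × Fin (n + 2) → R} {p : Fin 3 → R}

theorem eval_charpoly_mulMatrix (hp : p 0 = 1) (h : ∀ k, rowMinor a p k = 0) :
    (mulMatrix 1 a).charpoly.eval (spanDet a * p 1) = 0 := by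
  have hsmul := congrArg (· ⬝ᵥ coeffs n (X 0 ^ n))
    (eval_charpoly_smul_of_vecMul_eq_smul (monomialVec_vecMul_mulMatrix hp h 1))
  simpa [monomialVec_dotProduct_coeffs_X_pow, hp] using hsmul

theorem eval_coordPoly (hp : p 0 = 1) (h : ∀ k, rowMinor a p k = 0) :
    (coordPoly a).eval (spanDet a * p 1) = krylovDet a * (spanDet a * p 2) := by
  have heval := eval_krylovPoly_mul (monomialVec_vecMul_mulMatrix hp h 1) (coeffs n (X 0 ^ n))
    (mulMatrix 2 a *ᵥ coeffs n (X 0 ^ n))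
  rwa [Matrix.dotProduct_mulVec, monomialVec_vecMul_mulMatrix hp h, smul_dotProduct,
    monomialVec_dotProduct_coeffs_X_pow, hp, one_pow, mul_one, smul_eq_mul, mul_one] at heval

end Coordinates

section Syzygies

variable {R : Type*} [CommRing R] {n : ℕ}

theorem exists_X_mul_monomial_eq {d : ℕ} (m : Exponent (d + 1)) (c : R) :
    ∃ (i : Fin 3) (m' : Exponent d), X i * monomial m'.1 c = monomial m.1 c := by
  obtain ⟨i, hi⟩ : ∃ i, m.1 i ≠ 0 := by
    by_contra! h
    have hdegree := m.degree_eq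
    rw [show m.1 = 0 from Finsupp.ext h, map_zero] at hdegree
    omega
  have hm : Finsupp.single i 1 + (m.1 - Finsupp.single i 1) = m.1 :=
    add_tsub_cancel_of_le (Finsupp.single_le_iff.2 (Nat.one_le_iff_ne_zero.2 hi))
  have hm' : (m.1 - Finsupp.single i 1).degree = d := by
    have hdegree := congrArg Finsupp.degree hm
    rw [map_add, m.degree_eq, Finsupp.degree_single] at hdegree
    omega
  exact ⟨i, ⟨_, mem_finsuppAntidiag_univ_iff.2 hm'⟩, by rw [X, monomial_mul, hm, one_mul]⟩

theorem exists_eq_sum_X_mul_formOf {d : ℕ} {f : MvPolynomial (Fin 3) R}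
    (hf : f.IsHomogeneous (d + 1)) :
    ∃ w : Fin 3 → Exponent d → R, f = ∑ i, X i * formOf d (w i) := by
  suffices f ∈ LinearMap.range (∑ i, LinearMap.mulLeft R (X i) ∘ₗ formOf d ∘ₗ LinearMap.proj i :
      (Fin 3 → Exponent d → R) →ₗ[R] MvPolynomial (Fin 3) R) by
    obtain ⟨w, rfl⟩ := this
    exact ⟨w, by simp⟩
  rw [← formOf_coeffs hf, formOf_apply]
  refine Submodule.sum_mem _ fun m _ => ?_
  obtain ⟨i, m', h⟩ := exists_X_mul_monomial_eq m (coeffs (d + 1) f m)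
  rw [← h, ← formOf_single]
  refine ⟨Pi.single i (Pi.single m' (coeffs (d + 1) f m)), ?_⟩
  rw [LinearMap.sum_apply, Finset.sum_eq_single i] <;> simp +contextual

/-- The map `(ℓ, w) ↦ ∑ₖ ℓₖ Δₖ + X₀² w` from families of linear forms and forms of degree `n` to
forms of degree `n + 2`, where the `Δₖ` are the maximal minors. -/
def relationMap (a : Fin 3 × Fin (n + 1) × Fin (n + 2) → R) :
    ((Fin (n + 2) → Exponent 1 → R) × (Exponent n → R)) →ₗ[R] MvPolynomial (Fin 3) R :=
  (∑ k, LinearMap.mulRight R (minorForm a k) ∘ₗ formOf 1 ∘ₗ LinearMap.proj k).coprod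
    (LinearMap.mulLeft R (X 0 ^ 2) ∘ₗ formOf n)

/-- The syzygies of the maximal minors given by the rows of the matrix `∑ᵢ Xᵢ a(i, ·, ·)`. -/
def syzygyMap (a : Fin 3 × Fin (n + 1) × Fin (n + 2) → R) :
    (Fin (n + 1) → R) →ₗ[R] (Fin (n + 2) → Exponent 1 → R) × (Exponent n → R) :=
  LinearMap.inl R _ _ ∘ₗ LinearMap.pi fun k => coeffs 1 ∘ₗ
    ((-1 : R) ^ (k : ℕ) • Fintype.linearCombination R fun j => contractRows (C ∘ a) X j k)

variable (a : Fin 3 × Fin (n + 1) × Fin (n + 2) → R)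

theorem relationMap_apply (l : Fin (n + 2) → Exponent 1 → R) (w : Exponent n → R) :
    relationMap a (l, w) = ∑ k, formOf 1 (l k) * minorForm a k + X 0 ^ 2 * formOf n w := by
  simp [relationMap]

theorem formOf_syzygyMap (y : Fin (n + 1) → R) (k : Fin (n + 2)) :
    formOf 1 ((syzygyMap a y).1 k) =
      (-1 : R) ^ (k : ℕ) • ∑ j, y j • contractRows (C ∘ a) X j k := by
  have hform : ((-1 : R) ^ (k : ℕ) • ∑ j, y j • contractRows (C ∘ a) X j k :
      MvPolynomial (Fin 3) R).IsHomogeneous 1 :=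
    (homogeneousSubmodule (Fin 3) R 1).smul_mem _ <| Submodule.sum_mem _ fun j _ =>
      (homogeneousSubmodule (Fin 3) R 1).smul_mem _ (isHomogeneous_contractRows_X a j k)
  exact formOf_coeffs hform

theorem relationMap_syzygyMap (y : Fin (n + 1) → R) : relationMap a (syzygyMap a y) = 0 := by
  have hrow (j : Fin (n + 1)) :
      ∑ k : Fin (n + 2), ((-1 : R) ^ (k : ℕ) • contractRows (C ∘ a) X j k) * minorForm a k = 0 := by
    simpa [smul_eq_C_mul, minorForm] using sum_contractRows_mul_rowMinor (C ∘ a) X j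
  calc relationMap a (syzygyMap a y)
      = ∑ k, formOf 1 ((syzygyMap a y).1 k) * minorForm a k := by
        rw [← Prod.mk.eta (p := syzygyMap a y), relationMap_apply]
        simp [syzygyMap]
    _ = ∑ j, y j • ∑ k : Fin (n + 2),
          ((-1 : R) ^ (k : ℕ) • contractRows (C ∘ a) X j k) * minorForm a k := by
        simp only [formOf_syzygyMap, Finset.smul_sum, Finset.sum_mul]
        rw [Finset.sum_comm]
        simp only [smul_mul_assoc, smul_comm (y _)]
    _ = 0 := by simp only [hrow, smul_zero, Finset.sum_const_zero]

end Syzygies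

section Field

variable {F : Type*} [Field F] {n : ℕ} {a : Fin 3 × Fin (n + 1) × Fin (n + 2) → F}

theorem exists_spanMap_eq (ha : spanDet a ≠ 0) {f : MvPolynomial (Fin 3) F}
    (hf : f.IsHomogeneous (n + 1)) : ∃ w, spanMap a w = f :=
  ⟨(spanDet a)⁻¹ • spanSolve a f, by
    rw [map_smul, spanMap_spanSolve a hf, smul_smul, inv_mul_cancel₀ ha, one_smul]⟩

theorem minorForm_ne_zero (ha : spanDet a ≠ 0) (k : Fin (n + 2)) : minorForm a k ≠ 0 := by
  intro h
  have hsolve := congrFun (spanSolve_minorForm a k) (Sum.inr k)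
  simp [h, ha.symm] at hsolve

theorem apply_zero_ne_zero_of_rowMinor (ha : spanDet a ≠ 0) {p : Fin 3 → F} (hp : p ≠ 0)
    (h : ∀ k, rowMinor a p k = 0) : p 0 ≠ 0 := by
  refine fun h0 => hp (funext fun i => ?_)
  obtain ⟨w, hw⟩ := exists_spanMap_eq ha (isHomogeneous_X_pow (R := F) i (n + 1))
  have heval := congrArg (eval p) hw
  rw [spanMap_apply] at heval
  simpa [smul_eval, eval_minorForm, h, h0] using heval.symm

theorem syzygyMap_injective (ha : spanDet a ≠ 0) : Function.Injective (syzygyMap a) := by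
  rw [injective_iff_map_eq_zero]
  intro y hy
  by_contra hne
  refine minorForm_ne_zero ha 0 (Matrix.exists_vecMul_eq_zero_iff.1 ⟨C ∘ y, fun h => hne ?_, ?_⟩)
  · ext j
    exact C_injective (Fin 3) F (by simpa using congrFun h j)
  · ext1 k
    have hform := formOf_syzygyMap a y (Fin.succAbove 0 k)
    rw [hy, Prod.fst_zero, Pi.zero_apply, map_zero, eq_comm, smul_eq_zero] at hform
    exact (congrArg _ (_root_.funext fun j => (smul_eq_C_mul _ _).symm)).trans
      (hform.resolve_left (by simp))

theorem X_mul_mem_range_relationMap (ha : spanDet a ≠ 0) (i : Fin 3) {f : MvPolynomial (Fin 3) F}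
    (hf : f.IsHomogeneous (n + 1)) : X i * f ∈ LinearMap.range (relationMap a) := by
  obtain ⟨w, rfl⟩ := exists_spanMap_eq ha hf
  obtain ⟨w', hw'⟩ := exists_spanMap_eq ha (isHomogeneous_X_mul_formOf i (w ∘ Sum.inl))
  rw [spanMap_apply] at hw' ⊢
  set ℓ : Fin (n + 2) → MvPolynomial (Fin 3) F := fun k =>
    w' (Sum.inr k) • X 0 + w (Sum.inr k) • X i with hℓ
  have hform (k : Fin (n + 2)) : formOf 1 (coeffs 1 (ℓ k)) = ℓ k :=
    formOf_coeffs <| Submodule.add_mem (homogeneousSubmodule (Fin 3) F 1)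
      (Submodule.smul_mem _ _ (isHomogeneous_X F 0)) (Submodule.smul_mem _ _ (isHomogeneous_X F i))
  have hsum : ∑ k, ℓ k * minorForm a k =
      X 0 * ∑ k, w' (Sum.inr k) • minorForm a k + X i * ∑ k, w (Sum.inr k) • minorForm a k := by
    simp only [hℓ, Finset.mul_sum, ← Finset.sum_add_distrib, smul_eq_C_mul]
    exact Finset.sum_congr rfl fun k _ => by ring
  refine ⟨(fun k => coeffs 1 (ℓ k), w' ∘ Sum.inl), ?_⟩
  rw [relationMap_apply]
  simp only [hform, hsum]
  linear_combination X 0 * hw'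

theorem range_formOf_le_range_relationMap (ha : spanDet a ≠ 0) :
    LinearMap.range (formOf (R := F) (n + 2)) ≤ LinearMap.range (relationMap a) := by
  rintro _ ⟨v, rfl⟩
  obtain ⟨w, hw⟩ := exists_eq_sum_X_mul_formOf (isHomogeneous_formOf v)
  rw [hw]
  exact Submodule.sum_mem _ fun i _ => X_mul_mem_range_relationMap ha i (isHomogeneous_formOf _)

theorem ker_relationMap (ha : spanDet a ≠ 0) :
    LinearMap.ker (relationMap a) = LinearMap.range (syzygyMap a) := by
  have hle : LinearMap.range (syzygyMap a) ≤ LinearMap.ker (relationMap a) := by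
    rintro _ ⟨y, rfl⟩
    exact relationMap_syzygyMap a y
  have hrank := LinearMap.finrank_range_add_finrank_ker (relationMap a)
  have hrange := Submodule.finrank_mono (range_formOf_le_range_relationMap ha)
  have hsyzygy := LinearMap.finrank_range_of_inj (syzygyMap_injective ha)
  rw [LinearMap.finrank_range_of_inj formOf_injective] at hrange
  simp only [Module.finrank_prod, Module.finrank_pi_fintype, card_exponent,
    Finset.sum_const, Finset.card_univ, Fintype.card_fin, smul_eq_mul,
    Module.finrank_self, show (1 + 2).choose 2 = 3 from rfl] at hrank hrange hsyzygy
  have hchoose : (n + 2 + 2).choose 2 = (n + 2).choose 2 + (n + 2) + (n + 3) := by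
    rw [Nat.choose_succ_succ' (n + 3) 1, Nat.choose_succ_succ' (n + 2) 1, Nat.choose_one_right,
      Nat.choose_one_right]
    ring
  exact (Submodule.eq_of_le_of_finrank_le hle (by omega)).symm

theorem eq_zero_of_relationMap_eq_zero (ha : spanDet a ≠ 0) {l : Fin (n + 2) → Exponent 1 → F}
    {w : Exponent n → F} (h : relationMap a (l, w) = 0) : w = 0 := by
  obtain ⟨y, hy⟩ : (l, w) ∈ LinearMap.range (syzygyMap a) := by
    rw [← ker_relationMap ha]
    exact h
  exact (congrArg Prod.snd hy).symm

theorem mulMatrix_comm (ha : spanDet a ≠ 0) :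
    mulMatrix 1 a * mulMatrix 2 a = mulMatrix 2 a * mulMatrix 1 a := by
  refine Matrix.ext_of_mulVec_single fun m => ?_
  rw [← Matrix.mulVec_mulVec, ← Matrix.mulVec_mulVec, ← sub_eq_zero]
  generalize (Pi.single m 1 : Exponent n → F) = w
  set w₁ := mulMatrix 1 a *ᵥ w
  set w₂ := mulMatrix 2 a *ᵥ w
  set c : Fin 3 → (Exponent n → F) → Fin (n + 2) → F :=
    fun i v k => spanSolve a (X i * formOf n v) (Sum.inr k)
  set ℓ : Fin (n + 2) → MvPolynomial (Fin 3) F := fun k =>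
    (c 1 w₂ k - c 2 w₁ k) • X 0 + (spanDet a * c 2 w k) • X 1 - (spanDet a * c 1 w k) • X 2 with hℓ
  have hform (k : Fin (n + 2)) : formOf 1 (coeffs 1 (ℓ k)) = ℓ k :=
    formOf_coeffs <| Submodule.sub_mem (homogeneousSubmodule (Fin 3) F 1)
      (Submodule.add_mem _ (Submodule.smul_mem _ _ (isHomogeneous_X F 0))
        (Submodule.smul_mem _ _ (isHomogeneous_X F 1)))
      (Submodule.smul_mem _ _ (isHomogeneous_X F 2))
  have hsum : ∑ k, ℓ k * minorForm a k =
      X 0 * ∑ k, c 1 w₂ k • minorForm a k - X 0 * ∑ k, c 2 w₁ k • minorForm a k +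
      C (spanDet a) * X 1 * ∑ k, c 2 w k • minorForm a k -
      C (spanDet a) * X 2 * ∑ k, c 1 w k • minorForm a k := by
    simp only [hℓ, Finset.mul_sum, ← Finset.sum_sub_distrib, ← Finset.sum_add_distrib,
      smul_eq_C_mul, map_sub, map_mul]
    exact Finset.sum_congr rfl fun k _ => by ring
  refine eq_zero_of_relationMap_eq_zero ha (l := fun k => coeffs 1 (ℓ k)) ?_
  simp only [relationMap_apply, hform, hsum, map_sub]
  have h₁ := spanDet_smul_X_mul_formOf a 1 w
  have h₂ := spanDet_smul_X_mul_formOf a 2 w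
  have h₁₂ := spanDet_smul_X_mul_formOf a 1 w₂
  have h₂₁ := spanDet_smul_X_mul_formOf a 2 w₁
  rw [smul_eq_C_mul] at h₁ h₂ h₁₂ h₂₁
  linear_combination C (spanDet a) * X 2 * h₁ - C (spanDet a) * X 1 * h₂ - X 0 * h₁₂ + X 0 * h₂₁

end Field

section Eigenvectors

variable {F : Type*} [Field F] {n : ℕ} {a : Fin 3 × Fin (n + 1) × Fin (n + 2) → F}
  {φ : Exponent n → F} {p : Fin 3 → F} {r : F}

theorem eq_zero_of_vecMul_mulMatrix_eq_smul (hk : krylovDet a ≠ 0)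
    (h : φ ᵥ* mulMatrix 1 a = r • φ) (h0 : φ ⬝ᵥ coeffs n (X 0 ^ n) = 0) : φ = 0 := by
  by_contra hne
  refine hk (Matrix.exists_vecMul_eq_zero_iff.1 ⟨φ, hne, ?_⟩)
  ext m
  rw [vecMul_krylovMatrix h, h0, mul_zero, Pi.zero_apply]

theorem exists_vecMul_eq_smul_of_eval_charpoly_eq_zero {ι : Type*} [Fintype ι] [DecidableEq ι]
    {A : Matrix ι ι F} (hr : A.charpoly.eval r = 0) : ∃ φ ≠ 0, φ ᵥ* A = r • φ := by
  rw [Matrix.eval_charpoly, ← Matrix.exists_vecMul_eq_zero_iff] at hr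
  obtain ⟨φ, hφ, h⟩ := hr
  refine ⟨φ, hφ, ?_⟩
  rw [Matrix.vecMul_sub, sub_eq_zero] at h
  rw [← h, Matrix.scalar_apply, ← Matrix.smul_one_eq_diagonal, Matrix.vecMul_smul,
    Matrix.vecMul_one]

theorem dotProduct_coeffs_X_mul {d : ℕ} {a : Fin 3 × Fin (d + 2) × Fin (d + 3) → F}
    (ha : spanDet a ≠ 0) {φ : Exponent (d + 1) → F} {i : Fin 3}
    (h : φ ᵥ* mulMatrix i a = (spanDet a * p i) • φ) {f : MvPolynomial (Fin 3) F}
    (hf : f.IsHomogeneous d) :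
    φ ⬝ᵥ coeffs (d + 1) (X i * f) = p i * (φ ⬝ᵥ coeffs (d + 1) (X 0 * f)) := by
  apply mul_left_cancel₀ ha
  rw [← smul_eq_mul, ← dotProduct_smul, ← mulMatrix_mulVec_coeffs_X_zero_mul a i hf,
    Matrix.dotProduct_mulVec, h, smul_dotProduct, smul_eq_mul, mul_assoc]

theorem dotProduct_coeffs_X_pow_mul (ha : spanDet a ≠ 0)
    (h : ∀ i, φ ᵥ* mulMatrix i a = (spanDet a * p i) • φ)
    (hφ : φ ⬝ᵥ coeffs n (X 0 ^ n) = 1) {k : ℕ} {f : MvPolynomial (Fin 3) F}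
    (hf : f.IsHomogeneous k) {j : ℕ} (hjk : j + k = n) :
    φ ⬝ᵥ coeffs n (X 0 ^ j * f) = eval p f := by
  induction k generalizing f j with
  | zero =>
    obtain ⟨c, rfl⟩ : ∃ c, f = C c :=
      ⟨_, totalDegree_eq_zero_iff_eq_C.1 ((totalDegree_zero_iff_isHomogeneous _).2 hf)⟩
    obtain rfl : j = n := hjk
    rw [mul_comm, ← smul_eq_C_mul, map_smul, dotProduct_smul, hφ, eval_C, smul_eq_mul, mul_one]
  | succ k ih =>
    obtain ⟨d, rfl⟩ : ∃ d, n = d + 1 := ⟨j + k, hjk.symm⟩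
    obtain ⟨w, rfl⟩ := exists_eq_sum_X_mul_formOf hf
    have hdegree (i : Fin 3) : (X 0 ^ j * formOf k (w i)).IsHomogeneous d := by
      rw [← Nat.succ_injective hjk]
      exact (isHomogeneous_X_pow 0 j).mul (isHomogeneous_formOf _)
    rw [Finset.mul_sum, map_sum, dotProduct_sum, map_sum]
    refine Finset.sum_congr rfl fun i _ => ?_
    rw [mul_left_comm, dotProduct_coeffs_X_mul ha (h i) (hdegree i), ← mul_assoc (X 0), ← pow_succ',
      ih (isHomogeneous_formOf _) (by omega), map_mul, eval_X]

theorem eq_monomialVec_of_vecMul_mulMatrix (ha : spanDet a ≠ 0)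
    (h : ∀ i, φ ᵥ* mulMatrix i a = (spanDet a * p i) • φ)
    (hφ : φ ⬝ᵥ coeffs n (X 0 ^ n) = 1) : φ = monomialVec n p := by
  refine dotProduct_eq _ _ fun w => ?_
  rw [monomialVec_dotProduct, ← dotProduct_coeffs_X_pow_mul ha h hφ (isHomogeneous_formOf w)
    (zero_add n), pow_zero, one_mul, coeffs_formOf]

theorem rowMinor_eq_zero_of_vecMul_mulMatrix (ha : spanDet a ≠ 0)
    (h : ∀ i, monomialVec n p ᵥ* mulMatrix i a =
      (spanDet a * p i) • monomialVec n p) (k : Fin (n + 2)) : rowMinor a p k = 0 := by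
  obtain ⟨w, hw⟩ := exists_eq_sum_X_mul_formOf (isHomogeneous_minorForm a k)
  have hdot (i : Fin 3) : monomialVec n p ⬝ᵥ (spanSolve a (X i * formOf n (w i)) ∘ Sum.inl) =
      spanDet a * eval p (X i * formOf n (w i)) := by
    rw [← mulMatrix_mulVec, Matrix.dotProduct_mulVec, h, smul_dotProduct, monomialVec_dotProduct,
      map_mul, eval_X, smul_eq_mul, mul_assoc]
  have hsolve : spanSolve a (minorForm a k) ∘ Sum.inl = 0 := by
    ext m
    simp [spanSolve_minorForm]
  refine (mul_eq_zero.1 ?_).resolve_left ha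
  calc spanDet a * rowMinor a p k
      = ∑ i, monomialVec n p ⬝ᵥ (spanSolve a (X i * formOf n (w i)) ∘ Sum.inl) := by
        rw [← eval_minorForm, hw, map_sum, Finset.mul_sum]
        exact Finset.sum_congr rfl fun i _ => (hdot i).symm
    _ = monomialVec n p ⬝ᵥ (spanSolve a (minorForm a k) ∘ Sum.inl) := by
        rw [← dotProduct_sum, hw, map_sum]
        congr 1
    _ = 0 := by rw [hsolve, dotProduct_zero]

theorem exists_rowMinor_eq_zero_of_root (ha : spanDet a ≠ 0) (hk : krylovDet a ≠ 0)
    (hr : (mulMatrix 1 a).charpoly.eval r = 0) :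
    ∃ p : Fin 3 → F, p 0 = 1 ∧ spanDet a * p 1 = r ∧ ∀ k, rowMinor a p k = 0 := by
  obtain ⟨ψ, hψ, hψr⟩ := exists_vecMul_eq_smul_of_eval_charpoly_eq_zero hr
  set c := ψ ⬝ᵥ coeffs n (X 0 ^ n)
  have hc : c ≠ 0 := fun h => hψ (eq_zero_of_vecMul_mulMatrix_eq_smul hk hψr h)
  obtain ⟨φ, hφ, hφr⟩ : ∃ φ, φ ⬝ᵥ coeffs n (X 0 ^ n) = 1 ∧
      φ ᵥ* mulMatrix 1 a = r • φ :=
    ⟨c⁻¹ • ψ, by rw [smul_dotProduct, smul_eq_mul, inv_mul_cancel₀ hc], by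
      rw [Matrix.smul_vecMul, hψr, smul_comm]⟩
  set s := φ ᵥ* mulMatrix 2 a ⬝ᵥ coeffs n (X 0 ^ n) with hs
  have hφs : φ ᵥ* mulMatrix 2 a = s • φ := by
    rw [← sub_eq_zero]
    refine eq_zero_of_vecMul_mulMatrix_eq_smul (r := r) hk ?_ ?_
    · rw [Matrix.sub_vecMul, Matrix.vecMul_vecMul, ← mulMatrix_comm ha, ← Matrix.vecMul_vecMul,
        hφr, Matrix.smul_vecMul, Matrix.smul_vecMul, hφr, smul_sub, smul_comm r s]
    · rw [sub_dotProduct, smul_dotProduct, hφ, ← hs, smul_eq_mul, mul_one, sub_self]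
  have hφp (i : Fin 3) : φ ᵥ* mulMatrix i a =
      (spanDet a * ![1, r / spanDet a, s / spanDet a] i) • φ := by
    fin_cases i
    · refine dotProduct_eq _ _ fun w => ?_
      simp [← Matrix.dotProduct_mulVec, mulMatrix_zero_mulVec]
    · simpa [mul_div_cancel₀ _ ha] using hφr
    · simpa [mul_div_cancel₀ _ ha] using hφs
  refine ⟨![1, r / spanDet a, s / spanDet a], rfl, mul_div_cancel₀ _ ha,
    rowMinor_eq_zero_of_vecMul_mulMatrix ha ?_⟩
  rwa [← eq_monomialVec_of_vecMul_mulMatrix ha hφp hφ]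

end Eigenvectors

section MinorVector

variable {R : Type*} [CommRing R] {l m n : ℕ}

theorem contractRows_add (a : Fin l × Fin m × Fin n → R) (s s' : Fin l → R) :
    contractRows a (s + s') = contractRows a s + contractRows a s' := by
  ext j k
  simp [contractRows, mul_add, Finset.sum_add_distrib]

theorem contractRows_add_smul_mulVec (a : Fin l × Fin m × Fin n → R) {s s' : Fin l → R}
    {x : Fin n → R} (h : contractRows a s *ᵥ x = 0) (h' : contractRows a s' *ᵥ x = 0)
    (b c : R) : contractRows a (b • s + c • s') *ᵥ x = 0 := by
  rw [contractRows_add, contractRows_smul, contractRows_smul, Matrix.add_mulVec,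
    Matrix.smul_mulVec, Matrix.smul_mulVec, h, h', smul_zero, smul_zero, add_zero]

variable {a : Fin l × Fin m × Fin (m + 1) → R} {s : Fin l → R}

theorem rowMinor_eq_zero_of_vecMul {y : Fin m → R} (h : y ᵥ* contractRows a s = 0)
    (hy : ∃ j, IsUnit (y j)) (k : Fin (m + 1)) : rowMinor a s k = 0 := by
  obtain ⟨j, hj⟩ := hy
  have hsub : y ᵥ* (contractRows a s).submatrix id k.succAbove = 0 :=
    _root_.funext fun i => congrFun h (k.succAbove i)
  have hsmul : rowMinor a s k • y = 0 := by
    rw [rowMinor, ← Matrix.vecMul_one y, ← Matrix.vecMul_smul, ← Matrix.mul_adjugate,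
      ← Matrix.vecMul_vecMul, hsub, Matrix.zero_vecMul]
  exact hj.mul_left_eq_zero.1 (congrFun hsmul j)

theorem mul_rowMinor_comm {x : Fin (m + 1) → R} (h : contractRows a s *ᵥ x = 0)
    (k i : Fin (m + 1)) :
    x i * ((-1) ^ (k : ℕ) * rowMinor a s k) = x k * ((-1) ^ (i : ℕ) * rowMinor a s i) := by
  set N : Matrix (Fin (m + 1)) (Fin (m + 1)) R :=
    Matrix.of (Fin.cons (Pi.single i 1) (contractRows a s))
  have hN0 (r) : N 0 r = (Pi.single i 1 : Fin (m + 1) → R) r := rfl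
  have hx : N *ᵥ x = Pi.single 0 (x i) := by
    ext r
    refine Fin.cases ?_ (fun j => ?_) r
    · exact (single_dotProduct _ _ i).trans (one_mul _)
    · rw [Pi.single_eq_of_ne (Fin.succ_ne_zero j)]
      exact congrFun h j
  have hdet : N.det = (-1) ^ (i : ℕ) * rowMinor a s i := by
    rw [Matrix.det_succ_row_zero, Finset.sum_eq_single i]
    · rw [hN0, Pi.single_eq_same, mul_one]
      rfl
    · intro b _ hb
      rw [hN0, Pi.single_eq_of_ne hb, mul_zero, zero_mul]
    · simp
  have hadj : N.adjugate k 0 = (-1) ^ (k : ℕ) * rowMinor a s k := by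
    rw [Matrix.adjugate_fin_succ_eq_det_submatrix, Fin.val_zero, zero_add]
    rfl
  have hcramer : N.det • x = N.adjugate *ᵥ Pi.single 0 (x i) := by
    rw [← hx, Matrix.mulVec_mulVec, Matrix.adjugate_mul, Matrix.smul_mulVec, Matrix.one_mulVec]
  simpa [hdet, hadj, mul_comm] using (congrFun hcramer k).symm

theorem rowMinor_eq_zero_of_mulVec {x : Fin (m + 1) → R} (h : contractRows a s *ᵥ x = 0)
    {i : Fin (m + 1)} (hi : IsUnit (x i)) (h0 : rowMinor a s i = 0) (k : Fin (m + 1)) :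
    rowMinor a s k = 0 := by
  have hcomm := mul_rowMinor_comm h k i
  rw [h0, mul_zero, mul_zero] at hcomm
  exact (IsUnit.mul_right_eq_zero (isUnit_one.neg.pow _)).1 (hi.mul_right_eq_zero.1 hcomm)

end MinorVector

section DualNumbers

open TrivSqZeroExt

variable {F : Type*} [Field F] {l m n : ℕ}

theorem contractRows_firstOrderPoint (a : Fin l × Fin m × Fin n → F) (q v : Fin l → F) (j : Fin m)
    (k : Fin n) : contractRows (inlHom F F ∘ a) (firstOrderPoint q v) j k =
      inl (contractRows a q j k) + inr (contractRows a v j k) := by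
  ext <;> simp [contractRows, firstOrderPoint, fst_sum, snd_sum]

theorem firstOrderPoint_vecMul_contractRows (a : Fin l × Fin m × Fin n → F) (q v : Fin l → F)
    (y w : Fin m → F) :
    firstOrderPoint y w ᵥ* contractRows (inlHom F F ∘ a) (firstOrderPoint q v) =
    firstOrderPoint (y ᵥ* contractRows a q)
      (y ᵥ* contractRows a v + w ᵥ* contractRows a q) := by
  ext k <;> simp [Matrix.vecMul, dotProduct, contractRows_firstOrderPoint, firstOrderPoint,
    fst_sum, snd_sum, Finset.sum_add_distrib, mul_comm]

theorem contractRows_firstOrderPoint_mulVec (a : Fin l × Fin m × Fin n → F) (q v : Fin l → F)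
    (x : Fin n → F) :
    contractRows (inlHom F F ∘ a) (firstOrderPoint q v) *ᵥ (inlHom F F ∘ x) =
      firstOrderPoint (contractRows a q *ᵥ x) (contractRows a v *ᵥ x) := by
  ext j <;> simp [Matrix.mulVec, dotProduct, contractRows_firstOrderPoint, firstOrderPoint,
    fst_sum, snd_sum, mul_comm]

theorem adjugate_eq_zero_of_vecMul {ι : Type*} [Fintype ι] [DecidableEq ι] {D : Matrix ι ι F}
    {y w : ι → F} (hy : y ᵥ* D = 0) (hw : w ᵥ* D = 0)
    (hli : LinearIndependent F ![y, w]) : D.adjugate = 0 := by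
  ext i j
  rw [Matrix.adjugate_apply, Matrix.zero_apply, ← Matrix.exists_vecMul_eq_zero_iff]
  obtain ⟨z, hz0, hzj, hzD⟩ : ∃ z : ι → F, z ≠ 0 ∧ z j = 0 ∧ z ᵥ* D = 0 := by
    rw [LinearIndependent.pair_iff] at hli
    by_cases h : y j = 0
    · exact ⟨y, fun h0 => one_ne_zero (hli 1 0 (by simp [h0])).1, h, hy⟩
    · refine ⟨w j • y + (-y j) • w, fun h0 => h (by simpa using (hli _ _ h0).2), ?_, ?_⟩
      · simp [mul_comm]
      · rw [Matrix.add_vecMul, Matrix.smul_vecMul, Matrix.smul_vecMul, hy, hw, smul_zero,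
          smul_zero, add_zero]
  refine ⟨z, hz0, ?_⟩
  rw [← hzD]
  ext k
  simp only [Matrix.vecMul, dotProduct]
  refine Finset.sum_congr rfl fun i _ => ?_
  by_cases hi : i = j
  · simp [hi, hzj]
  · rw [Matrix.updateRow_ne hi]

/-- The corank being at least two, the adjugate of `D` is divisible by `ε`, and the determinant
by `ε² = 0`. -/
theorem det_eq_zero_of_vecMul_map_fst {ι : Type*} [Fintype ι] [DecidableEq ι]
    {D : Matrix ι ι (DualNumber F)} {y w : ι → F} (hy : y ᵥ* D.map fst = 0)
    (hw : w ᵥ* D.map fst = 0) (hli : LinearIndependent F ![y, w]) : D.det = 0 := by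
  have hadj (i j) : (D.adjugate i j).fst = 0 := by
    have hmap := RingHom.map_adjugate (fstHom F F F : DualNumber F →+* F) D
    have hzero := adjugate_eq_zero_of_vecMul hy hw hli
    exact congrFun (congrFun (hmap.trans hzero) i) j
  have hvec (i) : (((inlHom F F ∘ y) ᵥ* D) i).fst = 0 := by
    simpa [Matrix.vecMul, dotProduct, fst_sum] using congrFun hy i
  obtain ⟨j, hj⟩ : ∃ j, y j ≠ 0 := Function.ne_iff.1 (hli.ne_zero 0)
  have hdet : D.det • (inlHom F F ∘ y) = 0 := by
    rw [← Matrix.vecMul_one (inlHom F F ∘ y), ← Matrix.vecMul_smul, ← Matrix.mul_adjugate,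
      ← Matrix.vecMul_vecMul]
    ext i <;> rw [Matrix.vecMul, dotProduct] <;> simp [fst_sum, snd_sum, hadj, hvec]
  have hunit : IsUnit (inlHom F F (y j)) := (isUnit_iff_ne_zero.2 hj).map _
  exact hunit.mul_left_eq_zero.1 (congrFun hdet j)

theorem rowMinor_firstOrderPoint_eq_zero {a : Fin l × Fin m × Fin (m + 1) → F} {q : Fin l → F}
    {y w : Fin m → F} (hy : y ᵥ* contractRows a q = 0)
    (hw : w ᵥ* contractRows a q = 0) (hli : LinearIndependent F ![y, w])
    (v : Fin l → F) (k : Fin (m + 1)) :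
    rowMinor (inlHom F F ∘ a) (firstOrderPoint q v) k = 0 := by
  have hfst : ((contractRows (inlHom F F ∘ a) (firstOrderPoint q v)).submatrix id
      k.succAbove).map fst = (contractRows a q).submatrix id k.succAbove := by
    ext i j
    simp [contractRows_firstOrderPoint]
  refine det_eq_zero_of_vecMul_map_fst (y := y) (w := w) ?_ ?_ hli <;> rw [hfst]
  · exact _root_.funext fun i => congrFun hy (k.succAbove i)
  · exact _root_.funext fun i => congrFun hw (k.succAbove i)

theorem aeval_inl_add_inr (f : Polynomial F) (z v : F) :
    Polynomial.aeval (inl z + inr v : DualNumber F) f =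
      inl (f.eval z) + inr (f.derivative.eval z * v) := by
  have hinl (g : Polynomial F) :
      Polynomial.aeval (inl z : DualNumber F) g = inl (g.eval z) :=
    Polynomial.aeval_algebraMap_apply_eq_algebraMap_eval z g
  rw [Polynomial.aeval_add_of_sq_eq_zero _ _ _ (by rw [pow_two, inr_mul_inr]), hinl, hinl,
    inl_mul_inr, smul_eq_mul]

end DualNumbers

section General

open TrivSqZeroExt

variable {F : Type*} [Field F] {n : ℕ} {ι : Type*}

/-- The open condition on the coefficients `a` used for the theorem: the maximal minors of
`∑ᵢ sᵢ a(i, ·, ·)` vanish exactly at the points `p i`, which lie in the chart `s₀ = 1`, are reduced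
(no tangent vector `v` over the dual numbers) and in general position. -/
structure IsGeneral (a : Fin 3 × Fin (n + 1) × Fin (n + 2) → F) (p : ι → Fin 3 → F) : Prop where
  coord_zero_ne_zero : ∀ q : Fin 3 → F, q ≠ 0 → (∀ k, rowMinor a q k = 0) → q 0 ≠ 0
  normalized : ∀ i, p i 0 = 1
  injective : Function.Injective p
  rowMinor_eq_zero : ∀ i k, rowMinor a (p i) k = 0
  complete : ∀ q : Fin 3 → F, q 0 = 1 → (∀ k, rowMinor a q k = 0) → ∃ i, q = p i
  reduced : ∀ q v : Fin 3 → F, q 0 = 1 → v 0 = 0 →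
    (∀ k, rowMinor (inlHom F F ∘ a) (firstOrderPoint q v) k = 0) → v = 0
  position : ∀ (d : ℕ) (e : Exponent d ↪ ι) (f : MvPolynomial (Fin 3) F), f.IsHomogeneous d →
    (∀ m, eval (p (e m)) f = 0) → f = 0

theorem eq_zero_of_rowMinor_firstOrderPoint {a : Fin 3 × Fin (n + 1) × Fin (n + 2) → F}
    (ha : spanDet a ≠ 0) (hk : krylovDet a ≠ 0) (hχ : (mulMatrix 1 a).charpoly.Separable)
    {q v : Fin 3 → F} (hq : q 0 = 1) (hv : v 0 = 0)
    (h : ∀ k, rowMinor (inlHom F F ∘ a) (firstOrderPoint q v) k = 0) : v = 0 := by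
  have h0 : firstOrderPoint q v 0 = (1 : DualNumber F) := by simp [firstOrderPoint, hq, hv]
  have hcoord (i) : spanDet (inlHom F F ∘ a) * firstOrderPoint q v i =
      inl (spanDet a * q i) + inr (spanDet a * v i) := by
    rw [← map_spanDet]
    ext <;> simp [firstOrderPoint]
  have hroot := eval_charpoly_mulMatrix h0 h
  rw [← map_charpoly_mulMatrix, hcoord, Polynomial.eval_map] at hroot
  replace hroot := (aeval_inl_add_inr _ _ _).symm.trans hroot
  have hv1 : v 1 = 0 := by
    have hsnd := congrArg snd hroot
    have hder : (mulMatrix 1 a).charpoly.derivative.eval (spanDet a * q 1) ≠ 0 :=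
      hχ.eval₂_derivative_ne_zero (RingHom.id F) (by simpa using congrArg fst hroot)
    simpa [ha, hder] using hsnd
  have hv2 : v 2 = 0 := by
    have hpoly := eval_coordPoly h0 h
    rw [← map_coordPoly, hcoord, hcoord, ← map_krylovDet, hv1, mul_zero, inr_zero, add_zero,
      ← inlHom_apply, Polynomial.eval_map_apply] at hpoly
    simpa [ha, hk] using congrArg snd hpoly
  ext i
  fin_cases i
  · exact hv
  · exact hv1
  · exact hv2

namespace IsGeneral

variable {a : Fin 3 × Fin (n + 1) × Fin (n + 2) → F} {p : ι → Fin 3 → F}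

theorem eq_smul (hp : IsGeneral a p) {q : Fin 3 → F} (hq : q ≠ 0)
    (h : ∀ k, rowMinor a q k = 0) : ∃ i, q = q 0 • p i := by
  have h0 := hp.coord_zero_ne_zero q hq h
  obtain ⟨i, hi⟩ := hp.complete ((q 0)⁻¹ • q) (by simp [h0]) fun k => by
    rw [rowMinor_smul, h, mul_zero]
  exact ⟨i, by rw [← hi, smul_smul, mul_inv_cancel₀ h0, one_smul]⟩

end IsGeneral

/-- The map `(v, w) ↦ yᵀ C(v) + wᵀ C(s)`, where `C(s) = ∑ᵢ sᵢ a(i, ·, ·)`. If `yᵀ C(s) = 0`, its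
kernel consists of the first order deformations of the solution `(s, y)`. -/
def deformationMap (a : Fin 3 × Fin (n + 1) × Fin (n + 2) → F) (s : Fin 3 → F)
    (y : Fin (n + 1) → F) : ((Fin 3 → F) × (Fin (n + 1) → F)) →ₗ[F] (Fin (n + 2) → F) where
  toFun u := y ᵥ* contractRows a u.1 + u.2 ᵥ* contractRows a s
  map_add' u u' := by
    rw [Prod.fst_add, Prod.snd_add, contractRows_add, Matrix.vecMul_add, Matrix.add_vecMul]
    abel
  map_smul' c u := by
    rw [Prod.smul_fst, Prod.smul_snd, contractRows_smul, Matrix.vecMul_smul, Matrix.smul_vecMul,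
      RingHom.id_apply, smul_add]

variable {a : Fin 3 × Fin (n + 1) × Fin (n + 2) → F} {s : Fin 3 → F} {y : Fin (n + 1) → F}
  {x : Fin (n + 2) → F}

theorem three_le_finrank_ker_deformationMap (hx : x ≠ 0) (hs : contractRows a s *ᵥ x = 0)
    (hy : ∀ v, y ⬝ᵥ contractRows a v *ᵥ x = 0) :
    3 ≤ Module.finrank F (LinearMap.ker (deformationMap a s y)) := by
  have horth (u) : deformationMap a s y u ⬝ᵥ x = 0 := by
    change (y ᵥ* contractRows a u.1 + u.2 ᵥ* contractRows a s) ⬝ᵥ x = 0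
    rw [add_dotProduct, ← Matrix.dotProduct_mulVec, ← Matrix.dotProduct_mulVec, hy, hs,
      dotProduct_zero, add_zero]
  have hrange : LinearMap.range (deformationMap a s y) ≠ ⊤ := by
    intro htop
    obtain ⟨k, hk⟩ : ∃ k, x k ≠ 0 := Function.ne_iff.1 hx
    obtain ⟨u, hu⟩ := LinearMap.range_eq_top.1 htop (Pi.single k 1)
    have hu0 := horth u
    rw [hu, single_dotProduct, one_mul] at hu0
    exact hk hu0
  have hlt := Submodule.finrank_lt hrange
  have hsum := LinearMap.finrank_range_add_finrank_ker (deformationMap a s y)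
  simp only [Module.finrank_prod, Module.finrank_fin_fun] at hlt hsum
  omega

theorem exists_deformation (hx : x ≠ 0) (hs0 : s 0 = 1)
    (hys : y ᵥ* contractRows a s = 0) (hs : contractRows a s *ᵥ x = 0)
    (hy : ∀ v, y ⬝ᵥ contractRows a v *ᵥ x = 0) :
    ∃ v w, y ᵥ* contractRows a v + w ᵥ* contractRows a s = 0 ∧
      v 0 = 0 ∧ (v = 0 → ∀ c : F, c • y ≠ w) := by
  obtain ⟨u, hu, hspan⟩ : ∃ u ∈ LinearMap.ker (deformationMap a s y),
      u ∉ Submodule.span F (Set.range ![((0 : Fin 3 → F), y), (s, 0)]) := by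
    by_contra! h
    have hker := Submodule.finrank_mono (show LinearMap.ker (deformationMap a s y) ≤ _ from h)
    have hcard := finrank_range_le_card (R := F) ![((0 : Fin 3 → F), y), (s, 0)]
    have hthree := three_le_finrank_ker_deformationMap hx hs hy
    rw [Set.finrank, Fintype.card_fin] at hcard
    omega
  refine ⟨u.1 - u.1 0 • s, u.2, ?_, by simp [hs0], fun hv c hc => hspan ?_⟩
  · rw [sub_eq_add_neg, ← neg_smul, contractRows_add, contractRows_smul, Matrix.vecMul_add,
      Matrix.vecMul_smul, hys, smul_zero, add_zero]
    exact hu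
  · rw [Matrix.range_cons_cons_empty, Submodule.mem_span_pair]
    exact ⟨c, u.1 0, Prod.ext (by simpa using (sub_eq_zero.1 hv).symm) (by simpa using hc)⟩

namespace IsGeneral

variable {p : ι → Fin 3 → F}

theorem not_forall_dotProduct_mulVec_eq_zero (hp : IsGeneral a p) (hs : s ≠ 0) (hy : y ≠ 0)
    (hx : x ≠ 0) (hys : y ᵥ* contractRows a s = 0)
    (hsx : contractRows a s *ᵥ x = 0) :
    ¬ ∀ v, y ⬝ᵥ contractRows a v *ᵥ x = 0 := by
  intro hyx
  obtain ⟨j, hj⟩ : ∃ j, y j ≠ 0 := Function.ne_iff.1 hy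
  have hs0 := hp.coord_zero_ne_zero s hs
    (rowMinor_eq_zero_of_vecMul hys ⟨j, isUnit_iff_ne_zero.2 hj⟩)
  wlog hnorm : s 0 = 1 generalizing s
  · refine this (s := (s 0)⁻¹ • s) (by simp [hs, hs0]) ?_ ?_ (by simp [hs0]) (by simp [hs0])
    · rw [contractRows_smul, Matrix.vecMul_smul, hys, smul_zero]
    · rw [contractRows_smul, Matrix.smul_mulVec, hsx, smul_zero]
  obtain ⟨v, w, hvw, hv0, hw⟩ := exists_deformation hx hnorm hys hsx hyx
  have hv : v = 0 := by
    refine hp.reduced s v hnorm hv0 (rowMinor_eq_zero_of_vecMul (y := firstOrderPoint y w) ?_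
      ⟨j, ?_⟩)
    · rw [firstOrderPoint_vecMul_contractRows, hys, hvw]
      ext <;> simp [firstOrderPoint]
    · rw [isUnit_iff_isUnit_fst]
      simpa [firstOrderPoint] using hj
  have hws : w ᵥ* contractRows a s = 0 := by
    have hzero : contractRows a (0 : Fin 3 → F) = 0 := by simpa using contractRows_smul a 0 0
    rwa [hv, hzero, Matrix.vecMul_zero, zero_add] at hvw
  have hli : LinearIndependent F ![y, w] := (LinearIndependent.pair_iff' hy).2 (hw hv)
  exact one_ne_zero (congrFun (hp.reduced s ![0, 1, 0] hnorm rfl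
    (rowMinor_firstOrderPoint_eq_zero hys hws hli _)) 1)

end IsGeneral

end General

section Lines

open TrivSqZeroExt

variable {R S : Type*} [CommRing R] [CommRing S] {l m : ℕ}

/-- The maximal minors of `∑ᵢ qᵢ a(i, ·, ·)` as polynomials in `z` along the line
`q = s + z s'`. -/
def lineMinor (a : Fin l × Fin m × Fin (m + 1) → R) (s s' : Fin l → R) (k : Fin (m + 1)) :
    Polynomial R :=
  rowMinor (Polynomial.C ∘ a)
    (Polynomial.C ∘ s + (Polynomial.X : Polynomial R) • (Polynomial.C ∘ s')) k

variable (a : Fin l × Fin m × Fin (m + 1) → R) (s s' : Fin l → R) (k : Fin (m + 1))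

theorem eval₂_lineMinor (f : R →+* S) (z : S) :
    (lineMinor a s s' k).eval₂ f z = rowMinor (f ∘ a) (f ∘ s + z • (f ∘ s')) k := by
  rw [lineMinor, ← Polynomial.coe_eval₂RingHom, map_rowMinor]
  congr 1
  · ext
    simp
  · ext
    simpa using mul_comm _ z

theorem eval_lineMinor (z : R) : (lineMinor a s s' k).eval z = rowMinor a (s + z • s') k :=
  eval₂_lineMinor a s s' k (RingHom.id R) z

theorem lineMinor_eq_det : lineMinor a s s' k =
    (((Polynomial.X : Polynomial R) •
      ((contractRows a s').submatrix id k.succAbove).map Polynomial.C) +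
      ((contractRows a s).submatrix id k.succAbove).map Polynomial.C).det := by
  rw [lineMinor, rowMinor, contractRows_add, contractRows_smul, ← map_contractRows,
    ← map_contractRows]
  exact congrArg Matrix.det (add_comm _ _)

variable {a s s' k}

theorem natDegree_lineMinor (h : rowMinor a s' k ≠ 0) : (lineMinor a s s' k).natDegree = m := by
  have hle := Polynomial.natDegree_det_X_add_C_le ((contractRows a s').submatrix id k.succAbove)
    ((contractRows a s).submatrix id k.succAbove)
  have hcoeff := Polynomial.coeff_det_X_add_C_card
    ((contractRows a s').submatrix id k.succAbove) ((contractRows a s).submatrix id k.succAbove)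
  rw [← lineMinor_eq_det, Fintype.card_fin] at hle hcoeff
  exact le_antisymm hle (Polynomial.le_natDegree_of_ne_zero (hcoeff.trans_ne h))

end Lines

namespace IsGeneral

open TrivSqZeroExt

variable {F : Type*} [Field F] {n : ℕ} {ι : Type*}
  {a : Fin 3 × Fin (n + 1) × Fin (n + 2) → F} {p : ι → Fin 3 → F} {s s' : Fin 3 → F}
  {x : Fin (n + 2) → F} {k : Fin (n + 2)}

theorem natDegree_lineMinor (hp : IsGeneral a p) (hk : x k ≠ 0) (hs' : s' ≠ 0) (hs'0 : s' 0 = 0)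
    (h' : contractRows a s' *ᵥ x = 0) : (lineMinor a s s' k).natDegree = n + 1 :=
  Determinantal.natDegree_lineMinor fun h0 => hp.coord_zero_ne_zero s' hs'
    (rowMinor_eq_zero_of_mulVec h' (isUnit_iff_ne_zero.2 hk) h0) hs'0

theorem coord_zero_ne_zero_of_line [IsAlgClosed F] (hp : IsGeneral a p) (hx : x ≠ 0)
    (hli : LinearIndependent F ![s', s]) (hs'0 : s' 0 = 0) (h : contractRows a s *ᵥ x = 0)
    (h' : contractRows a s' *ᵥ x = 0) : s 0 ≠ 0 := by
  obtain ⟨k, hk⟩ : ∃ k, x k ≠ 0 := Function.ne_iff.1 hx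
  have hs' : s' ≠ 0 := hli.ne_zero 0
  obtain ⟨z, hz⟩ := IsAlgClosed.exists_root (lineMinor a s s' k) fun h0 => by
    have hdeg := hp.natDegree_lineMinor (s := s) hk hs' hs'0 h'
    rw [Polynomial.natDegree_eq_zero_iff_degree_le_zero.2 h0.le] at hdeg
    omega
  rw [Polynomial.IsRoot, eval_lineMinor] at hz
  have hne : s + z • s' ≠ 0 := fun h0 =>
    one_ne_zero (LinearIndependent.pair_iff.1 hli z 1 (by rw [one_smul, add_comm, h0])).2
  have hker : contractRows a (s + z • s') *ᵥ x = 0 := by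
    simpa using contractRows_add_smul_mulVec a h h' 1 z
  have h0 := hp.coord_zero_ne_zero _ hne
    (rowMinor_eq_zero_of_mulVec hker (isUnit_iff_ne_zero.2 hk) hz)
  simpa [hs'0] using h0

theorem derivative_lineMinor_ne_zero (hp : IsGeneral a p) (hk : x k ≠ 0) (hs : s 0 = 1)
    (hs' : s' ≠ 0) (hs'0 : s' 0 = 0) (h : contractRows a s *ᵥ x = 0)
    (h' : contractRows a s' *ᵥ x = 0) {z : F} (hz : (lineMinor a s s' k).eval z = 0) :
    (lineMinor a s s' k).derivative.eval z ≠ 0 := by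
  intro hz'
  have hpoint : inlHom F F ∘ s + (inl z + inr 1 : DualNumber F) • (inlHom F F ∘ s') =
      firstOrderPoint (s + z • s') s' := by
    ext i <;> simp [firstOrderPoint]
  have hdual : rowMinor (inlHom F F ∘ a) (firstOrderPoint (s + z • s') s') k = 0 := by
    rw [← hpoint, ← eval₂_lineMinor]
    refine (aeval_inl_add_inr _ _ _).trans ?_
    rw [hz, hz', zero_mul, inl_zero, inr_zero, add_zero]
  have hker : contractRows (inlHom F F ∘ a) (firstOrderPoint (s + z • s') s') *ᵥ
      (inlHom F F ∘ x) = 0 := by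
    rw [contractRows_firstOrderPoint_mulVec, h', ← one_smul F s,
      contractRows_add_smul_mulVec a h h']
    ext <;> simp [firstOrderPoint]
  exact hs' (hp.reduced (s + z • s') s' (by simp [hs, hs'0]) hs'0
    (rowMinor_eq_zero_of_mulVec hker ((isUnit_iff_ne_zero.2 hk).map (inlHom F F)) hdual))

theorem card_roots_lineMinor [IsAlgClosed F] [DecidableEq F] (hp : IsGeneral a p) (hk : x k ≠ 0)
    (hs : s 0 = 1) (hs' : s' ≠ 0) (hs'0 : s' 0 = 0) (h : contractRows a s *ᵥ x = 0)
    (h' : contractRows a s' *ᵥ x = 0) :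
    (lineMinor a s s' k).roots.toFinset.card = n + 1 := by
  have hdeg := hp.natDegree_lineMinor (s := s) hk hs' hs'0 h'
  have hne : lineMinor a s s' k ≠ 0 := fun h0 => by simp [h0] at hdeg
  rw [Multiset.toFinset_card_of_nodup]
  · exact (IsAlgClosed.splits _).natDegree_eq_card_roots.symm.trans hdeg
  · refine Multiset.nodup_iff_count_le_one.2 fun z => ?_
    rw [Polynomial.count_roots]
    by_contra! hz
    obtain ⟨hroot, hder⟩ := (Polynomial.one_lt_rootMultiplicity_iff_isRoot hne).1 hz
    exact hp.derivative_lineMinor_ne_zero hk hs hs' hs'0 h h' hroot hder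

theorem not_three_on_line (hp : IsGeneral a p) {c : Fin 3 → F} (hc : c ≠ 0) (e : Fin 3 ↪ ι) :
    ∃ i, c ⬝ᵥ p (e i) ≠ 0 := by
  by_contra! h
  obtain ⟨g⟩ : Nonempty (Exponent 1 ↪ Fin 3) :=
    Function.Embedding.nonempty_of_card_le (by rw [card_exponent]; decide)
  have hform : ∑ i, C (c i) * X i = (0 : MvPolynomial (Fin 3) F) := by
    refine hp.position 1 (g.trans e) _ (IsHomogeneous.sum _ _ _ fun i _ => ?_) fun i => ?_
    · simpa using (isHomogeneous_C (Fin 3) (c i)).mul (isHomogeneous_X F i)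
    · simpa [dotProduct] using h (g i)
  refine hc (_root_.funext fun i => ?_)
  simpa [Pi.single_apply] using congrArg (eval (Pi.single i 1)) hform

theorem not_mulVec_eq_zero_of_normalized [IsAlgClosed F] (hp : IsGeneral a p) (hn : 2 ≤ n)
    (hx : x ≠ 0) (hs : s 0 = 1) (hs' : s' ≠ 0) (hs'0 : s' 0 = 0)
    (h : contractRows a s *ᵥ x = 0) : contractRows a s' *ᵥ x ≠ 0 := by
  classical
  intro h'
  obtain ⟨k, hk⟩ : ∃ k, x k ≠ 0 := Function.ne_iff.1 hx
  set Z := (lineMinor a s s' k).roots.toFinset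
  have hpoint : ∀ z ∈ Z, ∃ i, s + z • s' = p i := by
    intro z hz
    have hker : contractRows a (s + z • s') *ᵥ x = 0 := by
      simpa using contractRows_add_smul_mulVec a h h' 1 z
    refine hp.complete _ (by simp [hs, hs'0])
      (rowMinor_eq_zero_of_mulVec hker (isUnit_iff_ne_zero.2 hk) ?_)
    rw [← eval_lineMinor]
    exact (Polynomial.mem_roots'.1 (Multiset.mem_toFinset.1 hz)).2
  choose i hi using hpoint
  have hinj : Function.Injective fun z : Z => i z z.2 := fun z z' hzz => by
    have hline : s + z.1 • s' = s + z'.1 • s' := by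
      rw [hi z z.2, hi z' z'.2]
      exact congrArg p hzz
    exact Subtype.ext (smul_left_injective F hs' (add_left_cancel hline))
  obtain ⟨e⟩ : Nonempty (Fin 3 ↪ Z) := Function.Embedding.nonempty_of_card_le (by
    rw [Fintype.card_fin, Fintype.card_coe, hp.card_roots_lineMinor hk hs hs' hs'0 h h']
    omega)
  have hc : ![s 1 * s' 2 - s 2 * s' 1, -s' 2, s' 1] ≠ 0 := by
    refine fun h0 => hs' (_root_.funext fun j => ?_)
    fin_cases j
    · exact hs'0
    · exact congrFun h0 2
    · simpa using congrFun h0 1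
  obtain ⟨j, hj⟩ := hp.not_three_on_line hc (e.trans ⟨_, hinj⟩)
  refine hj ?_
  simp only [Function.Embedding.trans_apply, Function.Embedding.coeFn_mk, ← hi, dotProduct,
    Fin.sum_univ_three, Pi.add_apply, Pi.smul_apply, hs, hs'0, smul_eq_mul, Matrix.cons_val]
  ring

theorem mulVec_ne_zero_of_linearIndependent [IsAlgClosed F] (hp : IsGeneral a p) (hn : 2 ≤ n)
    (hx : x ≠ 0) (hli : LinearIndependent F ![s', s]) (h : contractRows a s *ᵥ x = 0) :
    contractRows a s' *ᵥ x ≠ 0 := by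
  intro h'
  wlog hs'0 : s' 0 = 0 generalizing s s'
  · refine this (s := s') (s' := s' 0 • s + (-s 0) • s') ?_ h'
      (contractRows_add_smul_mulVec a h h' _ _) (by simp [mul_comm])
    rw [LinearIndependent.pair_iff] at hli ⊢
    intro c d hcd
    obtain ⟨hd, hc⟩ := hli (d - c * s 0) (c * s' 0) (by rw [← hcd]; module)
    have hc0 : c = 0 := (mul_eq_zero.1 hc).resolve_right hs'0
    exact ⟨hc0, by simpa [hc0] using hd⟩
  have hs0 := hp.coord_zero_ne_zero_of_line hx hli hs'0 h h'
  refine hp.not_mulVec_eq_zero_of_normalized hn (s := (s 0)⁻¹ • s) hx (by simp [hs0])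
    (hli.ne_zero 0) hs'0 ?_ h'
  rw [contractRows_smul, Matrix.smul_mulVec, h, smul_zero]

end IsGeneral

section Specialization

theorem exists_eq_prod_X_sub_C {F ι : Type*} [Field F] [IsAlgClosed F] [Fintype ι]
    {χ : Polynomial F} (h : χ.Monic) (hn : χ.natDegree = Fintype.card ι) :
    ∃ t : ι → F, χ = ∏ i, (Polynomial.X - Polynomial.C (t i)) := by
  classical
  have hcard := (IsAlgClosed.splits χ).natDegree_eq_card_roots
  let e : ι ≃ χ.roots := Fintype.equivOfCardEq <| by rw [Multiset.card_coe, ← hcard, hn]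
  refine ⟨fun i => e i, ?_⟩
  rw [Equiv.prod_comp e fun r => Polynomial.X - Polynomial.C (r : F)]
  conv_lhs => rw [← Polynomial.prod_multiset_X_sub_C_of_monic_of_roots_card_eq h hcard.symm,
    ← Multiset.map_univ]
  rfl

theorem eval_smul_of_isHomogeneous {R σ : Type*} [CommRing R] {d : ℕ} {f : MvPolynomial σ R}
    (hf : f.IsHomogeneous d) (c : R) (q : σ → R) : eval (c • q) f = c ^ d * eval q f := by
  rw [eval_eq, eval_eq, Finset.mul_sum]
  refine Finset.sum_congr rfl fun m hm => ?_
  rw [hf.degree_eq_sum_deg_support hm, ← Finset.prod_pow_eq_pow_sum]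
  simp only [Pi.smul_apply, smul_eq_mul, mul_pow, Finset.prod_mul_distrib]
  ring

theorem map_monomialVec {R S : Type*} [CommRing R] [CommRing S] (f : R →+* S) {d : ℕ}
    (p : Fin 3 → R) (m : Exponent d) : f (monomialVec d p m) = monomialVec d (f ∘ p) m := by
  simp [monomialVec, eval_monomial, Finsupp.prod]

theorem monomialVec_smul {R : Type*} [CommRing R] (d : ℕ) (c : R) (p : Fin 3 → R) :
    monomialVec d (c • p) = c ^ d • monomialVec d p := by
  ext m
  exact eval_smul_of_isHomogeneous (isHomogeneous_monomial _ m.degree_eq) c p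

theorem eq_zero_of_det_monomialVec_ne_zero {F : Type*} [Field F] {d : ℕ}
    {q : Exponent d → Fin 3 → F} (h : (Matrix.of fun m => monomialVec d (q m)).det ≠ 0)
    {f : MvPolynomial (Fin 3) F} (hf : f.IsHomogeneous d) (h0 : ∀ m, eval (q m) f = 0) :
    f = 0 := by
  have hcoeffs : coeffs d f = 0 := Matrix.eq_zero_of_mulVec_eq_zero h <| by
    ext m
    exact (eval_eq_monomialVec_dotProduct hf (q m)).symm.trans (h0 m)
  rw [← formOf_coeffs hf, hcoeffs, map_zero]

variable {F : Type*} [Field F] {n : ℕ} {ι : Type*} [Fintype ι]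

/-- A trilinear form `a` with known degeneracy points `p i` to which the generic construction
specialises without degenerating. -/
structure IsBase (a : Fin 3 × Fin (n + 1) × Fin (n + 2) → F) (p : ι → Fin 3 → F) : Prop where
  card_eq : Fintype.card ι = (n + 2).choose 2
  normalized : ∀ i, p i 0 = 1
  injective : Function.Injective fun i => p i 1
  rowMinor_eq_zero : ∀ i k, rowMinor a (p i) k = 0
  independent : ∀ c : Fin (n + 2) → F, (∀ s, ∑ k, c k * rowMinor a s k = 0) → c = 0
  position : ∀ d ≤ n, ∀ e : Exponent d ↪ ι,
    (Matrix.of fun m => monomialVec d (p (e m))).det ≠ 0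

namespace IsBase

variable {a : Fin 3 × Fin (n + 1) × Fin (n + 2) → F} {p : ι → Fin 3 → F}

theorem card_exponent_eq (hp : IsBase a p) : Fintype.card (Exponent n) = Fintype.card ι :=
  (card_exponent n).trans hp.card_eq.symm

theorem spanMap_injective (hp : IsBase a p) {w : Exponent n ⊕ Fin (n + 2) → F}
    (h : spanMap a w = 0) : w = 0 := by
  have heval (s : Fin 3 → F) : s 0 * eval s (formOf n (w ∘ Sum.inl)) +
      ∑ k, w (Sum.inr k) * rowMinor a s k = 0 := by
    simpa [spanMap_apply, eval_minorForm] using congrArg (eval s) h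
  have hform : formOf n (w ∘ Sum.inl) = 0 := by
    refine eq_zero_of_det_monomialVec_ne_zero
      (hp.position n le_rfl (Fintype.equivOfCardEq hp.card_exponent_eq).toEmbedding)
      (isHomogeneous_formOf _) fun m => ?_
    simpa [hp.normalized, hp.rowMinor_eq_zero] using
      heval (p (Fintype.equivOfCardEq hp.card_exponent_eq m))
  have hinl := (formOf_injective (hform.trans (map_zero _).symm) :)
  have hinr := hp.independent (w ∘ Sum.inr) fun s => by simpa [hform] using heval s
  rw [← Sum.elim_comp_inl_inr w, hinl, hinr]
  exact Sum.elim_const_const 0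

theorem spanDet_ne_zero (hp : IsBase a p) : spanDet a ≠ 0 := by
  intro h
  obtain ⟨w, hw, h⟩ := Matrix.exists_mulVec_eq_zero_iff.2 h
  rw [spanMatrix_mulVec] at h
  have hcoeffs : coeffs (n + 1) (spanMap a w) = 0 :=
    (Equiv.surjective _).injective_comp_right h
  refine hw (hp.spanMap_injective ?_)
  rw [← formOf_coeffs (isHomogeneous_spanMap a w), hcoeffs, map_zero]

theorem smul_injective (hp : IsBase a p) : Function.Injective fun i => spanDet a * p i 1 :=
  fun _ _ h => hp.injective (mul_left_cancel₀ hp.spanDet_ne_zero h)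

theorem charpoly_eq (hp : IsBase a p) : (mulMatrix 1 a).charpoly =
    ∏ i, (Polynomial.X - Polynomial.C (spanDet a * p i 1)) := by
  refine Polynomial.eq_of_monic_of_dvd_of_natDegree_le
    (Polynomial.monic_prod_of_monic _ _ fun _ _ => Polynomial.monic_X_sub_C _)
    (Matrix.charpoly_monic _) ?_ ?_
  · exact Finset.prod_dvd_of_coprime
      ((Polynomial.pairwise_coprime_X_sub_C hp.smul_injective).set_pairwise _) fun i _ =>
        Polynomial.dvd_iff_isRoot.2
          (eval_charpoly_mulMatrix (hp.normalized i) (hp.rowMinor_eq_zero i))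
  · rw [Matrix.charpoly_natDegree_eq_dim, Polynomial.natDegree_finsetProd_X_sub_C_eq_card,
      hp.card_exponent_eq, Finset.card_univ]

theorem krylovDet_ne_zero (hp : IsBase a p) : krylovDet a ≠ 0 := by
  let e := Fintype.equivOfCardEq hp.card_exponent_eq
  let t (k : Fin (Fintype.card (Exponent n))) : F :=
    spanDet a * p (e ((Fintype.equivFin (Exponent n)).symm k)) 1
  have hmul : (Matrix.of fun m => monomialVec n (p (e m))) *
      krylovMatrix (mulMatrix 1 a) (coeffs n (X 0 ^ n)) =
      (Matrix.vandermonde t).submatrix (Fintype.equivFin _) (Fintype.equivFin _) := by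
    ext m k
    refine (vecMul_krylovMatrix (monomialVec_vecMul_mulMatrix (hp.normalized (e m))
      (hp.rowMinor_eq_zero (e m)) 1) _ k).trans ?_
    simp [t, monomialVec_dotProduct_coeffs_X_pow, hp.normalized, Matrix.vandermonde_apply]
  have hdet := congrArg Matrix.det hmul
  rw [Matrix.det_mul, Matrix.det_submatrix_equiv_self] at hdet
  refine right_ne_zero_of_mul (hdet.trans_ne (Matrix.det_vandermonde_ne_zero_iff.2 ?_))
  exact hp.smul_injective.comp (e.injective.comp (Equiv.injective _))

end IsBase

section PositionDet

variable {R S : Type*} [CommRing R] [CommRing S]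

/-- The determinant whose vanishing says that the points whose `x₁`-coordinates correspond to the
eigenvalues `X m` lie on a curve of degree `d`; the `x₂`-coordinates are recovered through
`coordPoly`. -/
def positionDet (b : Fin 3 × Fin (n + 1) × Fin (n + 2) → R) (d : ℕ) :
    MvPolynomial (Exponent d) R :=
  (Matrix.of fun m => monomialVec d ![C (spanDet b * krylovDet b), C (krylovDet b) * X m,
    (coordPoly b).eval₂ C (X m)]).det

theorem eval₂_positionDet (f : R →+* S) (b : Fin 3 × Fin (n + 1) × Fin (n + 2) → R) (d : ℕ)
    {q : Exponent d → Fin 3 → S} (h0 : ∀ m, q m 0 = 1) (h : ∀ m k, rowMinor (f ∘ b) (q m) k = 0) :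
    eval₂ f (fun m => spanDet (f ∘ b) * q m 1) (positionDet b d) =
      ((spanDet (f ∘ b) * krylovDet (f ∘ b)) ^ d) ^ Fintype.card (Exponent d) *
        (Matrix.of fun m => monomialVec d (q m)).det := by
  have hcoord (m) : eval₂ f (fun m => spanDet (f ∘ b) * q m 1) ((coordPoly b).eval₂ C (X m)) =
      krylovDet (f ∘ b) * (spanDet (f ∘ b) * q m 2) := by
    rw [← eval_coordPoly (h0 m) (h m), ← map_coordPoly, Polynomial.eval_map, ← coe_eval₂Hom,
      Polynomial.hom_eval₂]
    congr 1
    · ext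
      simp
    · simp
  have hpoint (m) : eval₂Hom f (fun m => spanDet (f ∘ b) * q m 1) ∘
      ![C (spanDet b * krylovDet b), C (krylovDet b) * X m, (coordPoly b).eval₂ C (X m)] =
      (spanDet (f ∘ b) * krylovDet (f ∘ b)) • q m := by
    ext i
    fin_cases i
    · simp [h0, ← map_spanDet b, ← map_krylovDet _ b, -map_mul]
    · simp [← map_krylovDet _ b, mul_left_comm, mul_assoc]
    · simp [hcoord, mul_left_comm, mul_assoc]
  rw [← Matrix.det_smul, positionDet, ← coe_eval₂Hom, RingHom.map_det]
  congr 1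
  ext m m'
  rw [Matrix.smul_apply, Matrix.of_apply, ← Pi.smul_apply, ← monomialVec_smul, ← hpoint]
  exact map_monomialVec (eval₂Hom f fun m => spanDet (f ∘ b) * q m 1) _ m'

end PositionDet

end Specialization

section Generic

variable {F : Type*} [Field F] {n : ℕ} {ι : Type*} [Fintype ι]

theorem mulMatrix_X_charpoly_map (i : Fin 3) (a : Fin 3 × Fin (n + 1) × Fin (n + 2) → F) :
    (mulMatrix i (X : Fin 3 × Fin (n + 1) × Fin (n + 2) → MvPolynomial _ F)).charpoly.map (eval a) =
      (mulMatrix i a).charpoly := by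
  rw [map_charpoly_mulMatrix]
  congr 2
  ext t
  exact eval_X t

variable (F n ι) in
/-- The polynomial in the coefficients `a` whose nonvanishing makes `a` general: the
monomials `x₀ · 𝔪ⁿ` and the maximal minors are independent, the eigenvalues of multiplication by
`x₁` are distinct and determine the points, and the points are in general position. -/
def generalityPoly : MvPolynomial (Fin 3 × Fin (n + 1) × Fin (n + 2)) F :=
  spanDet X * krylovDet X *
    resolvent ι (mulMatrix 1 (X : _ → MvPolynomial (Fin 3 × Fin (n + 1) × Fin (n + 2)) F)).charpoly
      (X 0 - X 1 : MvPolynomial (Fin 2) _) *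
    ∏ d ∈ Finset.range (n + 1), resolvent ι (mulMatrix 1 X).charpoly (positionDet X d)

variable {a : Fin 3 × Fin (n + 1) × Fin (n + 2) → F} {p : ι → Fin 3 → F}

theorem eval_resolvent_X_sub_X_ne_zero_iff {A : Type*} [CommRing A] {f : A →+* F}
    {χ : Polynomial A} {t : ι → F} (h : χ.map f = ∏ i, (Polynomial.X - Polynomial.C (t i))) :
    f (resolvent ι χ (X 0 - X 1 : MvPolynomial (Fin 2) A)) ≠ 0 ↔ Function.Injective t := by
  classical
  rw [map_resolvent f h, Finset.prod_ne_zero_iff]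
  refine ⟨fun h0 i j hij => ?_, fun ht e _ => ?_⟩
  · by_contra hne
    have hinj : Function.Injective ![i, j] := by
      simpa [Function.Injective, Fin.forall_fin_two, eq_comm] using hne
    exact h0 ⟨![i, j], hinj⟩ (Finset.mem_univ _) (by simp [hij])
  · simpa [sub_eq_zero] using (ht.comp e.injective).ne (zero_ne_one (α := Fin 2))

theorem eval_generalityPoly_ne_zero_iff (h0 : ∀ i, p i 0 = 1) (h : ∀ i k, rowMinor a (p i) k = 0)
    (hχ : (mulMatrix 1 a).charpoly =
      ∏ i, (Polynomial.X - Polynomial.C (spanDet a * p i 1))) :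
    eval a (generalityPoly F n ι) ≠ 0 ↔ spanDet a ≠ 0 ∧ krylovDet a ≠ 0 ∧
      (Function.Injective fun i => spanDet a * p i 1) ∧ ∀ d ≤ n, ∀ e : Exponent d ↪ ι,
        (Matrix.of fun m => monomialVec d (p (e m))).det ≠ 0 := by
  have hX : eval a ∘ (X : Fin 3 × Fin (n + 1) × Fin (n + 2) → MvPolynomial _ F) = a :=
    _root_.funext eval_X
  have hmap := (mulMatrix_X_charpoly_map 1 a).trans hχ
  have hposition (d : ℕ) : eval a (resolvent ι (mulMatrix 1 X).charpoly (positionDet X d)) =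
      ∏ e : Exponent d ↪ ι, ((spanDet a * krylovDet a) ^ d) ^ Fintype.card (Exponent d) *
        (Matrix.of fun m => monomialVec d (p (e m))).det := by
    rw [map_resolvent _ hmap]
    refine Finset.prod_congr rfl fun e _ => ?_
    have := eval₂_positionDet (eval a) X d (q := fun m => p (e m)) (fun m => h0 _)
      (by rw [hX]; exact fun m => h _)
    rwa [hX] at this
  simp only [generalityPoly, map_mul, map_prod, map_spanDet, map_krylovDet, hX, mul_ne_zero_iff,
    Finset.prod_ne_zero_iff, hposition, eval_resolvent_X_sub_X_ne_zero_iff hmap, and_assoc]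
  refine and_congr_right fun hs => and_congr_right fun hk => and_congr_right fun _ => ?_
  simp [hs, hk]

theorem isGeneral_of_charpoly_eq (hcard : Fintype.card ι = (n + 2).choose 2)
    (hs : spanDet a ≠ 0) (hk : krylovDet a ≠ 0) (h0 : ∀ i, p i 0 = 1)
    (h : ∀ i k, rowMinor a (p i) k = 0)
    (hχ : (mulMatrix 1 a).charpoly = ∏ i, (Polynomial.X - Polynomial.C (spanDet a * p i 1)))
    (hinj : Function.Injective fun i => spanDet a * p i 1)
    (hpos : ∀ d ≤ n, ∀ e : Exponent d ↪ ι,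
      (Matrix.of fun m => monomialVec d (p (e m))).det ≠ 0) : IsGeneral a p where
  coord_zero_ne_zero _ := apply_zero_ne_zero_of_rowMinor hs
  normalized := h0
  injective i j hij := hinj (congrArg (fun q => spanDet a * q 1) hij)
  rowMinor_eq_zero := h
  complete q hq h' := by
    have hroot := eval_charpoly_mulMatrix hq h'
    rw [hχ, Polynomial.eval_prod, Finset.prod_eq_zero_iff] at hroot
    obtain ⟨i, -, hi⟩ := hroot
    rw [Polynomial.eval_sub, Polynomial.eval_X, Polynomial.eval_C, sub_eq_zero] at hi
    have h1 : q 1 = p i 1 := mul_left_cancel₀ hs hi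
    have h2 : q 2 = p i 2 := mul_left_cancel₀ hs <| mul_left_cancel₀ hk <| by
      rw [← eval_coordPoly hq h', ← eval_coordPoly (h0 i) (h i), h1]
    exact ⟨i, by ext j; fin_cases j <;> [exact hq.trans (h0 i).symm; exact h1; exact h2]⟩
  reduced _ _ := eq_zero_of_rowMinor_firstOrderPoint hs hk
    (hχ ▸ Polynomial.separable_prod_X_sub_C_iff.2 hinj)
  position d e f hf hvan := by
    have hd : d ≤ n := by
      have hle := Fintype.card_le_of_embedding e
      rw [card_exponent, hcard] at hle
      by_contra! hlt
      have hmono : (n + 3).choose 2 ≤ (d + 2).choose 2 := Nat.choose_le_choose 2 (by omega)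
      have hsucc : (n + 3).choose 2 = (n + 2).choose 1 + (n + 2).choose 2 :=
        Nat.choose_succ_succ' (n + 2) 1
      rw [Nat.choose_one_right] at hsucc
      omega
    exact eq_zero_of_det_monomialVec_ne_zero (hpos d hd e) hf hvan

theorem exists_charpoly_eq [IsAlgClosed F] (hcard : Fintype.card ι = (n + 2).choose 2)
    (hs : spanDet a ≠ 0) (hk : krylovDet a ≠ 0) :
    ∃ p : ι → Fin 3 → F, (∀ i, p i 0 = 1) ∧ (∀ i k, rowMinor a (p i) k = 0) ∧
      (mulMatrix 1 a).charpoly = ∏ i, (Polynomial.X - Polynomial.C (spanDet a * p i 1)) := by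
  obtain ⟨t, ht⟩ := exists_eq_prod_X_sub_C (ι := ι) (Matrix.charpoly_monic (mulMatrix 1 a)) <| by
    rw [Matrix.charpoly_natDegree_eq_dim, card_exponent, hcard]
  have hroot (i : ι) : (mulMatrix 1 a).charpoly.eval (t i) = 0 := by
    rw [ht, Polynomial.eval_prod]
    exact Finset.prod_eq_zero (Finset.mem_univ i) (by simp)
  choose p hp0 hp1 hp using fun i => exists_rowMinor_eq_zero_of_root hs hk (hroot i)
  exact ⟨p, hp0, hp, by simp only [hp1, ht]⟩

theorem IsBase.eval_generalityPoly_ne_zero (hp : IsBase a p) :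
    eval a (generalityPoly F n ι) ≠ 0 :=
  (eval_generalityPoly_ne_zero_iff hp.normalized hp.rowMinor_eq_zero hp.charpoly_eq).2
    ⟨hp.spanDet_ne_zero, hp.krylovDet_ne_zero, hp.smul_injective, hp.position⟩

theorem exists_isGeneral_of_eval_ne_zero [IsAlgClosed F]
    (hcard : Fintype.card ι = (n + 2).choose 2) (h : eval a (generalityPoly F n ι) ≠ 0) :
    ∃ p : ι → Fin 3 → F, IsGeneral a p := by
  have hX : eval a ∘ (X : Fin 3 × Fin (n + 1) × Fin (n + 2) → MvPolynomial _ F) = a :=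
    _root_.funext eval_X
  obtain ⟨⟨⟨hs, hk⟩, -⟩, -⟩ : ((spanDet a ≠ 0 ∧ krylovDet a ≠ 0) ∧ _) ∧ _ := by
    simpa only [generalityPoly, map_mul, map_spanDet, map_krylovDet, hX, mul_ne_zero_iff] using h
  obtain ⟨p, h0, hp, hχ⟩ := exists_charpoly_eq hcard hs hk
  obtain ⟨-, -, hinj, hpos⟩ := (eval_generalityPoly_ne_zero_iff h0 hp hχ).1 h
  exact ⟨p, isGeneral_of_charpoly_eq hcard hs hk h0 hp hχ hinj hpos⟩

end Generic

section BaseForm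

theorem signVariations_lt_card_support {P : Polynomial ℝ} (hP : P ≠ 0) :
    P.signVariations < P.support.card := by
  induction h : P.support.card using Nat.strong_induction_on generalizing P with
  | _ n ih =>
    subst h
    have hlt := Polynomial.eraseLead_support_card_lt hP
    by_cases h0 : P.eraseLead = 0
    · have hmonomial := Polynomial.eraseLead_add_monomial_natDegree_leadingCoeff P
      rw [h0, zero_add] at hmonomial
      rw [← hmonomial, Polynomial.signVariations_monomial, hmonomial]
      exact Finset.card_pos.2 (Polynomial.support_nonempty.2 hP)
    · have := ih _ hlt h0 rfl
      have := Polynomial.signVariations_le_eraseLead_succ (P := P)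
      omega

theorem roots_countP_pos_lt_card_support {P : Polynomial ℝ} (hP : P ≠ 0) :
    P.roots.countP (0 < ·) < P.support.card :=
  (Polynomial.roots_countP_pos_le_signVariations P).trans_lt (signVariations_lt_card_support hP)

theorem det_pow_ne_zero {ι : Type*} [Fintype ι] [DecidableEq ι] {x : ι → ℝ} {k : ι → ℕ}
    (hx : Function.Injective x) (hpos : ∀ i, 0 < x i) (hk : Function.Injective k) :
    (Matrix.of fun i j => x i ^ k j).det ≠ 0 := by
  intro h
  obtain ⟨v, hv, h⟩ := Matrix.exists_mulVec_eq_zero_iff.2 h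
  let P : Polynomial ℝ := ∑ j, Polynomial.monomial (k j) (v j)
  have hcoeff (j) : P.coeff (k j) = v j := by
    simp [P, Polynomial.finsetSum_coeff, Polynomial.coeff_monomial, hk.eq_iff]
  have hP : P ≠ 0 := fun h0 => hv <| by
    ext j
    rw [← hcoeff, h0, Polynomial.coeff_zero, Pi.zero_apply]
  have hsupport : P.support.card ≤ Fintype.card ι := by
    rw [← Finset.card_univ, ← Finset.card_image_of_injective _ hk]
    refine Finset.card_le_card fun m hm => ?_
    rw [Polynomial.mem_support_iff, Polynomial.finsetSum_coeff] at hm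
    obtain ⟨j, -, hj⟩ := Finset.exists_ne_zero_of_sum_ne_zero hm
    rw [Polynomial.coeff_monomial, ne_eq, ite_eq_right_iff, Classical.not_imp] at hj
    exact Finset.mem_image.2 ⟨j, Finset.mem_univ j, hj.1⟩
  have hroot (i) : x i ∈ P.roots := by
    rw [Polynomial.mem_roots hP, Polynomial.IsRoot, Polynomial.eval_finsetSum]
    simpa [Matrix.mulVec, dotProduct, mul_comm] using congrFun h i
  have hroots : Fintype.card ι ≤ P.roots.countP (0 < ·) := by
    rw [Multiset.countP_eq_card_filter, ← Finset.card_univ, ← Finset.card_image_of_injective _ hx]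
    refine Multiset.card_le_card ((Multiset.le_iff_subset (Finset.nodup _)).2 fun y hy => ?_)
    obtain ⟨i, -, rfl⟩ := Finset.mem_image.1 (Finset.mem_def.2 hy)
    exact Multiset.mem_filter.2 ⟨hroot i, hpos i⟩
  exact (roots_countP_pos_lt_card_support hP).not_ge (hsupport.trans hroots)

/-- The points `(1, t, t⁴)` for `t = 1, …, 10`, for which Descartes' rule of signs gives general
position. -/
def basePoint (i : Fin 10) : Fin 3 → ℂ :=
  ![1, ((i : ℕ) + 1 : ℂ), ((i : ℕ) + 1 : ℂ) ^ 4]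

/-- A trilinear form whose maximal minors vanish at the points `basePoint i`. Its constants come
from `y(t) = (1, t²-55t, t³-55t²+1320t, t⁶-55t⁵+1320t⁴-23170290t)`, for which `y(t)` times the
`4 × 5` matrix `contractRows baseForm (1, t, t⁴)` is `(0, 0, 0, 0, ∏ (t - i))`, the product being
over `1 ≤ i ≤ 10`. -/
def baseForm : Fin 3 × Fin 4 × Fin 5 → ℂ := fun t =>
  (![!![0, 0, 0, 0, 3628800; 0, 0, 23170290, 1705, -449768924; 1, 0, 0, 0, 0; 0, 1, 0, 0, 0],
    !![-1320, 23170290, 1274365950, 93775, -24747919460; -1, 0, 0, 55, -8409500; 0, 0, 0, 1, 0;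
      0, 0, 1, 0, 0],
    !![0, -1320, 0, -1, 3416930; 0, -1, 0, 0, -840477; 0, 0, -1, 0, -18150; 0, 0, 0, 0, 1]] :
      Fin 3 → Matrix (Fin 4) (Fin 5) ℂ) t.1 t.2.1 t.2.2

theorem contractRows_baseForm (s : Fin 3 → ℂ) : contractRows baseForm s =
    !![-1320 * s 1, 23170290 * s 1 - 1320 * s 2, 1274365950 * s 1, 93775 * s 1 - s 2,
        3628800 * s 0 - 24747919460 * s 1 + 3416930 * s 2;
      -s 1, -s 2, 23170290 * s 0, 1705 * s 0 + 55 * s 1,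
        -449768924 * s 0 - 8409500 * s 1 - 840477 * s 2;
      s 0, 0, -s 2, s 1, -18150 * s 2; 0, s 0, s 1, 0, s 2] := by
  ext j k
  fin_cases j <;> fin_cases k <;>
    simp [contractRows, baseForm, Fin.sum_univ_three, Matrix.of_apply] <;> ring

theorem rowMinor_baseForm (t : ℂ) : rowMinor baseForm ![1, t, t ^ 4] =
    (-∏ i : Fin 10, (t - ((i : ℕ) + 1))) • ![t ^ 6 + 55 * t ^ 5 + 1705 * t ^ 4 + 23170290 * t,
      t ^ 3 + 55 * t ^ 2 + 1705 * t, t ^ 2 + 55 * t + 1705, 23170290, 0] := by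
  ext k
  fin_cases k <;>
    simp [rowMinor, contractRows_baseForm, Matrix.det_succ_row_zero, Fin.sum_univ_succ,
      Fin.succAbove, Fin.prod_univ_succ] <;> ring

theorem eq_zero_of_sum_mul_rowMinor_baseForm {c : Fin 5 → ℂ}
    (h : ∀ s, ∑ k, c k * rowMinor baseForm s k = 0) : c = 0 := by
  have hpoly : Polynomial.C (c 0) * (Polynomial.X ^ 6 + Polynomial.C 55 * Polynomial.X ^ 5 +
      Polynomial.C 1705 * Polynomial.X ^ 4 + Polynomial.C 23170290 * Polynomial.X) +
      Polynomial.C (c 1) * (Polynomial.X ^ 3 + Polynomial.C 55 * Polynomial.X ^ 2 +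
        Polynomial.C 1705 * Polynomial.X) +
      Polynomial.C (c 2) * (Polynomial.X ^ 2 + Polynomial.C 55 * Polynomial.X +
        Polynomial.C 1705) + Polynomial.C (c 3 * 23170290) = 0 := by
    refine (mul_eq_zero.1 (Polynomial.funext fun t => ?_)).resolve_left
      (Polynomial.monic_prod_X_sub_C (fun i : Fin 10 => ((i : ℕ) + 1 : ℂ)) Finset.univ).ne_zero
    have hcurve := h ![1, t, t ^ 4]
    simp only [rowMinor_baseForm, Pi.smul_apply, smul_eq_mul, mul_left_comm (c _),
      ← Finset.mul_sum, Fin.sum_univ_five] at hcurve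
    rw [neg_mul, neg_eq_zero] at hcurve
    simpa [Polynomial.eval_prod] using hcurve
  have h0 : c 0 = 0 := by
    simpa [Polynomial.coeff_X, Polynomial.coeff_C] using congrArg (Polynomial.coeff · 6) hpoly
  have h1 : c 1 = 0 := by
    simpa [h0, Polynomial.coeff_X] using congrArg (Polynomial.coeff · 3) hpoly
  have h2 : c 2 = 0 := by
    simpa [h0, h1, Polynomial.coeff_X] using congrArg (Polynomial.coeff · 2) hpoly
  have h3 : c 3 = 0 := by simpa [h0, h1, h2] using congrArg (Polynomial.coeff · 0) hpoly
  have h4 : c 4 = 0 := by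
    simpa [h0, h1, h2, h3, Fin.sum_univ_succ, rowMinor, contractRows_baseForm,
      Matrix.det_succ_row_zero, Fin.succAbove] using h ![0, 1, 0]
  ext k
  fin_cases k <;> assumption

theorem monomialVec_basePoint (d : ℕ) (i : Fin 10) (m : Exponent d) :
    monomialVec d (basePoint i) m = (((((i : ℕ) + 1 : ℝ)) ^ (m.1 1 + 4 * m.1 2) : ℝ) : ℂ) := by
  simp [monomialVec, eval_monomial, Finsupp.prod_fintype, Fin.prod_univ_three, basePoint, pow_add,
    pow_mul]

theorem det_monomialVec_basePoint_ne_zero {d : ℕ} (hd : d ≤ 3) (e : Exponent d ↪ Fin 10) :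
    (Matrix.of fun m => monomialVec d (basePoint (e m))).det ≠ 0 := by
  have hpoint : Function.Injective fun m : Exponent d => ((e m : ℕ) + 1 : ℝ) := fun m m' h =>
    e.injective (Fin.ext (by simpa using h))
  have hexponent : Function.Injective fun m : Exponent d => m.1 1 + 4 * m.1 2 := by
    intro m m' h
    have hm := m.degree_eq
    have hm' := m'.degree_eq
    rw [Finsupp.degree_eq_sum, Fin.sum_univ_three] at hm hm'
    refine Subtype.ext (Finsupp.ext fun i => ?_)
    dsimp only at h
    fin_cases i <;> simp <;> omega
  have hdet := (map_ne_zero Complex.ofRealHom).2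
    (det_pow_ne_zero hpoint (fun m => by positivity) hexponent)
  rw [RingHom.map_det] at hdet
  convert! hdet
  ext m m'
  exact monomialVec_basePoint d (e m) m'

theorem isBase_baseForm : IsBase (n := 3) baseForm basePoint where
  card_eq := rfl
  normalized _ := rfl
  injective i j h := by
    have : ((i : ℕ) + 1 : ℂ) = (j : ℕ) + 1 := h
    exact Fin.ext (by simpa using this)
  rowMinor_eq_zero i k := by
    have hzero : ∏ j : Fin 10, (((i : ℕ) + 1 : ℂ) - ((j : ℕ) + 1)) = 0 :=
      Finset.prod_eq_zero (Finset.mem_univ i) (sub_self _)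
    have hminor := congrFun (rowMinor_baseForm ((i : ℕ) + 1)) k
    rw [hzero, neg_zero, zero_smul] at hminor
    exact hminor
  independent _ := eq_zero_of_sum_mul_rowMinor_baseForm
  position _ := det_monomialVec_basePoint_ne_zero

end BaseForm

section Geometry

theorem exists_ne_zero_mem_zeroLocus_minorIdeal {l m n : ℕ} (hmn : m < n)
    (a : Fin (l + 1) × Fin m × Fin n → ℂ) :
    ∃ x ≠ 0, x ∈ zeroLocus ℂ (minorIdeal (l + 1) (linearMatrix a)) := by
  obtain ⟨x, hker, hx⟩ := Submodule.exists_mem_ne_zero_of_ne_bot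
    (LinearMap.ker_ne_bot_of_finrank_lt
      (f := (contractRows a (Pi.single 0 1)).mulVecLin) (by simpa using hmn))
  exact ⟨x, hx, mem_zeroLocus_minorIdeal_of_mulVec (by simp) hker⟩

theorem zero_mem_zeroLocus_minorIdeal {l m n : ℕ} (a : Fin (l + 1) × Fin m × Fin n → ℂ) :
    0 ∈ zeroLocus ℂ (minorIdeal (l + 1) (linearMatrix a)) :=
  mem_zeroLocus_minorIdeal_of_mulVec (s := Pi.single 0 1) (by simp) (Matrix.mulVec_zero _)

namespace IsGeneral

variable {n : ℕ} {ι : Type*} {a : Fin 3 × Fin (n + 1) × Fin (n + 2) → ℂ} {p : ι → Fin 3 → ℂ}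

theorem isRegularLocalRing_minorIdeal (hp : IsGeneral a p) (hn : 2 ≤ n) {x : Fin (n + 2) → ℂ}
    (hx0 : x ≠ 0) (hx : x ∈ zeroLocus ℂ (minorIdeal 3 (linearMatrix a))) :
    IsRegularLocalRing (LocalRingAt (minorIdeal 3 (linearMatrix a)) x) ∧
      ringKrullDim (LocalRingAt (minorIdeal 3 (linearMatrix a)) x) = ((3 : ℕ) : WithBot ℕ∞) := by
  obtain ⟨j, j', hs⟩ : ∃ j j', (matrixAt a x).col j ⨯₃ (matrixAt a x).col j' ≠ 0 := by
    by_contra! hcross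
    obtain ⟨s, s', hli, hsx, hsx'⟩ := exists_linearIndependent_vecMul_eq_zero hcross
    rw [vecMul_matrixAt] at hsx hsx'
    exact hp.mulVec_ne_zero_of_linearIndependent hn hx0 hli hsx hsx'
  have hsx : contractRows a ((matrixAt a x).col j ⨯₃ (matrixAt a x).col j') *ᵥ x = 0 := by
    rw [← vecMul_matrixAt]
    ext k
    rw [vecMul_cross_col, mem_zeroLocus_minorIdeal_iff.1 hx, Pi.zero_apply]
  have hmain := isRegularLocalRing_minorIdeal_of_cross_col_ne_zero hx hs fun y hys hxy => by
    by_contra hy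
    refine hp.not_forall_dotProduct_mulVec_eq_zero hs hy hx0 hys hsx fun v => ?_
    rw [← dotProduct_matrixAt_mulVec, hxy, dotProduct_zero]
  exact ⟨hmain.1, hmain.2.trans (by congr; omega)⟩

theorem ringKrullDim_minorIdeal (hp : IsGeneral a p) (hn : 2 ≤ n) :
    ringKrullDim (MvPolynomial (Fin (n + 2)) ℂ ⧸ minorIdeal 3 (linearMatrix a)) =
      ((3 : ℕ) : WithBot ℕ∞) := by
  refine le_antisymm (ringKrullDim_quotient_le (Set.finite_singleton 0) fun x hx hx0 =>
    (hp.isRegularLocalRing_minorIdeal hn hx0 hx).2.le) ?_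
  obtain ⟨x, hx0, hx⟩ := exists_ne_zero_mem_zeroLocus_minorIdeal (Nat.lt_succ_self _) a
  rw [← (hp.isRegularLocalRing_minorIdeal hn hx0 hx).2]
  exact ringKrullDim_localRingAt_le hx

theorem singularPoints_minorIdeal (hp : IsGeneral a p) (hn : 2 ≤ n) :
    singularPoints (minorIdeal 3 (linearMatrix a)) = {0} := by
  refine Set.eq_singleton_iff_unique_mem.2 ⟨⟨zero_mem_zeroLocus_minorIdeal a,
    not_isRegularLocalRing_localRingAt (minorIdeal_le_ker_firstOrderEval_zero (by norm_num)) ?_ ?_⟩,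
    fun x ⟨hx, hsing⟩ => by_contra fun hx0 =>
      hsing (hp.isRegularLocalRing_minorIdeal hn hx0 hx).1⟩
  · rw [← (Pi.basisFun ℂ (Fin (n + 2))).span_eq]
    congr 2
    ext i : 1
    rw [Pi.basisFun_apply]
  · refine ((ringKrullDim_localRingAt_le (zero_mem_zeroLocus_minorIdeal a)).trans
      (hp.ringKrullDim_minorIdeal hn).le).trans_lt ?_
    rw [Module.finrank_fintype_fun_eq_card, Fintype.card_fin]
    exact_mod_cast (by omega : 3 < n + 2)

theorem isICMC2 {a : Fin 3 × Fin 4 × Fin 5 → ℂ} (hp : IsGeneral (n := 3) a p) :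
    IsICMC2 (linearMatrix a) := by
  have hsingular := hp.singularPoints_minorIdeal (by norm_num)
  refine ⟨⟨by norm_num, le_rfl, by norm_num, ?_⟩, hsingular ▸ rfl, Set.univ, isOpen_univ, trivial,
    by rw [Set.univ_inter, hsingular]⟩
  rw [hp.ringKrullDim_minorIdeal (by norm_num)]
  norm_num

variable {i : Fin 3} {x : Fin (n + 2) → ℂ} {s : Fin 3 → ℂ}

theorem isRegularLocalRing_tjurinaEquations (hp : IsGeneral a p)
    (hq : Sum.elim x s ∈ zeroLocus ℂ (Ideal.span (Set.range (tjurinaEquations a i))))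
    (h : ¬ (x = 0 ∧ ∀ k, rowMinor a s k = 0)) :
    IsRegularLocalRing
        (LocalRingAt (Ideal.span (Set.range (tjurinaEquations a i))) (Sum.elim x s)) ∧
      ringKrullDim (LocalRingAt (Ideal.span (Set.range (tjurinaEquations a i))) (Sum.elim x s)) =
        ((3 : ℕ) : WithBot ℕ∞) := by
  obtain ⟨hs, hsx⟩ := mem_zeroLocus_tjurinaEquations.1 hq
  have hs0 : s ≠ 0 := by
    rintro rfl
    exact zero_ne_one hs
  have hmain := Determinantal.isRegularLocalRing_tjurinaEquations hq fun y hys hxy => by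
    by_contra hy
    obtain ⟨j, hj⟩ : ∃ j, y j ≠ 0 := Function.ne_iff.1 hy
    refine h ⟨by_contra fun hx0 => ?_,
      rowMinor_eq_zero_of_vecMul hys ⟨j, isUnit_iff_ne_zero.2 hj⟩⟩
    refine hp.not_forall_dotProduct_mulVec_eq_zero hs0 hy hx0 hys hsx fun v => ?_
    rw [← dotProduct_matrixAt_mulVec, hxy, dotProduct_zero]
  exact ⟨hmain.1, hmain.2.trans (by congr; omega)⟩

theorem ringKrullDim_tjurinaEquations_le [Finite ι] (hp : IsGeneral a p) (i : Fin 3) :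
    ringKrullDim (MvPolynomial (Fin (n + 2) ⊕ Fin 3) ℂ ⧸
      Ideal.span (Set.range (tjurinaEquations a i))) ≤ ((3 : ℕ) : WithBot ℕ∞) := by
  refine ringKrullDim_quotient_le (F := Set.range fun j => Sum.elim 0 ((p j i)⁻¹ • p j))
    (Set.finite_range _) fun q hq hqF => ?_
  obtain ⟨x, s, rfl⟩ : ∃ x s, q = Sum.elim x s := ⟨_, _, (Sum.elim_comp_inl_inr q).symm⟩
  refine (hp.isRegularLocalRing_tjurinaEquations hq ?_).2.le
  rintro ⟨rfl, hminor⟩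
  obtain ⟨hs, -⟩ := mem_zeroLocus_tjurinaEquations.1 hq
  obtain ⟨j, hj⟩ := hp.eq_smul (by rintro rfl; exact zero_ne_one hs) hminor
  have hscale : s 0 * p j i = 1 := (congrFun hj i).symm.trans hs
  refine hqF ⟨j, ?_⟩
  dsimp only
  rw [hj, ← eq_inv_of_mul_eq_one_left hscale]

theorem mem_singularPoints_tjurinaIdeal [Finite ι] (hp : IsGeneral a p) (hn : 1 ≤ n)
    (hs : s i = 1) :
    Sum.elim x s ∈ singularPoints (tjurinaIdeal (linearMatrix a) i) ↔
      x = 0 ∧ ∀ k, rowMinor a s k = 0 := by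
  rw [tjurinaIdeal_linearMatrix (by omega)]
  constructor
  · rintro ⟨hq, hsing⟩
    by_contra hminor
    exact hsing (hp.isRegularLocalRing_tjurinaEquations hq hminor).1
  · rintro ⟨rfl, hminor⟩
    have hq := mem_zeroLocus_tjurinaEquations.2 ⟨hs, Matrix.mulVec_zero (contractRows a s)⟩
    obtain ⟨w, hli, hw⟩ := exists_linearIndependent_mulVec_eq_zero hminor
    refine ⟨hq, not_isRegularLocalRing_tjurinaEquations hs hli hw ?_⟩
    refine ((ringKrullDim_localRingAt_le hq).trans
      (hp.ringKrullDim_tjurinaEquations_le i)).trans_lt ?_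
    rw [Fintype.card_fin]
    exact_mod_cast (by norm_num : 3 < 4)

theorem ne_zero (hp : IsGeneral a p) (i : ι) : p i ≠ 0 := fun h =>
  zero_ne_one ((congrFun h 0).symm.trans (hp.normalized i))

/-- The points of `ℙ²` at which the maximal minors of `∑ᵢ sᵢ a(i, ·, ·)` vanish. -/
def point (hp : IsGeneral a p) (i : ι) : Projectivization ℂ (Fin 3 → ℂ) :=
  Projectivization.mk ℂ (p i) (hp.ne_zero i)

theorem exists_eq_smul_rep (hp : IsGeneral a p) (i : ι) :
    ∃ c : ℂ, c ≠ 0 ∧ p i = c • (hp.point i).rep := by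
  obtain ⟨c, hc⟩ := Projectivization.exists_smul_eq_mk_rep ℂ (p i) (hp.ne_zero i)
  exact ⟨(c⁻¹ : ℂˣ), Units.ne_zero _, (inv_smul_eq_iff.2 hc.symm).symm⟩

theorem point_injective (hp : IsGeneral a p) : Function.Injective hp.point := by
  intro i j hij
  obtain ⟨c, hc⟩ := (Projectivization.mk_eq_mk_iff' ℂ _ _ (hp.ne_zero i) (hp.ne_zero j)).1 hij
  have hc1 : c = 1 := by simpa [hp.normalized] using congrFun hc 0
  rw [hc1, one_smul] at hc
  exact hp.injective hc.symm

theorem exists_point_eq_iff (hp : IsGeneral a p) (q : Projectivization ℂ (Fin 3 → ℂ)) :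
    (∃ i, hp.point i = q) ↔ ∀ k, rowMinor a q.rep k = 0 := by
  constructor
  · rintro ⟨i, rfl⟩ k
    obtain ⟨c, hc, hrep⟩ := hp.exists_eq_smul_rep i
    have hminor := hp.rowMinor_eq_zero i k
    rw [hrep, rowMinor_smul] at hminor
    exact (mul_eq_zero.1 hminor).resolve_left (pow_ne_zero _ hc)
  · intro hminor
    obtain ⟨i, hi⟩ := hp.eq_smul q.rep_nonzero hminor
    refine ⟨i, ?_⟩
    rw [← q.mk_rep, eq_comm, point, Projectivization.mk_eq_mk_iff']
    exact ⟨q.rep 0, hi.symm⟩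

theorem inGeneralPosition [Fintype ι] [DecidableEq (Projectivization ℂ (Fin 3 → ℂ))]
    (hp : IsGeneral a p) :
    InGeneralPosition (Finset.univ.image hp.point) := by
  intro d T hT hcard f hf hzero
  have hpoint (t : T) : ∃ i, hp.point i = t := by simpa using hT t.2
  choose index hindex using hpoint
  have hinj : Function.Injective index := fun t t' h => Subtype.ext (by rw [← hindex, h, hindex])
  let e : Exponent d ≃ T := Fintype.equivOfCardEq (by rw [card_exponent, Fintype.card_coe, hcard])
  refine hp.position d (e.toEmbedding.trans ⟨index, hinj⟩) f hf fun m => ?_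
  obtain ⟨c, -, hrep⟩ := hp.exists_eq_smul_rep (index (e m))
  change eval (p (index (e m))) f = 0
  rw [hrep, eval_smul_of_isHomogeneous hf, hindex, hzero _ (e m).2, mul_zero]

theorem tjurinaSingularLocus_eq [Fintype ι] [DecidableEq (Projectivization ℂ (Fin 3 → ℂ))]
    (hp : IsGeneral a p) (hn : 1 ≤ n) :
    tjurinaSingularLocus (linearMatrix a) =
      {q | q.1 = 0 ∧ q.2 ∈ Finset.univ.image hp.point} := by
  ext ⟨x, q⟩
  have hmem : q ∈ Finset.univ.image hp.point ↔ ∀ k, rowMinor a q.rep k = 0 := by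
    rw [← hp.exists_point_eq_iff]
    simp only [Finset.mem_image, Finset.mem_univ, true_and]
  simp only [tjurinaSingularLocus, Set.mem_ofPred_eq, hmem]
  have hchart {i : Fin 3} (hi : q.rep i ≠ 0) :
      Sum.elim x ((q.rep i)⁻¹ • q.rep) ∈ singularPoints (tjurinaIdeal (linearMatrix a) i) ↔
        x = 0 ∧ ∀ k, rowMinor a q.rep k = 0 := by
    rw [hp.mem_singularPoints_tjurinaIdeal hn (inv_mul_cancel₀ hi)]
    simp only [rowMinor_smul, mul_eq_zero, pow_ne_zero _ (inv_ne_zero hi), false_or]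
  constructor
  · rintro ⟨i, hi, hsing⟩
    exact (hchart hi).1 hsing
  · intro h
    obtain ⟨i, hi⟩ : ∃ i, q.rep i ≠ 0 := Function.ne_iff.1 q.rep_nonzero
    exact ⟨i, hi, (hchart hi).2 h⟩

end IsGeneral

end Geometry

end Determinantal

end

theorem mainTheorem6 :
    ∃ g : MvPolynomial (Fin 3 × Fin 4 × Fin 5) ℂ, g ≠ 0 ∧
      ∀ a : Fin 3 × Fin 4 × Fin 5 → ℂ, MvPolynomial.eval a g ≠ 0 →
        Determinantal.IsICMC2 (Determinantal.linearMatrix a) ∧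
        ∃ S : Finset (Projectivization ℂ (Fin 3 → ℂ)),
          S.card = 10 ∧ Determinantal.InGeneralPosition S ∧
          Determinantal.tjurinaSingularLocus (Determinantal.linearMatrix a) =
            {q | q.1 = 0 ∧ q.2 ∈ S} := by
  classical
  refine ⟨Determinantal.generalityPoly ℂ 3 (Fin 10), fun h => ?_, fun a ha => ?_⟩
  · refine Determinantal.isBase_baseForm.eval_generalityPoly_ne_zero ?_
    rw [h, map_zero]
  obtain ⟨p, hp⟩ := Determinantal.exists_isGeneral_of_eval_ne_zero rfl ha
  refine ⟨hp.isICMC2, Finset.univ.image hp.point, ?_, hp.inGeneralPosition,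
    hp.tjurinaSingularLocus_eq (by norm_num)⟩
  rw [Finset.card_image_of_injective _ hp.point_injective, Finset.card_univ, Fintype.card_fin]
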